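/- **Definitions.** A *rooted Kripke model* $M=(W,R,\eta,r)$ consists of a non-empty set $W$ of worlds, a left-total relation $R\subseteq W\times W$, an assignment $\eta$ of a set of propositions to every world, and a root $r\in W$. CTL formulas are interpreted as usual, the path quantifiers ranging over infinite $R$-paths; $M\models\varphi$ means that $\varphi$ holds in $r$. A *submodel* of $M$ is a rooted Kripke model $M'=(W',R',\eta{\upharpoonright}_{W'},r)$ with $W'\subseteq W$ and $R'\subseteq R$ (so $R'$ is left-total on $W'$); it is *connected* if every world of $W'$ lies on an infinite path of $M'$ starting in $r$. For a set of deletions $D=(D_W,D_R)$, with $D_W$ a set of worlds and $D_R$ a set of pairs of worlds, $M-D$ denotes $(W\setminus D_W,R\setminus D_R,\eta{\upharpoonright}_{W\setminus D_W},r)$, provided that this is a rooted Kripke model; $D\subseteq D'$ is meant componentwise. Let $\Phi$ be the set of CTL formulas that are built from propositions and the constants $\top,\bot$ with $\mathsf{EX}$, $\mathsf{ER}$, $\mathsf{EU}$, $\wedge$, $\vee$ only (no negation). $\text{E-Submodels}(\mathsf{EX},\mathsf{ER},\mathsf{EU},\wedge,\vee)$ is the enumeration problem whose instances are the (encoded)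 pairs $\langle M,\varphi\rangle$ of a finite rooted Kripke model $M$ and a formula $\varphi\in\Phi$, and whose solutions are the connected submodels $M'$ of $M$ with $M'\models\varphi$ (each output as the pair $(W',R')$). $\text{ExtendSubmodel}$ is the decision problem: given $\langle M,\varphi,D\rangle$ with $M$ finite and $\varphi\in\Phi$, is there $D'\supseteq D$ such that $M-D'$ is a rooted Kripke model with $M-D'\models\varphi$? An enumeration problem is in $\mathsf{DelP}$ if there are a polynomial $p$ and a random access machine (with logarithmic cost, and with an oracle from $\mathsf P$) that on every instance $x$ terminates, outputs exactly the solutions of $x$ without duplicates, such that the time before the first output, between any two consecutive outputs, and after the last output is at most $p(|x|)$, and every oracle query has length at most $p(|x|)$. **Theorem.** 1. $\text{E-Submodels}(\mathsf{EX},\mathsf{ER},\mathsf{EU},\wedge,\vee)\in\mathsf{DelP}$. 2. If $M'$ is a submodel of a rooted Kripke model $M$, $\varphi\in\Phi$, and $M'\models\varphi$, then $M\models\varphi$. 3. Let $M$ be a rooted Kripke model, $\varphi\in\Phi$, and $D$ a set of deletions such that $M-D$ is a rooted Kripke model. Then there is $D'\supseteq D$ such that $M-D'$ is a rooted Kripke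 model with $M-D'\models\varphi$ if and only if $M-D\models\varphi$. 4. Given $\langle M,\varphi,D\rangle$ with $M$ finite, $\varphi\in\Phi$, and $M-D$ a rooted Kripke model, it can be decided in polynomial time whether $M-D\models\varphi$; and $\text{ExtendSubmodel}\in\mathsf P$ (for all $D$). -/

import Mathlib

namespace SubmodelEnum

/-! ### CTL -/

/-- CTL formulas over the set `P` of propositions. -/
inductive CTL (P : Type*) where
  | top : CTL P
  | prop : P → CTL P
  | neg : CTL P → CTL P
  | or : CTL P → CTL P → CTL P
  | and : CTL P → CTL P → CTL P
  | EX : CTL P → CTL P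
  | AX : CTL P → CTL P
  | EF : CTL P → CTL P
  | AF : CTL P → CTL P
  | EG : CTL P → CTL P
  | AG : CTL P → CTL P
  | EU : CTL P → CTL P → CTL P
  | AU : CTL P → CTL P → CTL P
  | ER : CTL P → CTL P → CTL P
  | AR : CTL P → CTL P → CTL P

/-- The constant false is `¬ ⊤`. -/
def CTL.bot {P : Type*} : CTL P := CTL.neg CTL.top

/-- Formulas built from propositions and the constants `⊤`, `⊥` by `EX`, `ER`, `EU`, `∧`, `∨`;
there is no negation apart from the one that abbreviates `⊥`. -/
inductive CTL.PosExistential {P : Type*} : CTL P → Prop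
  | top : PosExistential CTL.top
  | bot : PosExistential CTL.bot
  | prop (p : P) : PosExistential (CTL.prop p)
  | or {φ ψ : CTL P} : PosExistential φ → PosExistential ψ → PosExistential (CTL.or φ ψ)
  | and {φ ψ : CTL P} : PosExistential φ → PosExistential ψ → PosExistential (CTL.and φ ψ)
  | EX {φ : CTL P} : PosExistential φ → PosExistential (CTL.EX φ)
  | EU {φ ψ : CTL P} : PosExistential φ → PosExistential ψ → PosExistential (CTL.EU φ ψ)
  | ER {φ ψ : CTL P} : PosExistential φ → PosExistential ψ → PosExistential (CTL.ER φ ψ)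

/-! ### Rooted Kripke models -/

/-- A rooted Kripke model `(W, R, η, r)` whose worlds are taken from `V`. The assignment lives on
`W`; it is extended by the empty set to the other elements of `V`. -/
structure KripkeModel (V P : Type*) where
  W : Set V
  R : Set (V × V)
  η : V → Set P
  r : V
  r_mem : r ∈ W
  R_subset : R ⊆ W ×ˢ W
  R_total : ∀ u ∈ W, ∃ v, (u, v) ∈ R
  η_off : ∀ v, v ∉ W → η v = ∅

namespace KripkeModel

variable {V P : Type*}

/-- `Π(w)`: the infinite paths that start in `w` (positions are counted from `0`). -/
def paths (M : KripkeModel V P) (w : V) : Set (ℕ → V) :=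
  {π | π 0 = w ∧ ∀ i, (π i, π (i + 1)) ∈ M.R}

/-- `M, w ⊨ φ`. -/
def Sat (M : KripkeModel V P) : CTL P → V → Prop
  | .top, _ => True
  | .prop p, w => p ∈ M.η w
  | .neg φ, w => ¬ M.Sat φ w
  | .or φ ψ, w => M.Sat φ w ∨ M.Sat ψ w
  | .and φ ψ, w => M.Sat φ w ∧ M.Sat ψ w
  | .EX φ, w => ∃ π ∈ M.paths w, M.Sat φ (π 1)
  | .AX φ, w => ∀ π ∈ M.paths w, M.Sat φ (π 1)
  | .EF φ, w => ∃ π ∈ M.paths w, ∃ k, M.Sat φ (π k)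
  | .AF φ, w => ∀ π ∈ M.paths w, ∃ k, M.Sat φ (π k)
  | .EG φ, w => ∃ π ∈ M.paths w, ∀ k, M.Sat φ (π k)
  | .AG φ, w => ∀ π ∈ M.paths w, ∀ k, M.Sat φ (π k)
  | .EU φ ψ, w => ∃ π ∈ M.paths w, ∃ k, M.Sat ψ (π k) ∧ ∀ i < k, M.Sat φ (π i)
  | .AU φ ψ, w => ∀ π ∈ M.paths w, ∃ k, M.Sat ψ (π k) ∧ ∀ i < k, M.Sat φ (π i)
  | .ER φ ψ, w => ∃ π ∈ M.paths w, ∀ k, M.Sat ψ (π k) ∨ ∃ i < k, M.Sat φ (π i)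
  | .AR φ ψ, w => ∀ π ∈ M.paths w, ∀ k, M.Sat ψ (π k) ∨ ∃ i < k, M.Sat φ (π i)

/-- `M ⊨ φ`: the formula holds in the root. -/
def Models (M : KripkeModel V P) (φ : CTL P) : Prop := M.Sat φ M.r

/-- `M'` is a submodel of `M` (totality of `M'.R` is part of being a Kripke model). -/
structure IsSubmodel (M' M : KripkeModel V P) : Prop where
  W_subset : M'.W ⊆ M.W
  R_subset : M'.R ⊆ M.R
  η_eq : ∀ w ∈ M'.W, M'.η w = M.η w
  r_eq : M'.r = M.r

/-- `M'` is a connected submodel of `M`: every world of `M'` lies on a path of `M'` that starts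
in the root. -/
structure IsConnectedSubmodel (M' M : KripkeModel V P) : Prop extends IsSubmodel M' M where
  connected : ∀ w ∈ M'.W, ∃ π ∈ M'.paths M'.r, ∃ i, π i = w

/-- `M' = M - D` for a set of deletions `D = (D_W, D_R)`. As `M'` is a Kripke model, this contains
the requirement that the root is not deleted and that what is left is total. -/
structure IsDeletion (M : KripkeModel V P) (D : Set V × Set (V × V)) (M' : KripkeModel V P) :
    Prop where
  W_eq : M'.W = M.W \ D.1
  R_eq : M'.R = M.R \ D.2
  η_eq : ∀ w ∈ M'.W, M'.η w = M.η w
  r_eq : M'.r = M.r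

/-- The question of the extension problem: is there `D' ⊇ D` with `M - D' ⊨ φ`? -/
def Extendable (M : KripkeModel V P) (φ : CTL P) (D : Set V × Set (V × V)) : Prop :=
  ∃ D' : Set V × Set (V × V), D.1 ⊆ D'.1 ∧ D.2 ⊆ D'.2 ∧
    ∃ M' : KripkeModel V P, M.IsDeletion D' M' ∧ M'.Models φ

end KripkeModel

/-! ### Problems, random access machines, complexity classes -/

/-- Words over the alphabet with `k` letters. -/
abbrev Word (k : ℕ) := List (Fin k)

/-- An enumeration problem `(I, Sol)` over the alphabet with `k` letters; only the values of `Sol`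
on `I` matter. -/
structure EnumProblem (k : ℕ) where
  I : Set (Word k)
  Sol : Word k → Set (Word k)
  bounded : ∃ p : Polynomial ℕ, ∀ x ∈ I, ∀ y ∈ Sol x, y.length ≤ p.eval x.length

/-- A decision problem: a set of instances, and the property of an instance that is asked for. -/
structure DecisionProblem (k : ℕ) where
  I : Set (Word k)
  Yes : Set (Word k)

/-- A class of decision problems, over all alphabets. -/
abbrev DecisionClass := ∀ k : ℕ, Set (DecisionProblem k)

/-- Instructions of a random access machine with registers `R[0], R[1], …` that hold natural
numbers, a read-only random access input, an output, and oracle registers `O[0], O[1], …`.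

* `set i c`:    `R[i] := c`
* `add i j m`:  `R[i] := R[j] + R[m]`
* `sub i j m`:  `R[i] := R[j] - R[m]` (truncated)
* `load i j`:   `R[i] := R[R[j]]`
* `store i j`:  `R[R[i]] := R[j]`
* `input i j`:  `R[i] :=` the code of the input letter at position `R[j]`
* `jpos j m`:   jump to instruction `m` if `R[j] > 0`
* `print j`:    append the letter with code `R[j]` to the word that is being printed
* `emit`:       the word that is being printed is complete; it is output as a solution
* `ostore i j`: `O[R[i]] :=` the letter with code `R[j]`
* `query m`:    jump to instruction `m` if the oracle answers "yes" -/
inductive Instr where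
  | set (i c : ℕ)
  | add (i j m : ℕ)
  | sub (i j m : ℕ)
  | load (i j : ℕ)
  | store (i j : ℕ)
  | input (i j : ℕ)
  | jpos (j m : ℕ)
  | print (j : ℕ)
  | emit
  | ostore (i j : ℕ)
  | query (m : ℕ)

/-- Logarithmic cost of an instruction: one plus the bit lengths of the register contents that it
handles, addresses included. An oracle query is charged as a single step. -/
def Instr.cost (R : ℕ → ℕ) : Instr → ℕ
  | .set _ _ => 1
  | .add _ j m => 1 + (R j).size + (R m).size
  | .sub _ j m => 1 + (R j).size + (R m).size
  | .load _ j => 1 + (R j).size + (R (R j)).size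
  | .store i j => 1 + (R i).size + (R j).size
  | .input _ j => 1 + (R j).size
  | .jpos j _ => 1 + (R j).size
  | .print j => 1 + (R j).size
  | .emit => 1
  | .ostore i j => 1 + (R i).size + (R j).size
  | .query _ => 1

/-- The letter `a` has the code `a + 1`; the code `0` means "no letter". -/
def letterCode {k : ℕ} : Option (Fin k) → ℕ
  | none => 0
  | some a => a + 1

/-- The letter with a given code, if there is one. -/
def letterOf (k : ℕ) (c : ℕ) : Option (Fin k) :=
  if h : 0 < c ∧ c ≤ k then some ⟨c - 1, by omega⟩ else none

/-- A configuration: program counter, registers, oracle registers (`none` is "empty"), the word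
that is being printed, the solutions output so far together with the times of their output, and
the elapsed time. -/
structure Config (k l : ℕ) where
  pc : ℕ
  reg : ℕ → ℕ
  orc : ℕ → Option (Fin l)
  buf : Word k
  out : List (Word k × ℕ)
  time : ℕ

/-- Initially all registers are `0` and all oracle registers are empty. -/
def Config.init (k l : ℕ) : Config k l :=
  { pc := 0, reg := fun _ => 0, orc := fun _ => none, buf := [], out := [], time := 0 }

/-- The input of the oracle: the contents of `O[0]` and of all consecutive non-empty oracle
registers. -/
noncomputable def Config.queryWord {k l : ℕ} (c : Config k l) : Word l :=
  (List.range (sInf {n | c.orc n = none})).filterMap c.orc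

/-- A program is a finite list of instructions. -/
abbrev Program := List Instr

open Classical in
/-- One step of a program with oracle `L` on input `x`. The machine has halted when the program
counter has left the program. -/
noncomputable def step {k l : ℕ} (prog : Program) (L : Set (Word l)) (x : Word k)
    (c : Config k l) : Config k l :=
  match prog[c.pc]? with
  | none => c
  | some ins =>
    let d : Config k l := { c with pc := c.pc + 1, time := c.time + ins.cost c.reg }
    match ins with
    | .set i a => { d with reg := Function.update c.reg i a }
    | .add i j m => { d with reg := Function.update c.reg i (c.reg j + c.reg m) }
    | .sub i j m => { d with reg := Function.update c.reg i (c.reg j - c.reg m) }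
    | .load i j => { d with reg := Function.update c.reg i (c.reg (c.reg j)) }
    | .store i j => { d with reg := Function.update c.reg (c.reg i) (c.reg j) }
    | .input i j => { d with reg := Function.update c.reg i (letterCode x[c.reg j]?) }
    | .jpos j m => if 0 < c.reg j then { d with pc := m } else d
    | .print j => { d with buf := c.buf ++ (letterOf k (c.reg j)).toList }
    | .emit => { d with buf := [], out := c.out ++ [(c.buf, d.time)] }
    | .ostore i j => { d with orc := Function.update c.orc (c.reg i) (letterOf l (c.reg j)) }
    | .query m => if c.queryWord ∈ L then { d with pc := m } else d

/-- The configuration after `t` steps. -/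
noncomputable def run {k l : ℕ} (prog : Program) (L : Set (Word l)) (x : Word k) (t : ℕ) :
    Config k l :=
  (step prog L x)^[t] (Config.init k l)

/-- The program counter has left the program. -/
def Config.Halted {k l : ℕ} (prog : Program) (c : Config k l) : Prop := prog[c.pc]? = none

/-- The class of the decision problems that a machine without oracle decides in polynomial time.
As for enumeration problems, the inputs are the instances of the problem.
The answer is "yes" if the machine halts with `R[0] ≠ 0`. -/
def classP : DecisionClass := fun k =>
  {Q : DecisionProblem k | ∃ (prog : Program) (p : Polynomial ℕ), ∀ x ∈ Q.I, ∃ t : ℕ,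
    let c : Config k 0 := run prog ∅ x t
    c.Halted prog ∧ c.time ≤ p.eval x.length ∧ (c.reg 0 ≠ 0 ↔ x ∈ Q.Yes)}

/-- The program with oracle `L` terminates on input `x`, outputs exactly the elements of `S`
without duplicates, and the precomputation time, the time between two consecutive outputs and the
postcomputation time are all at most `d`. -/
def EnumeratesWithDelay {k l : ℕ} (prog : Program) (L : Set (Word l)) (x : Word k)
    (S : Set (Word k)) (d : ℕ) : Prop :=
  ∃ t : ℕ,
    let c : Config k l := run prog L x t
    c.Halted prog ∧
    (c.out.map Prod.fst).Nodup ∧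
    (∀ y, y ∈ c.out.map Prod.fst ↔ y ∈ S) ∧
    List.IsChain (fun a b => b ≤ a + d) (0 :: c.out.map Prod.snd ++ [c.time])

/-- `Del C`: the problem is enumerated with polynomial delay by a random access machine with an
oracle from `C`, and all oracle calls are on instances of the oracle problem that have polynomial
size. -/
def InDel {k : ℕ} (C : DecisionClass) (E : EnumProblem k) : Prop :=
  ∃ (l : ℕ) (Q : DecisionProblem l), Q ∈ C l ∧
    ∃ (prog : Program) (p : Polynomial ℕ), ∀ x ∈ E.I,
      EnumeratesWithDelay prog Q.Yes x (E.Sol x) (p.eval x.length) ∧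
      ∀ t m : ℕ, prog[(run prog Q.Yes x t).pc]? = some (Instr.query m) →
        (run prog Q.Yes x t).queryWord ∈ Q.I ∧
        (run prog Q.Yes x t).queryWord.length ≤ p.eval x.length

/-- `DelP`. -/
def InDelP {k : ℕ} (E : EnumProblem k) : Prop := InDel classP E

/-! ### Encodings

The alphabet has 18 letters: `0` and `1` are bits, `2` is a separator, the others are the symbols
of formulas. Propositions are natural numbers. -/

/-- A finite Kripke model with worlds from `{0, …, n - 1}`, where the finite set of propositions
of each world is given as a list. -/
structure FinModel where
  n : ℕ
  M : KripkeModel (Fin n) ℕ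
  lab : Fin n → List ℕ
  lab_spec : ∀ i p, p ∈ lab i ↔ p ∈ M.η i

/-- A proposition: its number in binary, delimited. -/
def encProp (p : ℕ) : Word 18 := 4 :: (p.bits.map (fun b => if b then 1 else 0) ++ [2])

/-- Formulas in reverse Polish notation. -/
def encFormula : CTL ℕ → Word 18
  | .top => [3]
  | .prop p => encProp p
  | .neg φ => encFormula φ ++ [5]
  | .or φ ψ => encFormula φ ++ encFormula ψ ++ [6]
  | .and φ ψ => encFormula φ ++ encFormula ψ ++ [7]
  | .EX φ => encFormula φ ++ [8]
  | .AX φ => encFormula φ ++ [9]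
  | .EF φ => encFormula φ ++ [10]
  | .AF φ => encFormula φ ++ [11]
  | .EG φ => encFormula φ ++ [12]
  | .AG φ => encFormula φ ++ [13]
  | .EU φ ψ => encFormula φ ++ encFormula ψ ++ [14]
  | .AU φ ψ => encFormula φ ++ encFormula ψ ++ [15]
  | .ER φ ψ => encFormula φ ++ encFormula ψ ++ [16]
  | .AR φ ψ => encFormula φ ++ encFormula ψ ++ [17]

open Classical in
/-- A set of worlds as a bit vector and a binary relation as an adjacency matrix (row by row). -/
noncomputable def encGraph {n : ℕ} (A : Set (Fin n)) (B : Set (Fin n × Fin n)) : Word 18 :=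
  List.ofFn (fun i : Fin n => if i ∈ A then 1 else 0) ++ [2] ++
    (List.finRange n).flatMap (fun i => List.ofFn (fun j : Fin n => if (i, j) ∈ B then 1 else 0)) ++
    [2]

/-- Worlds and transitions, the root in unary, and the propositions of each world. -/
noncomputable def encModel (F : FinModel) : Word 18 :=
  encGraph F.M.W F.M.R ++ (List.replicate (F.M.r : ℕ) 1 ++ [2]) ++
    (List.finRange F.n).flatMap (fun i => (F.lab i).flatMap encProp ++ [2])

/-- The instance `⟨M, φ⟩`. -/
noncomputable def encInstance (F : FinModel) (φ : CTL ℕ) : Word 18 := encModel F ++ encFormula φ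

/-- The instance `⟨M, φ, D⟩`. -/
noncomputable def encExtInstance (F : FinModel) (φ : CTL ℕ)
    (D : Set (Fin F.n) × Set (Fin F.n × Fin F.n)) : Word 18 :=
  encModel F ++ encGraph D.1 D.2 ++ encFormula φ

/-! ### The submodel problems -/

theorem encGraph_length {n : ℕ} (A : Set (Fin n)) (B : Set (Fin n × Fin n)) :
    (encGraph A B).length = n + 1 + n * n + 1 := by
  simp [encGraph, List.length_flatMap]
  ring

/-- Submodel enumeration for formulas from `Φ`: given `⟨M, φ⟩`, output all connected submodels `M'`
of `M` with `M' ⊨ φ`. Given `M`, a submodel `M' = (W', R', η ↾ W', r)` is determined by `W'` and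
`R'`, and it is output in this form. -/
noncomputable def ESubmodels (Φ : Set (CTL ℕ)) : EnumProblem 18 where
  I := {x | ∃ (F : FinModel) (φ : CTL ℕ), φ ∈ Φ ∧ x = encInstance F φ}
  Sol x := {y | ∃ (F : FinModel) (φ : CTL ℕ), φ ∈ Φ ∧ x = encInstance F φ ∧
    ∃ M' : KripkeModel (Fin F.n) ℕ,
      M'.IsConnectedSubmodel F.M ∧ M'.Models φ ∧ y = encGraph M'.W M'.R}
  bounded := by
    refine ⟨Polynomial.X, ?_⟩
    rintro x - y ⟨F, φ, -, rfl, M', -, -, rfl⟩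
    simp only [Polynomial.eval_X, encInstance, encModel, List.length_append, encGraph_length]
    omega

/-- The extension problem for formulas from `Φ`: given `⟨M, φ, D⟩`, is there `D' ⊇ D` with
`M - D' ⊨ φ`? -/
noncomputable def ExtendSubmodel (Φ : Set (CTL ℕ)) : DecisionProblem 18 where
  I := {x | ∃ (F : FinModel) (φ : CTL ℕ) (D : Set (Fin F.n) × Set (Fin F.n × Fin F.n)),
    φ ∈ Φ ∧ x = encExtInstance F φ D}
  Yes := {x | ∃ (F : FinModel) (φ : CTL ℕ) (D : Set (Fin F.n) × Set (Fin F.n × Fin F.n)),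
    φ ∈ Φ ∧ x = encExtInstance F φ D ∧ F.M.Extendable φ D}

/-- Model checking of `M - D` for formulas from `Φ`: given `⟨M, φ, D⟩` such that `M - D` is a
submodel of `M`, does `M - D ⊨ φ` hold? -/
noncomputable def DeletionModelChecking (Φ : Set (CTL ℕ)) : DecisionProblem 18 where
  I := {x | ∃ (F : FinModel) (φ : CTL ℕ) (D : Set (Fin F.n) × Set (Fin F.n × Fin F.n)),
    φ ∈ Φ ∧ x = encExtInstance F φ D ∧ ∃ N : KripkeModel (Fin F.n) ℕ, F.M.IsDeletion D N}
  Yes := {x | ∃ (F : FinModel) (φ : CTL ℕ) (D : Set (Fin F.n) × Set (Fin F.n × Fin F.n)),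
    φ ∈ Φ ∧ x = encExtInstance F φ D ∧
      ∃ N : KripkeModel (Fin F.n) ℕ, F.M.IsDeletion D N ∧ N.Models φ}

end SubmodelEnum

open SubmodelEnum

namespace SubmodelEnum

/-! The logical core is monotonicity. Formulas in `Φ` have only existential path quantifiers, and no
negation except in `⊥`; every path of a submodel is a path of the model, so truth is preserved from
submodels to models (`IsSubmodel.sat`). Deleting more can therefore never help, and if `M - D` is a
model, then it is itself the best extension of `D` (`extendable_iff`). If `M - D` is not total, the
same argument applies to what is left after removing all worlds without an infinite continuation:
the largest serial set `alive` (`extendable_iff_restrictModels`). Both decision problems reduce to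
computing a greatest fixed point and model checking, which is again done by fixed points on a finite
set (`sat_EU_iff`, `sat_ER_iff`).

For the enumeration, a connected submodel is determined by its transition relation (`W_eq_dom`).
Among the submodels with transitions from a set `E` there is a largest connected one, `best E`, and
if any solution lies inside `E`, then `best E` is a solution that contains it (`subset_best`,
`best_mem_solutions`). Solutions are listed in decreasing lexicographic order, starting with `best
M.R`. The next solution below `R` has a first difference `e` to `R`: it lacks `e`, agrees with `R`
before `e` and is free after `e`. For fixed `e` the largest relation of this kind is found by one
computation of `best`, and the largest `e` for which it works yields the next solution (`next_some`,
`next_none`). So each step needs polynomially many polynomial tests and only the current solution as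
memory.

The rest makes this an actual random access machine with logarithmic cost. A small language `Cmd`
updates binary relations on `{0, …, |x|}` by first-order definitions, with loops of `|x| + 1` rounds
only, so every program has a polynomial step bound by construction. It is compiled with a verified
semantics (`Cmd.code_spec`), and step counts are turned into logarithmic cost because one step
lengthens registers by at most one bit (`step_bound`). `mem_classP_of_cmd` and `inDel_of_cmd` then
leave only statements about `Cmd.eval`: parsing of the input (`Cmd.eval_parse`), model checking
(`roundOp_iterate`), pruning and the successor step. The machine carries out all tests itself, so
the oracle is never called.

Injectivity of the encoding of instances is never proved. The behaviour of a program depends on the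
word alone and is correct for every decoding of it, so any two decodings must agree
(`EnumInvariant.unique`). -/

/-! ### Reasoning about machine programs -/

/-- The program contains the code `l` from position `o` on. -/
def CodeAt (prog : Program) (o : ℕ) (l : List Instr) : Prop :=
  ∀ i, ∀ h : i < l.length, prog[o + i]? = some l[i]

theorem CodeAt.append {prog : Program} {o : ℕ} {l₁ l₂ : List Instr}
    (h : CodeAt prog o (l₁ ++ l₂)) :
    CodeAt prog o l₁ ∧ CodeAt prog (o + l₁.length) l₂ := by
  refine ⟨fun i hi => ?_, fun i hi => ?_⟩
  · have := h i (by simp; omega)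
    rwa [List.getElem_append_left hi] at this
  · have := h (l₁.length + i) (by simp; omega)
    rw [List.getElem_append_right (by omega)] at this
    simpa [Nat.add_assoc] using this

theorem CodeAt.cons {prog : Program} {o : ℕ} {a : Instr} {l : List Instr}
    (h : CodeAt prog o (a :: l)) : prog[o]? = some a ∧ CodeAt prog (o + 1) l := by
  have := CodeAt.append (l₁ := [a]) (l₂ := l) h
  exact ⟨by simpa using this.1 0 (by simp), this.2⟩

theorem codeAt_append_left (l₀ l l₁ : List Instr) :
    CodeAt (l₀ ++ l ++ l₁) l₀.length l := by
  intro i hi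
  rw [List.append_assoc, List.getElem?_append_right (by omega)]
  simp [List.getElem?_append_left, hi]

/-- The effect of an instruction on the registers. -/
def Instr.exec {k : ℕ} (x : Word k) (r : ℕ → ℕ) : Instr → ℕ → ℕ
  | .set i a => Function.update r i a
  | .add i j m => Function.update r i (r j + r m)
  | .sub i j m => Function.update r i (r j - r m)
  | .load i j => Function.update r i (r (r j))
  | .store i j => Function.update r (r i) (r j)
  | .input i j => Function.update r i (letterCode x[r j]?)
  | _ => r

/-- Instructions that only change registers. -/
def Instr.Straight : Instr → Prop
  | .set _ _ | .add _ _ _ | .sub _ _ _ | .load _ _ | .store _ _ | .input _ _ => True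
  | _ => False

/-- A Hoare triple with a bound `T` on the number of steps, for code between the positions `o` and
`o'`; the list of solutions is not changed. -/
def Triple {k l : ℕ} (prog : Program) (L : Set (Word l)) (x : Word k) (o o' T : ℕ)
    (P Q : (ℕ → ℕ) → Word k → Prop) : Prop :=
  ∀ c : Config k l, c.pc = o → P c.reg c.buf →
    ∃ t ≤ T, ((step prog L x)^[t] c).pc = o' ∧
      Q ((step prog L x)^[t] c).reg ((step prog L x)^[t] c).buf ∧
      ((step prog L x)^[t] c).out = c.out

section Triple

variable {k l : ℕ} {prog : Program} {L : Set (Word l)} {x : Word k} {o o' o'' T T' : ℕ}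
  {P P' Q Q' R : (ℕ → ℕ) → Word k → Prop}

theorem Triple.seq (h₁ : Triple prog L x o o' T P Q) (h₂ : Triple prog L x o' o'' T' Q R) :
    Triple prog L x o o'' (T + T') P R := by
  intro c hc hP
  obtain ⟨t, ht, hpc, hQ, hout⟩ := h₁ c hc hP
  obtain ⟨t', ht', hpc', hR, hout'⟩ := h₂ _ hpc hQ
  refine ⟨t' + t, by omega, ?_⟩
  rw [Function.iterate_add_apply]
  exact ⟨hpc', hR, hout'.trans hout⟩

theorem Triple.weaken (h : Triple prog L x o o' T P Q) (hT : T ≤ T')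
    (hP : ∀ r b, P' r b → P r b) (hQ : ∀ r b, Q r b → Q' r b) :
    Triple prog L x o o' T' P' Q' := by
  intro c hc hp
  obtain ⟨t, ht, h1, h2, h3⟩ := h c hc (hP _ _ hp)
  exact ⟨t, ht.trans hT, h1, hQ _ _ h2, h3⟩

theorem Triple.skip (h : ∀ r b, P r b → Q r b) : Triple prog L x o o 0 P Q :=
  fun _ hc hP => ⟨0, le_rfl, hc, h _ _ hP, rfl⟩

/-- A precondition that fixes the initial registers and the initial buffer suffices. -/
theorem Triple.of_forall
    (h : ∀ r₀ b₀, P r₀ b₀ → Triple prog L x o o' T (fun r b => r = r₀ ∧ b = b₀) Q) :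
    Triple prog L x o o' T P Q :=
  fun c hc hP => h _ _ hP c hc ⟨rfl, rfl⟩

theorem Triple.straight_one {a : Instr} (ha : prog[o]? = some a) (hs : a.Straight)
    (h : ∀ r b, P r b → Q (a.exec x r) b) : Triple prog L x o (o + 1) 1 P Q := by
  intro c hc hP
  refine ⟨1, le_rfl, ?_⟩
  have := h _ _ hP
  subst hc
  cases a <;> simp_all [step, Instr.exec, Instr.Straight]

theorem Triple.straight (code : List Instr) (hc : CodeAt prog o code)
    (hs : ∀ a ∈ code, a.Straight) (h : ∀ r b, P r b → Q (code.foldl (Instr.exec x) r) b) :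
    Triple prog L x o (o + code.length) code.length P Q := by
  induction code generalizing o P with
  | nil => exact Triple.skip h
  | cons a code ih =>
    obtain ⟨h1, h2⟩ := hc.cons
    have hstep : Triple prog L x o (o + 1) 1 P
        (fun r b => Q (code.foldl (Instr.exec x) r) b) :=
      Triple.straight_one h1 (hs a (by simp)) (fun r b hP => h r b hP)
    have := hstep.seq (ih h2 (fun a ha => hs a (by simp [ha])) (fun r b h => h))
    rw [List.length_cons, Nat.add_comm code.length 1, ← Nat.add_assoc]
    exact this

theorem Triple.print {j : ℕ} (ha : prog[o]? = some (.print j))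
    (h : ∀ r b, P r b → Q r (b ++ (letterOf k (r j)).toList)) :
    Triple prog L x o (o + 1) 1 P Q := by
  intro c hc hP
  refine ⟨1, le_rfl, ?_⟩
  have := h _ _ hP
  subst hc
  simp_all [step]

/-- Conditional jump that skips the code up to `o'`. -/
theorem Triple.jump {j : ℕ} (ha : prog[o]? = some (.jpos j o'))
    (h₁ : ∀ r b, P r b → 0 < r j → R r b)
    (h₂ : Triple prog L x (o + 1) o' T (fun r b => P r b ∧ r j = 0) R) :
    Triple prog L x o o' (T + 1) P R := by
  intro c hc hP
  subst hc
  by_cases hj : 0 < c.reg j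
  · refine ⟨1, by omega, ?_⟩
    have := h₁ _ _ hP hj
    simp_all [step]
  · have h1 : step prog L x c =
        { c with pc := c.pc + 1, time := c.time + (Instr.jpos j o').cost c.reg } := by
      simp [step, ha, hj]
    obtain ⟨t, ht, h⟩ := h₂ (step prog L x c) (by simp [h1]) (by rw [h1]; exact ⟨hP, by simp; omega⟩)
    refine ⟨t + 1, by omega, ?_⟩
    rw [Function.iterate_add_apply, Function.iterate_one]
    refine ⟨h.1, h.2.1, h.2.2.trans (by rw [h1])⟩

/-- A loop that tests at its end whether to jump back. -/
theorem Triple.doWhile {N m j : ℕ} (I : ℕ → (ℕ → ℕ) → Word k → Prop) (hN : 0 < N)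
    (hbody : ∀ i < N, Triple prog L x o m T (I i)
      (fun r b => I (i + 1) r b ∧ (0 < r j ↔ i + 1 < N)))
    (ha : prog[m]? = some (.jpos j o)) :
    Triple prog L x o (m + 1) (N * (T + 1)) (I 0) (I N) := by
  -- Induction on the number `d` of rounds that follow round `i`.
  suffices h : ∀ d i, i + d + 1 = N →
      Triple prog L x o (m + 1) ((d + 1) * (T + 1)) (I i) (I N) by
    have := h (N - 1) 0 (by omega)
    rwa [Nat.sub_add_cancel hN] at this
  intro d
  induction d with
  | zero =>
    intro i hi c hc hP
    obtain ⟨t, ht, h1, ⟨h2, h2'⟩, h3⟩ := hbody i (by omega) c hc hP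
    set c' := (step prog L x)^[t] c
    have h4 : ¬ 0 < c'.reg j := fun h => by have := h2'.1 h; omega
    have h5 : step prog L x c' =
        { c' with pc := m + 1, time := c'.time + (Instr.jpos j o).cost c'.reg } := by
      simp [step, h1, ha, h4]
    refine ⟨t + 1, by omega, ?_⟩
    rw [Function.iterate_succ_apply']
    change (step prog L x c').pc = _ ∧ _
    rw [h5]
    refine ⟨rfl, ?_, h3⟩
    rw [← hi]
    exact h2
  | succ d ih =>
    intro i hi c hc hP
    obtain ⟨t, ht, h1, ⟨h2, h2'⟩, h3⟩ := hbody i (by omega) c hc hP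
    set c' := (step prog L x)^[t] c with hc'
    have h4 : 0 < c'.reg j := h2'.2 (by omega)
    have h5 : step prog L x c' =
        { c' with pc := o, time := c'.time + (Instr.jpos j o).cost c'.reg } := by
      simp [step, h1, ha, h4]
    obtain ⟨t', ht', h6, h7, h8⟩ := ih (i + 1) (by omega) (step prog L x c') (by rw [h5])
      (by rw [h5]; exact h2)
    refine ⟨t' + (t + 1), ?_, ?_⟩
    · calc t' + (t + 1) ≤ (d + 1) * (T + 1) + (T + 1) := by omega
        _ = _ := by ring
    · rw [Function.iterate_add_apply, Function.iterate_succ_apply', ← hc']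
      exact ⟨h6, h7, h8.trans (by rw [h5]; exact h3)⟩

end Triple

/-! ### Logarithmic cost from step counts -/

/-- Instructions without oracle access whose constants are at most `C`. -/
def Instr.Fine (C : ℕ) : Instr → Prop
  | .set _ c => c ≤ C
  | .ostore _ _ => False
  | .query _ => False
  | _ => True

theorem letterCode_le {k : ℕ} (a : Option (Fin k)) : letterCode a ≤ k := by
  cases a with
  | none => simp [letterCode]
  | some a => exact a.2

theorem cost_le {r : ℕ → ℕ} {s : ℕ} (h : ∀ q, r q < 2 ^ s) (a : Instr) :
    a.cost r ≤ 1 + 2 * s := by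
  have hs : ∀ q, (r q).size ≤ s := fun q => Nat.size_le.2 (h q)
  cases a with
  | set | emit | query => simp [Instr.cost]
  | add _ j m => have := hs j; have := hs m; simp only [Instr.cost]; omega
  | sub _ j m => have := hs j; have := hs m; simp only [Instr.cost]; omega
  | load _ j => have := hs j; have := hs (r j); simp only [Instr.cost]; omega
  | store i j => have := hs i; have := hs j; simp only [Instr.cost]; omega
  | input _ j => have := hs j; simp only [Instr.cost]; omega
  | jpos j _ => have := hs j; simp only [Instr.cost]; omega
  | print j => have := hs j; simp only [Instr.cost]; omega
  | ostore i j => have := hs i; have := hs j; simp only [Instr.cost]; omega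

/-- Addition is the only instruction that can enlarge the largest register beyond the constants and
letter codes, and it at most doubles it. So one more bit per step suffices. -/
theorem step_bound {k l : ℕ} {prog : Program} {L : Set (Word l)} {x : Word k} {C s : ℕ}
    (hprog : ∀ a ∈ prog, a.Fine C) (hC : C < 2 ^ s) (hk : k < 2 ^ s) (c : Config k l)
    (hc : ∀ q, c.reg q < 2 ^ s) :
    (∀ q, (step prog L x c).reg q < 2 ^ (s + 1)) ∧
      (step prog L x c).time ≤ c.time + (1 + 2 * s) := by
  have hmono : ∀ q, c.reg q < 2 ^ (s + 1) := fun q => by have := hc q; rw [pow_succ]; omega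
  cases ha : prog[c.pc]? with
  | none => simp only [step, ha]; exact ⟨hmono, by omega⟩
  | some a =>
    have hcost := cost_le hc a
    have hfine := hprog a (List.mem_of_getElem? ha)
    have hup : ∀ i v, v < 2 ^ (s + 1) → ∀ q, Function.update c.reg i v q < 2 ^ (s + 1) := by
      intro i v hv q
      by_cases hq : q = i
      · subst hq; simpa using hv
      · simpa [hq] using hmono q
    cases a <;> simp only [step, ha]
    case set i a =>
      exact ⟨hup _ _ (by simp only [Instr.Fine] at hfine; rw [pow_succ]; omega), by omega⟩
    case add i j m =>
      exact ⟨hup _ _ (by have := hc j; have := hc m; rw [pow_succ]; omega), by omega⟩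
    case sub i j m => exact ⟨hup _ _ (by have := hmono j; omega), by omega⟩
    case load i j => exact ⟨hup _ _ (hmono _), by omega⟩
    case store i j => exact ⟨hup _ _ (hmono _), by omega⟩
    case input i j =>
      exact ⟨hup _ _ (by have := letterCode_le x[c.reg j]?; rw [pow_succ]; omega), by omega⟩
    case jpos j m => split_ifs <;> exact ⟨hmono, by simp only; omega⟩
    case print j => exact ⟨hmono, by omega⟩
    case emit => exact ⟨hmono, by omega⟩
    case ostore i j => exact ⟨hmono, by omega⟩
    case query m => split_ifs <;> exact ⟨hmono, by simp only; omega⟩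

theorem iterate_bound {k l : ℕ} {prog : Program} {L : Set (Word l)} {x : Word k} {C s : ℕ}
    (hprog : ∀ a ∈ prog, a.Fine C) (hC : C < 2 ^ s) (hk : k < 2 ^ s) (c : Config k l)
    (hc : ∀ q, c.reg q < 2 ^ s) (t : ℕ) :
    (∀ q, ((step prog L x)^[t] c).reg q < 2 ^ (s + t)) ∧
      ((step prog L x)^[t] c).time ≤ c.time + t * (1 + 2 * (s + t)) := by
  induction t with
  | zero => simpa using hc
  | succ t ih =>
    have hle : (2 : ℕ) ^ s ≤ 2 ^ (s + t) := Nat.pow_le_pow_right (by norm_num) (by omega)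
    rw [Function.iterate_succ_apply']
    obtain ⟨h1, h2⟩ := step_bound hprog (by omega) (by omega)
      ((step prog L x)^[t] c) ih.1 (L := L) (x := x)
    refine ⟨h1, h2.trans ?_⟩
    have := ih.2
    nlinarith

/-- `M` itself serves as a bound on the bit length of numbers up to `M`. This is wasteful, but `M`
will be polynomial in the input length, so the cost remains polynomial. -/
theorem time_bound {k l : ℕ} {prog : Program} {L : Set (Word l)} {x : Word k} {C M : ℕ}
    (hprog : ∀ a ∈ prog, a.Fine C) (hC : C ≤ M) (hk : k ≤ M) (c : Config k l)
    (hc : ∀ q, c.reg q ≤ M) {t T : ℕ} (ht : t ≤ T) :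
    ((step prog L x)^[t] c).time ≤ c.time + T * (1 + 2 * (M + T)) := by
  have hM : M < 2 ^ M := Nat.lt_two_pow_self
  refine ((iterate_bound hprog (hC.trans_lt hM) (hk.trans_lt hM) c
    (fun q => (hc q).trans_lt hM) t).2).trans ?_
  gcongr

/-! ### A programming language with definable updates of binary relations

Variables range over `{0, …, |x|}` where `x` is the input; programs work on binary relations
`A a` for `a < 32`, which are updated by first-order definitions. -/

/-- First-order formulas over the input word and the current relations. -/
inductive Fm where
  | inp (u c : ℕ)
  | same (u v : ℕ)
  | cst (u c : ℕ)
  | addc (u c v : ℕ)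
  | add (u v w : ℕ)
  | lt (u v : ℕ)
  | arr (a u v : ℕ)
  | not (φ : Fm)
  | and (φ ψ : Fm)
  | ex (v : ℕ) (φ : Fm)

/-- The current relations. -/
abbrev Arrays := ℕ → ℕ → ℕ → Prop

/-- Truth of a formula under an assignment `ρ`. -/
def Fm.Sat (x : Word 18) (A : Arrays) : Fm → (ℕ → ℕ) → Prop
  | .inp u c, ρ => letterCode x[ρ u]? = c
  | .same u v, ρ => letterCode x[ρ u]? = letterCode x[ρ v]?
  | .cst u c, ρ => ρ u = c
  | .addc u c v, ρ => ρ u + c = ρ v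
  | .add u v w, ρ => ρ u + ρ v = ρ w
  | .lt u v, ρ => ρ u < ρ v
  | .arr a u v, ρ => A a (ρ u) (ρ v)
  | .not φ, ρ => ¬ φ.Sat x A ρ
  | .and φ ψ, ρ => φ.Sat x A ρ ∧ ψ.Sat x A ρ
  | .ex v φ, ρ => ∃ i ≤ x.length, φ.Sat x A (Function.update ρ v i)

/-- Well-formedness relative to the bound variables `Γ`. -/
def Fm.wf : List ℕ → Fm → Bool
  | Γ, .inp u c => Γ.contains u && decide (c ≤ 64)
  | Γ, .same u v => Γ.contains u && Γ.contains v
  | Γ, .cst u c => Γ.contains u && decide (c ≤ 64)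
  | Γ, .addc u c v => Γ.contains u && Γ.contains v && decide (c ≤ 64)
  | Γ, .add u v w => Γ.contains u && Γ.contains v && Γ.contains w
  | Γ, .lt u v => Γ.contains u && Γ.contains v
  | Γ, .arr a u v => Γ.contains u && Γ.contains v && decide (a < 32)
  | Γ, .not φ => φ.wf Γ
  | Γ, .and φ ψ => φ.wf Γ && ψ.wf Γ
  | Γ, .ex v φ => !Γ.contains v && φ.wf (v :: Γ)

/-- The formula mentions the relation `a`. -/
def Fm.mentions (a : ℕ) : Fm → Bool
  | .arr b _ _ => a == b
  | .not φ => φ.mentions a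
  | .and φ ψ => φ.mentions a || ψ.mentions a
  | .ex _ φ => φ.mentions a
  | _ => false

/-- Needed for assignments: while a relation is being overwritten cell by cell, the defining formula
must keep its old meaning. -/
theorem Fm.sat_congr {x : Word 18} {A A' : Arrays} (φ : Fm) (ρ : ℕ → ℕ)
    (hA : ∀ a, φ.mentions a = true → A a = A' a) : φ.Sat x A ρ ↔ φ.Sat x A' ρ := by
  induction φ generalizing ρ with
  | arr a u v => simp only [Fm.Sat]; rw [hA a (by simp [mentions])]
  | not φ ih => exact not_congr (ih ρ hA)
  | and φ ψ ih₁ ih₂ =>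
    exact and_congr (ih₁ ρ fun a h => hA a (by simp [mentions, h]))
      (ih₂ ρ fun a h => hA a (by simp [mentions, h]))
  | ex v φ ih => exact exists_congr fun i => and_congr_right fun _ => ih _ hA
  | _ => exact Iff.rfl

/-! ### Register layout and compilation of formulas -/

/-- Registers of the variable `v`: its value, and its multiples for the address computation. -/
def rv (v : ℕ) : ℕ := 8 * v + 21
/-- The register of a multiple of the variable `v`. -/
def rk (v : ℕ) : ℕ := 8 * v + 23
/-- The register of a multiple of the variable `v`. -/
def rs (v : ℕ) : ℕ := 8 * v + 25
/-- Registers for truth values. -/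
def re (e : ℕ) : ℕ := 8 * e + 27

/-- The address of the truth value of `A a i j`. -/
def cell (B a i j : ℕ) : ℕ := 2 * a + 64 * (B + 1) * i + 64 * j

/-- The value `1` if `p` and `q` hold equal values, `0` otherwise. -/
def eqCode (p q e : ℕ) : List Instr :=
  [.sub 13 p q, .sub 15 q p, .add 13 13 15, .sub (re e) 1 13]

/-- A loop in which the variable `v` runs through `{0, …, |x|}`. -/
def loopCode (o v : ℕ) (body : List Instr) : List Instr :=
  [.set (rv v) 0, .set (rk v) 0, .set (rs v) 0] ++
    (body ++ [.add (rv v) (rv v) 1, .add (rk v) (rk v) 5, .add (rs v) (rs v) 7, .sub 9 3 (rv v),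
      .jpos 9 (o + 3)])

/-- Code for the address of a cell. -/
def cellCode (a u v : ℕ) : List Instr := [.set 9 (2 * a), .add 9 9 (rs u), .add 9 9 (rk v)]

/-- Code that evaluates a formula. -/
def Fm.code : ℕ → ℕ → Fm → List Instr
  | _, e, .inp u c => [.input 9 (rv u), .set 11 c] ++ eqCode 9 11 e
  | _, e, .same u v => [.input 9 (rv u), .input 11 (rv v)] ++ eqCode 9 11 e
  | _, e, .cst u c => [.set 9 c] ++ eqCode 9 (rv u) e
  | _, e, .addc u c v => [.set 9 c, .add 9 9 (rv u)] ++ eqCode 9 (rv v) e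
  | _, e, .add u v w => [.add 9 (rv u) (rv v)] ++ eqCode 9 (rv w) e
  | _, e, .lt u v => [.sub 9 (rv v) (rv u), .sub 9 1 9, .sub (re e) 1 9]
  | _, e, .arr a u v => cellCode a u v ++ [.load (re e) 9]
  | o, e, .not φ => φ.code o e ++ [.sub (re e) 1 (re e)]
  | o, e, .and φ ψ => φ.code o e ++ (ψ.code (o + (φ.code o e).length) (e + 1) ++
      [.add (re e) (re e) (re (e + 1)), .sub (re e) (re e) 1])
  | o, e, .ex v φ => [.set (re e) 0] ++ loopCode (o + 1) v (φ.code (o + 4) (e + 1) ++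
      [.add (re e) (re e) (re (e + 1)), .sub 9 1 (re e), .sub (re e) 1 9])

open Polynomial in
/-- Bound on the number of steps of the evaluation, as a function of the length of the input. -/
noncomputable def Fm.time : Fm → Polynomial ℕ
  | .not φ => φ.time + 1
  | .and φ ψ => φ.time + (ψ.time + 2)
  | .ex _ φ => 1 + (3 + (X + 1) * (φ.time + 3 + 4 + 1))
  | _ => 6

open Classical in
/-- Truth values as numbers. -/
noncomputable def truth (p : Prop) : ℕ := if p then 1 else 0

theorem truth_pos {p : Prop} (h : p) : truth p = 1 := if_pos h

theorem truth_neg {p : Prop} (h : ¬ p) : truth p = 0 := if_neg h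

theorem truth_le (p : Prop) : truth p ≤ 1 := by unfold truth; split_ifs <;> simp

theorem truth_congr {p q : Prop} (h : p ↔ q) : truth p = truth q := by rw [propext h]

theorem truth_not (p : Prop) : truth (¬ p) = 1 - truth p := by
  by_cases h : p <;> simp [truth, h]

theorem truth_and (p q : Prop) : truth (p ∧ q) = truth p + truth q - 1 := by
  by_cases h : p <;> by_cases h' : q <;> simp [truth, h, h']

theorem truth_or (p q : Prop) : truth (p ∨ q) = 1 - (1 - (truth p + truth q)) := by
  by_cases h : p <;> by_cases h' : q <;> simp [truth, h, h']

/-- The bound for all register contents. -/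
def regBound (B : ℕ) : ℕ := 64 * (B + 2) * (B + 2) + 64

/-- The registers represent the relations `A` and the values `ρ` of the variables `Γ`. -/
structure Inv (x : Word 18) (Γ : List ℕ) (ρ : ℕ → ℕ) (A : Arrays) (r : ℕ → ℕ) : Prop where
  one : r 1 = 1
  cnt : r 3 = x.length + 1
  row : r 5 = 64
  stride : r 7 = 64 * (x.length + 1)
  le : ∀ v ∈ Γ, ρ v ≤ x.length
  var : ∀ v ∈ Γ, r (rv v) = ρ v
  varK : ∀ v ∈ Γ, r (rk v) = 64 * ρ v
  varS : ∀ v ∈ Γ, r (rs v) = 64 * (x.length + 1) * ρ v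
  arr : ∀ a < 32, ∀ i ≤ x.length, ∀ j ≤ x.length,
    r (cell x.length a i j) = truth (A a i j)
  bd : ∀ q, r q ≤ regBound x.length

/-- Changing scratch registers, truth values and variables outside `Γ` does not matter. -/
theorem Inv.congr {x : Word 18} {Γ : List ℕ} {ρ : ℕ → ℕ} {A : Arrays} {r r' : ℕ → ℕ}
    (h : Inv x Γ ρ A r)
    (hr : ∀ q, q = 1 ∨ q = 3 ∨ q = 5 ∨ q = 7 ∨ q % 2 = 0 ∨
      (∃ v ∈ Γ, q = rv v ∨ q = rk v ∨ q = rs v) → r' q = r q)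
    (hb : ∀ q, r' q ≤ regBound x.length) : Inv x Γ ρ A r' where
  one := by rw [hr _ (by simp)]; exact h.one
  cnt := by rw [hr _ (by simp)]; exact h.cnt
  row := by rw [hr _ (by simp)]; exact h.row
  stride := by rw [hr _ (by simp)]; exact h.stride
  le := h.le
  var v hv := by
    rw [hr _ (.inr <| .inr <| .inr <| .inr <| .inr ⟨v, hv, by simp⟩)]; exact h.var v hv
  varK v hv := by
    rw [hr _ (.inr <| .inr <| .inr <| .inr <| .inr ⟨v, hv, by simp⟩)]; exact h.varK v hv
  varS v hv := by
    rw [hr _ (.inr <| .inr <| .inr <| .inr <| .inr ⟨v, hv, by simp⟩)]; exact h.varS v hv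
  arr a ha i hi j hj := by
    rw [hr _ (.inr <| .inr <| .inr <| .inr <| .inl ?_)]
    · exact h.arr a ha i hi j hj
    -- Cells have even addresses, whereas constants, scratch registers, variables and truth values
    -- sit in odd registers of disjoint residue classes or below 16.
    · unfold cell
      rw [show 2 * a + 64 * (x.length + 1) * i + 64 * j =
        2 * (a + 32 * (x.length + 1) * i + 32 * j) by ring, Nat.mul_mod_right]
  bd := hb

theorem Inv.congr_arr {x : Word 18} {Γ : List ℕ} {ρ : ℕ → ℕ} {A A' : Arrays} {r : ℕ → ℕ}
    (h : Inv x Γ ρ A r)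
    (hA : ∀ a, ∀ i ≤ x.length, ∀ j ≤ x.length, A a i j ↔ A' a i j) : Inv x Γ ρ A' r where
  __ := h
  arr a ha i hi j hj := by rw [h.arr a ha i hi j hj]; rw [truth_congr (hA a i hi j hj)]

theorem Inv.tail {x : Word 18} {Γ : List ℕ} {ρ : ℕ → ℕ} {A : Arrays} {r : ℕ → ℕ} {v i : ℕ}
    (hv : v ∉ Γ) (h : Inv x (v :: Γ) (Function.update ρ v i) A r) : Inv x Γ ρ A r := by
  have hne : ∀ w ∈ Γ, Function.update ρ v i w = ρ w := fun w hw =>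
    Function.update_of_ne (fun h : w = v => hv (h ▸ hw)) _ _
  exact
  { h with
    le := fun w hw => by rw [← hne w hw]; exact h.le w (by simp [hw])
    var := fun w hw => by rw [← hne w hw]; exact h.var w (by simp [hw])
    varK := fun w hw => by rw [← hne w hw]; exact h.varK w (by simp [hw])
    varS := fun w hw => by rw [← hne w hw]; exact h.varS w (by simp [hw]) }

theorem Inv.cons {x : Word 18} {Γ : List ℕ} {ρ : ℕ → ℕ} {A : Arrays} {r : ℕ → ℕ} {v i : ℕ}
    (hv : v ∉ Γ) (h : Inv x Γ ρ A r) (hi : i ≤ x.length) (h₁ : r (rv v) = i)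
    (h₂ : r (rk v) = 64 * i) (h₃ : r (rs v) = 64 * (x.length + 1) * i) :
    Inv x (v :: Γ) (Function.update ρ v i) A r := by
  have hne : ∀ w ∈ Γ, Function.update ρ v i w = ρ w := fun w hw =>
    Function.update_of_ne (fun h : w = v => hv (h ▸ hw)) _ _
  exact
  { h with
    le := fun w hw => by
      rcases List.mem_cons.1 hw with rfl | hw
      · simpa using hi
      · rw [hne w hw]; exact h.le w hw
    var := fun w hw => by
      rcases List.mem_cons.1 hw with rfl | hw
      · simpa using h₁
      · rw [hne w hw]; exact h.var w hw
    varK := fun w hw => by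
      rcases List.mem_cons.1 hw with rfl | hw
      · simpa using h₂
      · rw [hne w hw]; exact h.varK w hw
    varS := fun w hw => by
      rcases List.mem_cons.1 hw with rfl | hw
      · simpa using h₃
      · rw [hne w hw]; exact h.varS w hw }

theorem regBound_ge {B i j c : ℕ} (hi : i ≤ B + 1) (hj : j ≤ B + 1) (hc : c ≤ 64) :
    c + 64 * (B + 1) * i + 64 * j ≤ regBound B := by
  unfold regBound
  have : 64 * (B + 1) * i ≤ 64 * (B + 1) * (B + 1) := Nat.mul_le_mul_left _ hi
  nlinarith

theorem le_regBound {B q : ℕ} (h : q ≤ 64 * (B + 1) + 64) : q ≤ regBound B := by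
  have := regBound_ge (B := B) (i := 0) (j := B + 1) (c := 64) (by omega) (by omega) (by omega)
  omega

theorem update_le {r : ℕ → ℕ} {M i c : ℕ} (h : ∀ q, r q ≤ M) (hc : c ≤ M) :
    ∀ q, Function.update r i c q ≤ M := by
  intro q
  by_cases hq : q = i
  · subst hq; simpa using hc
  · simpa [hq] using h q

section Loop

variable {l : ℕ} {prog : Program} {L : Set (Word l)} {x : Word 18}

/-- The rule for loops over a variable. -/
theorem Triple.loop {Γ : List ℕ} {ρ : ℕ → ℕ} {o v T : ℕ} {body : List Instr}
    (hv : v ∉ Γ) (E : ℕ → Arrays → (ℕ → ℕ) → Word 18 → Prop)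
    (hcode : CodeAt prog o (loopCode o v body))
    (hE : ∀ i A r r' b, (∀ q, q ≠ rv v → q ≠ rk v → q ≠ rs v → q ≠ 9 → r' q = r q) →
      E i A r b → E i A r' b)
    (hbody : ∀ i ≤ x.length, Triple prog L x (o + 3) (o + 3 + body.length) T
      (fun r b => ∃ A, Inv x (v :: Γ) (Function.update ρ v i) A r ∧ E i A r b)
      (fun r b => ∃ A, Inv x (v :: Γ) (Function.update ρ v i) A r ∧ E (i + 1) A r b)) :
    Triple prog L x o (o + (loopCode o v body).length) (3 + (x.length + 1) * (T + 4 + 1))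
      (fun r b => ∃ A, Inv x Γ ρ A r ∧ E 0 A r b)
      (fun r b => ∃ A, Inv x Γ ρ A r ∧ E (x.length + 1) A r b) := by
  have hpos : 0 < x.length + 1 := Nat.succ_pos _
  -- Between rounds the loop variable is outside the scope `Γ`, so its three registers are tracked
  -- separately; `Inv.cons` and `Inv.tail` enter and leave the scope.
  let I : ℕ → (ℕ → ℕ) → Word 18 → Prop := fun i r b =>
    r (rv v) = i ∧ r (rk v) = 64 * i ∧ r (rs v) = 64 * (x.length + 1) * i ∧
      ∃ A, Inv x Γ ρ A r ∧ E i A r b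
  unfold loopCode at hcode
  obtain ⟨hc1, hc2⟩ := hcode.append
  obtain ⟨hc3, hc4⟩ := hc2.append
  have hc4' : CodeAt prog (o + 3 + body.length) ([.add (rv v) (rv v) 1, .add (rk v) (rk v) 5,
    .add (rs v) (rs v) 7, .sub 9 3 (rv v)] ++ [.jpos 9 (o + 3)]) := hc4
  obtain ⟨hc5, hc6⟩ := hc4'.append
  have hne : ∀ w ∈ Γ, w ≠ v := fun w hw h => hv (h ▸ hw)
  have hinit : Triple prog L x o (o + 3) 3
      (fun r b => ∃ A, Inv x Γ ρ A r ∧ E 0 A r b) (I 0) := by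
    refine Triple.straight _ hc1 (by simp [Instr.Straight]) ?_
    rintro r b ⟨A, hI, hA⟩
    simp only [List.foldl, Instr.exec]
    refine ⟨by simp [rv, rk, rs], by simp [rk, rs], by simp, A, ?_, ?_⟩
    · refine hI.congr ?_ (update_le (update_le (update_le hI.bd (Nat.zero_le _))
        (Nat.zero_le _)) (Nat.zero_le _))
      intro q hq
      have : q ≠ rv v ∧ q ≠ rk v ∧ q ≠ rs v := by
        simp only [rv, rk, rs] at hq ⊢
        rcases hq with h | h | h | h | h | ⟨w, hw, h⟩
        · omega
        · omega
        · omega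
        · omega
        · omega
        · have := hne w hw; omega
      simp [Function.update_of_ne, this]
    · refine hE 0 A r _ b ?_ hA
      intro q h1 h2 h3 h4
      simp [Function.update_of_ne, *]
  have hstep : ∀ i < x.length + 1, Triple prog L x (o + 3) (o + 3 + body.length + 4) (T + 4) (I i)
      (fun r b => I (i + 1) r b ∧ (0 < r 9 ↔ i + 1 < x.length + 1)) := by
    intro i hi
    have h1 : Triple prog L x (o + 3) (o + 3 + body.length) T (I i)
      (fun r b => ∃ A, Inv x (v :: Γ) (Function.update ρ v i) A r ∧ E (i + 1) A r b) := by
      refine (hbody i (by omega)).weaken le_rfl ?_ (fun _ _ h => h)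
      rintro r b ⟨h1, h2, h3, A, h4, h5⟩
      exact ⟨A, h4.cons hv (by omega) h1 h2 h3, h5⟩
    refine h1.seq (Triple.straight _ hc5 (by simp [Instr.Straight]) ?_)
    rintro r b ⟨A, hI, hA⟩
    have e1 : r (rv v) = i := by simpa using hI.var v (by simp)
    have e2 : r (rk v) = 64 * i := by simpa using hI.varK v (by simp)
    have e3 : r (rs v) = 64 * (x.length + 1) * i := by simpa using hI.varS v (by simp)
    set r' := List.foldl (Instr.exec x) r [Instr.add (rv v) (rv v) 1, Instr.add (rk v) (rk v) 5,
      Instr.add (rs v) (rs v) 7, Instr.sub 9 3 (rv v)] with hr'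
    simp only [List.foldl, Instr.exec] at hr'
    have f1 : r' (rv v) = i + 1 := by
      have h1 := hI.one
      rw [hr']; simp [rv, rk, rs] at e1 ⊢; omega
    have f2 : r' (rk v) = 64 * (i + 1) := by
      rw [hr', Nat.mul_add, ← e2, Nat.mul_one, ← hI.row]; simp [rv, rk, rs]
    have f3 : r' (rs v) = 64 * (x.length + 1) * (i + 1) := by
      rw [hr', Nat.mul_add _ i, ← e3, Nat.mul_one, ← hI.stride]
      simp [rv, rk, rs]
    -- The subtraction is truncated, so this is positive exactly if another round is due.
    have f4 : r' 9 = x.length + 1 - (i + 1) := by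
      have h1 := hI.one
      have h2 := hI.cnt
      rw [hr']; simp [rv, rk, rs] at e1 ⊢; omega
    have f5 : ∀ q, q ≠ rv v → q ≠ rk v → q ≠ rs v → q ≠ 9 → r' q = r q := by
      intro q h1 h2 h3 h4
      rw [hr']; simp [Function.update_of_ne, *]
    clear_value r'
    refine ⟨⟨f1, f2, f3, A, ?_, hE _ A r _ b f5 hA⟩, by omega⟩
    · refine (hI.tail hv).congr ?_ ?_
      · intro q hq
        have : q ≠ rv v ∧ q ≠ rk v ∧ q ≠ rs v ∧ q ≠ 9 := by
          simp only [rv, rk, rs] at hq ⊢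
          rcases hq with h | h | h | h | h | ⟨w, hw, h⟩
          · omega
          · omega
          · omega
          · omega
          · omega
          · have := hne w hw; omega
        exact f5 q this.1 this.2.1 this.2.2.1 this.2.2.2
      · intro q
        by_cases h1 : q = rv v
        · rw [h1, f1]; exact le_regBound (by omega)
        by_cases h2 : q = rk v
        · rw [h2, f2]; exact le_regBound (by omega)
        by_cases h3 : q = rs v
        · rw [h3, f3]
          have := regBound_ge (B := x.length) (i := i + 1) (j := 0) (c := 0) (by omega) (by omega)
            (by omega)
          omega
        by_cases h4 : q = 9
        · rw [h4, f4]; exact le_regBound (by omega)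
        rw [f5 q h1 h2 h3 h4]
        exact hI.bd q
  have hjump : prog[o + 3 + body.length + 4]? = some (.jpos 9 (o + 3)) := hc6.cons.1
  have hloop := Triple.doWhile I hpos hstep hjump
  have hlen : o + (loopCode o v body).length = o + 3 + body.length + 4 + 1 := by
    simp [loopCode]; omega
  rw [hlen]
  refine (hinit.seq hloop).weaken le_rfl (fun _ _ h => h) ?_
  rintro r b ⟨-, -, -, A, h⟩
  exact ⟨A, h⟩

end Loop

section Code

variable {l : ℕ} {prog : Program} {L : Set (Word l)} {x : Word 18}

theorem Inv.scratch {Γ : List ℕ} {ρ : ℕ → ℕ} {A : Arrays} {r r' : ℕ → ℕ} {e : ℕ}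
    (h : Inv x Γ ρ A r)
    (hr : ∀ q, q ≠ 9 → q ≠ 11 → q ≠ 13 → q ≠ 15 → q ≠ re e → r' q = r q)
    (h₁ : r' 9 ≤ regBound x.length) (h₂ : r' 11 ≤ regBound x.length)
    (h₃ : r' 13 ≤ regBound x.length) (h₄ : r' 15 ≤ regBound x.length) 
    (h₅ : r' (re e) ≤ regBound x.length) :
    Inv x Γ ρ A r' := by
  refine h.congr (fun q hq => ?_) (fun q => ?_)
  · have : q ≠ 9 ∧ q ≠ 11 ∧ q ≠ 13 ∧ q ≠ 15 ∧ q ≠ re e := by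
      simp only [rv, rk, rs, re] at hq ⊢
      rcases hq with h | h | h | h | h | ⟨w, -, h⟩ <;> omega
    exact hr q this.1 this.2.1 this.2.2.1 this.2.2.2.1 this.2.2.2.2
  · by_cases q1 : q = 9
    · rwa [q1]
    by_cases q2 : q = 11
    · rwa [q2]
    by_cases q3 : q = 13
    · rwa [q3]
    by_cases q4 : q = 15
    · rwa [q4]
    by_cases q5 : q = re e
    · rwa [q5]
    rw [hr q q1 q2 q3 q4 q5]
    exact h.bd q

/-- The state after the evaluation of a formula. -/
def Evaluated (x : Word 18) (Γ : List ℕ) (ρ : ℕ → ℕ) (A : Arrays) (e : ℕ) (p : Prop)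
    (r₀ : ℕ → ℕ) (b₀ : Word 18) (r : ℕ → ℕ) (b : Word 18) : Prop :=
  Inv x Γ ρ A r ∧ b = b₀ ∧ r (re e) = truth p ∧ ∀ e' < e, r (re e') = r₀ (re e')

theorem Evaluated.of_scratch {Γ : List ℕ} {ρ : ℕ → ℕ} {A : Arrays} {e : ℕ} {p : Prop}
    {r₀ r : ℕ → ℕ} {b : Word 18} (h : Inv x Γ ρ A r₀)
    (hr : ∀ q, q ≠ 9 → q ≠ 11 → q ≠ 13 → q ≠ 15 → q ≠ re e → r q = r₀ q)
    (h₁ : r 9 ≤ regBound x.length) (h₂ : r 11 ≤ regBound x.length)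
    (h₃ : r 13 ≤ regBound x.length) (h₄ : r 15 ≤ regBound x.length)
    (h₅ : r (re e) = truth p) : Evaluated x Γ ρ A e p r₀ b r b := by
  refine ⟨h.scratch hr h₁ h₂ h₃ h₄ 
    (by rw [h₅]; exact (truth_le p).trans (le_regBound (by omega))), rfl,
    by rw [h₅], fun e' he' => hr _ ?_ ?_ ?_ ?_ ?_⟩ <;> simp only [re] <;> omega

/-- With truncated subtraction, `(p - q) + (q - p)` is the distance of the two values, and one minus
it is the truth value of their equality. The operands must avoid 13 and 15, which the comparison
overwrites. -/
theorem Evaluated.of_eqCode {Γ : List ℕ} {ρ : ℕ → ℕ} {A : Arrays} {e p q : ℕ} {P : Prop}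
    {r₀ r : ℕ → ℕ} {b : Word 18} (h : Inv x Γ ρ A r₀)
    (hr : ∀ q, q ≠ 9 → q ≠ 11 → r q = r₀ q)
    (h₁ : r 9 ≤ regBound x.length) (h₂ : r 11 ≤ regBound x.length)
    (hp : p ≠ 13 ∧ p ≠ 15) (hq : q ≠ 13 ∧ q ≠ 15) (hP : r p = r q ↔ P) :
    Evaluated x Γ ρ A e P r₀ b ((eqCode p q e).foldl (Instr.exec x) r) b := by
  have hone : r 1 = 1 := by rw [hr 1 (by simp) (by simp)]; exact h.one
  have hbd : ∀ q, r q ≤ regBound x.length := by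
    intro q
    by_cases q1 : q = 9
    · rwa [q1]
    by_cases q2 : q = 11
    · rwa [q2]
    rw [hr q q1 q2]
    exact h.bd q
  have hbp := hbd p
  have hbq := hbd q
  have hre : re e ≠ 1 ∧ re e ≠ 9 ∧ re e ≠ 11 ∧ re e ≠ 13 ∧ re e ≠ 15 := by
    simp only [re]; omega
  have hre' := And.intro hre.1.symm <| And.intro hre.2.1.symm <| And.intro hre.2.2.1.symm <|
    And.intro hre.2.2.2.1.symm hre.2.2.2.2.symm
  have : Evaluated x Γ ρ A e P r₀ b (Function.update (Function.update (Function.update r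
      15 (r q - r p)) 13 (r p - r q + (r q - r p))) (re e) (1 - (r p - r q + (r q - r p)))) b := by
    refine Evaluated.of_scratch h ?_ ?_ ?_ ?_ ?_ ?_
    · intro s h1 h2 h3 h4 h5
      simp [Function.update_of_ne, *]
    · simpa [Function.update_of_ne, hre'] using h₁
    · simpa [Function.update_of_ne, hre'] using h₂
    · simp only [hre', ne_eq, not_false_eq_true, Function.update_of_ne, Function.update_self]; omega
    · rw [Function.update_of_ne hre'.2.2.2.2, Function.update_of_ne (by simp),
        Function.update_self]
      omega
    · rw [Function.update_self]
      by_cases hpq : r p = r q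
      · simp [hpq, truth_pos (hP.1 hpq)]
      · rw [truth_neg (fun h => hpq (hP.2 h))]; omega
  convert this using 1
  funext s
  simp only [eqCode, List.foldl, Instr.exec, Function.update_self]
  rw [Function.update_of_ne (a := 1) (by simp), Function.update_of_ne (a := 1) (by simp),
    Function.update_of_ne (a := 1) (by simp), hone, Function.update_of_ne (a := 13) (by simp),
    Function.update_self, Function.update_of_ne hq.1, Function.update_of_ne hp.1]
  simp only [Function.update_apply]
  split_ifs <;> rfl

theorem Inv.input_le {Γ : List ℕ} {ρ : ℕ → ℕ} {A : Arrays} {r : ℕ → ℕ} (_ : Inv x Γ ρ A r)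
    (i : ℕ) : letterCode x[i]? ≤ regBound x.length :=
  (letterCode_le _).trans (le_regBound (by omega))

/-- Correctness of the code that evaluates a formula. -/
theorem Fm.code_spec {A : Arrays} (φ : Fm) : ∀ {Γ : List ℕ} {ρ : ℕ → ℕ} {o e : ℕ},
    φ.wf Γ = true → CodeAt prog o (φ.code o e) → ∀ (r₀ : ℕ → ℕ) (b₀ : Word 18), Inv x Γ ρ A r₀ →
    Triple prog L x o (o + (φ.code o e).length) (φ.time.eval x.length)
      (fun r b => r = r₀ ∧ b = b₀) (Evaluated x Γ ρ A e (φ.Sat x A ρ) r₀ b₀) := by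
  induction φ with
  | inp u c =>
    intro Γ ρ o e hwf hc r₀ b₀ hI
    simp only [Fm.wf, Bool.and_eq_true, List.contains_iff_mem, decide_eq_true_eq] at hwf
    refine (Triple.straight _ hc (by simp [Fm.code, eqCode, Instr.Straight]) ?_).weaken
      (by simp [Fm.code, eqCode, Fm.time]) (fun _ _ h => h) (fun _ _ h => h)
    rintro r b ⟨rfl, rfl⟩
    rw [Fm.code, List.foldl_append]
    have := hI.input_le (ρ u)
    refine Evaluated.of_eqCode hI ?_ ?_ ?_ (by simp) (by simp) ?_ <;>
      simp +contextual [Instr.exec, hI.var u hwf.1, Fm.Sat, this]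
    exact le_regBound (by omega)
  | same u v =>
    intro Γ ρ o e hwf hc r₀ b₀ hI
    simp only [Fm.wf, Bool.and_eq_true, List.contains_iff_mem] at hwf
    refine (Triple.straight _ hc (by simp [Fm.code, eqCode, Instr.Straight]) ?_).weaken
      (by simp [Fm.code, eqCode, Fm.time]) (fun _ _ h => h) (fun _ _ h => h)
    rintro r b ⟨rfl, rfl⟩
    rw [Fm.code, List.foldl_append]
    have h1 := hI.input_le (ρ u)
    have h2 := hI.input_le (ρ v)
    have h3 : rv v ≠ 9 := by simp only [rv]; omega
    refine Evaluated.of_eqCode hI ?_ ?_ ?_ (by simp) (by simp) ?_ <;>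
      simp +contextual [Instr.exec, hI.var u hwf.1, hI.var v hwf.2, Fm.Sat, h1, h2, h3]
  | cst u c =>
    intro Γ ρ o e hwf hc r₀ b₀ hI
    simp only [Fm.wf, Bool.and_eq_true, List.contains_iff_mem, decide_eq_true_eq] at hwf
    refine (Triple.straight _ hc (by simp [Fm.code, eqCode, Instr.Straight]) ?_).weaken
      (by simp [Fm.code, eqCode, Fm.time]) (fun _ _ h => h) (fun _ _ h => h)
    rintro r b ⟨rfl, rfl⟩
    rw [Fm.code, List.foldl_append]
    have h3 : rv u ≠ 9 ∧ rv u ≠ 13 ∧ rv u ≠ 15 := by simp only [rv]; omega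
    have h4 : c ≤ regBound x.length := le_regBound (by omega)
    refine Evaluated.of_eqCode hI ?_ ?_ ?_ (by simp) h3.2 ?_ <;>
      simp +contextual [Instr.exec, hI.var u hwf.1, Fm.Sat, h3, h4, hI.bd, eq_comm]
  | addc u c v =>
    intro Γ ρ o e hwf hc r₀ b₀ hI
    simp only [Fm.wf, Bool.and_eq_true, List.contains_iff_mem, decide_eq_true_eq] at hwf
    refine (Triple.straight _ hc (by simp [Fm.code, eqCode, Instr.Straight]) ?_).weaken
      (by simp [Fm.code, eqCode, Fm.time]) (fun _ _ h => h) (fun _ _ h => h)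
    rintro r b ⟨rfl, rfl⟩
    rw [Fm.code, List.foldl_append]
    have h3 : rv v ≠ 9 ∧ rv v ≠ 13 ∧ rv v ≠ 15 := by simp only [rv]; omega
    have h5 : rv u ≠ 9 := by simp only [rv]; omega
    have h6 := hI.le u hwf.1.1
    have h4 : c + ρ u ≤ regBound x.length := le_regBound (by omega)
    refine Evaluated.of_eqCode hI ?_ ?_ ?_ (by simp) h3.2 ?_ <;>
      simp +contextual [Instr.exec, hI.var u hwf.1.1, hI.var v hwf.1.2, Fm.Sat, h3, h5, hI.bd,
        Nat.add_comm c]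
    omega
  | add u v w =>
    intro Γ ρ o e hwf hc r₀ b₀ hI
    simp only [Fm.wf, Bool.and_eq_true, List.contains_iff_mem] at hwf
    refine (Triple.straight _ hc (by simp [Fm.code, eqCode, Instr.Straight]) ?_).weaken
      (by simp [Fm.code, eqCode, Fm.time]) (fun _ _ h => h) (fun _ _ h => h)
    rintro r b ⟨rfl, rfl⟩
    rw [Fm.code, List.foldl_append]
    have h3 : rv w ≠ 9 ∧ rv w ≠ 13 ∧ rv w ≠ 15 := by simp only [rv]; omega
    have h6 := hI.le u hwf.1.1
    have h7 := hI.le v hwf.1.2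
    have h4 : ρ u + ρ v ≤ regBound x.length := le_regBound (by omega)
    refine Evaluated.of_eqCode hI ?_ ?_ ?_ (by simp) h3.2 ?_ <;>
      simp +contextual [Instr.exec, hI.var u hwf.1.1, hI.var v hwf.1.2, hI.var w hwf.2, Fm.Sat, h3,
        h4, hI.bd]
  | lt u v =>
    intro Γ ρ o e hwf hc r₀ b₀ hI
    simp only [Fm.wf, Bool.and_eq_true, List.contains_iff_mem] at hwf
    refine (Triple.straight _ hc (by simp [Fm.code, Instr.Straight]) ?_).weaken
      (by simp [Fm.code, Fm.time]) (fun _ _ h => h) (fun _ _ h => h)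
    rintro r b ⟨rfl, rfl⟩
    have hre : re e ≠ 9 ∧ re e ≠ 11 ∧ re e ≠ 13 ∧ re e ≠ 15 := by simp only [re]; omega
    have h4 : 1 ≤ regBound x.length := le_regBound (by omega)
    refine Evaluated.of_scratch hI ?_ ?_ ?_ ?_ ?_ ?_ <;>
      simp +contextual [Fm.code, Instr.exec, hI.var u hwf.1, hI.var v hwf.2, Fm.Sat,
        hI.bd, Function.update_of_ne, Ne.symm hre.1, Ne.symm hre.2.1, Ne.symm hre.2.2.1,
        Ne.symm hre.2.2.2, hI.one]
    · omega
    · by_cases h : ρ u < ρ v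
      · rw [truth_pos h]; omega
      · rw [truth_neg h]; omega
  | arr a u v =>
    intro Γ ρ o e hwf hc r₀ b₀ hI
    simp only [Fm.wf, Bool.and_eq_true, List.contains_iff_mem, decide_eq_true_eq] at hwf
    refine (Triple.straight _ hc (by simp [Fm.code, cellCode, Instr.Straight]) ?_).weaken
      (by simp [Fm.code, cellCode, Fm.time]) (fun _ _ h => h) (fun _ _ h => h)
    rintro r b ⟨rfl, rfl⟩
    have hre : re e ≠ 9 ∧ re e ≠ 11 ∧ re e ≠ 13 ∧ re e ≠ 15 := by simp only [re]; omega
    have h1 : rs u ≠ 9 := by simp only [rs]; omega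
    have h2 : rk v ≠ 9 := by simp only [rk]; omega
    have h6 := hI.le u hwf.1.1
    have h7 := hI.le v hwf.1.2
    have h4 : cell x.length a (ρ u) (ρ v) ≤ regBound x.length := by
      refine regBound_ge ?_ ?_ ?_ <;> omega
    have h5 : cell x.length a (ρ u) (ρ v) ≠ 9 := by
      unfold cell; simp only [Nat.mul_assoc]; omega
    have h8 := hI.arr a hwf.2 _ h6 _ h7
    refine Evaluated.of_scratch hI ?_ ?_ ?_ ?_ ?_ ?_ <;>
      simp +contextual [Fm.code, cellCode, Instr.exec, hI.varS u hwf.1.1, hI.varK v hwf.1.2, Fm.Sat,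
        hI.bd, Function.update_of_ne, Ne.symm hre.1, Ne.symm hre.2.1, Ne.symm hre.2.2.1,
        Ne.symm hre.2.2.2, h1, h2]
    · exact h4
    · unfold cell at h8 h5
      rw [Function.update_of_ne h5, h8]
  | not φ ih =>
    intro Γ ρ o e hwf hc r₀ b₀ hI
    rw [Fm.code] at hc
    obtain ⟨hc1, hc2⟩ := hc.append
    have h1 := (ih (by simpa [Fm.wf] using hwf) hc1 r₀ b₀ hI).seq
      (Triple.straight _ hc2 (by simp [Instr.Straight]) 
        (Q := Evaluated x Γ ρ A e ((Fm.not φ).Sat x A ρ) r₀ b₀) (L := L) ?_)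
    · rw [Fm.code, List.length_append, ← Nat.add_assoc]
      exact h1.weaken (by simp [Fm.time]) (fun _ _ h => h) (fun _ _ h => h)
    · rintro r b ⟨h1, h2, h3, h4⟩
      have hre : re e ≠ 9 ∧ re e ≠ 11 ∧ re e ≠ 13 ∧ re e ≠ 15 := by simp only [re]; omega
      have : Evaluated x Γ ρ A e (¬ φ.Sat x A ρ) r b
          (List.foldl (Instr.exec x) r [Instr.sub (re e) 1 (re e)]) b := by
        refine Evaluated.of_scratch h1 ?_ ?_ ?_ ?_ ?_ ?_ <;>
          simp +contextual [Instr.exec, h1.bd, Function.update_of_ne, Ne.symm hre.1,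
            Ne.symm hre.2.1, Ne.symm hre.2.2.1, Ne.symm hre.2.2.2, h1.one, h3, truth_not]
      exact ⟨this.1, this.2.1.trans h2, this.2.2.1,
        fun e' he' => (this.2.2.2 e' he').trans (h4 e' he')⟩
  | and φ ψ ih₁ ih₂ =>
    intro Γ ρ o e hwf hc r₀ b₀ hI
    rw [Fm.code] at hc
    obtain ⟨hc1, hc2⟩ := hc.append
    obtain ⟨hc3, hc4⟩ := hc2.append
    simp only [Fm.wf, Bool.and_eq_true] at hwf
    -- The second conjunct is evaluated into slot `e + 1`. The first value survives in slot `e`,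
    -- because evaluation preserves all slots below its target.
    have hmid : Triple prog L x (o + (φ.code o e).length) (o + (φ.code o e).length +
        (ψ.code (o + (φ.code o e).length) (e + 1)).length) (ψ.time.eval x.length)
        (Evaluated x Γ ρ A e (φ.Sat x A ρ) r₀ b₀)
        (fun r b => Evaluated x Γ ρ A e (φ.Sat x A ρ) r₀ b₀ r b ∧
          r (re (e + 1)) = truth (ψ.Sat x A ρ)) := by
      refine Triple.of_forall fun r₁ b₁ h => ?_
      refine (ih₂ hwf.2 hc3 r₁ b₁ h.1).weaken le_rfl (fun _ _ h => h) ?_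
      rintro r b ⟨h1, h2, h3, h4⟩
      refine ⟨⟨h1, h2.trans h.2.1, (h4 e (by omega)).trans h.2.2.1,
        fun e' he' => (h4 e' (by omega)).trans (h.2.2.2 e' he')⟩, ?_⟩
      rw [h3]
    have h1 := ((ih₁ hwf.1 hc1 r₀ b₀ hI).seq hmid).seq
      (Triple.straight _ hc4 (by simp [Instr.Straight])
        (Q := Evaluated x Γ ρ A e ((Fm.and φ ψ).Sat x A ρ) r₀ b₀) (L := L) ?_)
    · rw [Fm.code, List.length_append, List.length_append, ← Nat.add_assoc, ← Nat.add_assoc]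
      exact h1.weaken (by simp [Fm.time, Nat.add_assoc]) (fun _ _ h => h) (fun _ _ h => h)
    · rintro r b ⟨⟨h1, h2, h3, h4⟩, h5⟩
      have hre : re e ≠ 1 ∧ re e ≠ 9 ∧ re e ≠ 11 ∧ re e ≠ 13 ∧ re e ≠ 15 := by
        simp only [re]; omega
      have : Evaluated x Γ ρ A e ((Fm.and φ ψ).Sat x A ρ) r b
          (List.foldl (Instr.exec x) r [Instr.add (re e) (re e) (re (e + 1)),
            Instr.sub (re e) (re e) 1]) b := by
        refine Evaluated.of_scratch h1 ?_ ?_ ?_ ?_ ?_ ?_ <;>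
          simp +contextual [Instr.exec, h1.bd, Function.update_of_ne, Ne.symm hre.1,
            Ne.symm hre.2.1, Ne.symm hre.2.2.1, Ne.symm hre.2.2.2.1, Ne.symm hre.2.2.2.2, h1.one,
            h3, h5, Fm.Sat, truth_and]
      exact ⟨this.1, this.2.1.trans h2, this.2.2.1,
        fun e' he' => (this.2.2.2 e' he').trans (h4 e' he')⟩
  | ex v φ ih =>
    intro Γ ρ o e hwf hc r₀ b₀ hI
    rw [Fm.code] at hc
    obtain ⟨hc1, hc2⟩ := hc.append
    simp only [Fm.wf, Bool.and_eq_true, Bool.not_eq_true', ← Bool.not_eq_true,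
      List.contains_iff_mem] at hwf
    have hre : re e ≠ 1 ∧ re e ≠ 9 ∧ re e ≠ 11 ∧ re e ≠ 13 ∧ re e ≠ 15 := by
      simp only [re]; omega
    have hc3 := (hc2.append.2.append.1).append
    -- Slot `e` accumulates the disjunction over the values tried so far. The loop rule lets the
    -- relations vary, so the invariant has to say that evaluation leaves them as they are.
    let E : ℕ → Arrays → (ℕ → ℕ) → Word 18 → Prop := fun i A' r b =>
      A' = A ∧ b = b₀ ∧ r (re e) = truth (∃ j < i, φ.Sat x A (Function.update ρ v j)) ∧
        ∀ e' < e, r (re e') = r₀ (re e')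
    have hbody : ∀ i ≤ x.length, Triple prog L x (o + 1 + 3) (o + 1 + 3 + (φ.code (o + 4) (e + 1) ++
        [Instr.add (re e) (re e) (re (e + 1)), .sub 9 1 (re e), .sub (re e) 1 9]).length)
        (φ.time.eval x.length + 3)
      (fun r b => ∃ A, Inv x (v :: Γ) (Function.update ρ v i) A r ∧ E i A r b)
      (fun r b => ∃ A, Inv x (v :: Γ) (Function.update ρ v i) A r ∧ E (i + 1) A r b) := by
      intro i hi
      refine Triple.of_forall ?_
      rintro r₁ b₁ ⟨A', hI', rfl, hE1, hE2, hE3⟩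
      have h1 := ih hwf.2 hc3.1 r₁ b₁ hI'
      rw [List.length_append, ← Nat.add_assoc]
      refine h1.seq (Triple.straight _ hc3.2 (by simp [Instr.Straight]) ?_)
      rintro r b ⟨g1, g2, g3, g4⟩
      have g5 : r (re e) = _ := (g4 e (by omega)).trans hE2
      have hex : (∃ j < i + 1, φ.Sat x A' (Function.update ρ v j)) ↔
          (∃ j < i, φ.Sat x A' (Function.update ρ v j)) ∨ φ.Sat x A' (Function.update ρ v i) := by
        constructor
        · rintro ⟨j, hj, h⟩
          rcases Nat.lt_succ_iff_lt_or_eq.1 hj with h' | rfl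
          · exact .inl ⟨j, h', h⟩
          · exact .inr h
        · rintro (⟨j, hj, h⟩ | h)
          · exact ⟨j, by omega, h⟩
          · exact ⟨i, by omega, h⟩
      have : Evaluated x (v :: Γ) (Function.update ρ v i) A' e
          (∃ j < i + 1, φ.Sat x A' (Function.update ρ v j)) r b
          (List.foldl (Instr.exec x) r [Instr.add (re e) (re e) (re (e + 1)),
            Instr.sub 9 1 (re e), Instr.sub (re e) 1 9]) b := by
        have h4 : 1 ≤ regBound x.length := le_regBound (by omega)
        have hre' := And.intro hre.1.symm <| And.intro hre.2.1.symm <|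
          And.intro hre.2.2.1.symm <| And.intro hre.2.2.2.1.symm hre.2.2.2.2.symm
        refine Evaluated.of_scratch g1 (fun q q1 _ _ _ q5 => ?_) ?_ ?_ ?_ ?_ ?_
        · simp [Instr.exec, Function.update_of_ne q1, Function.update_of_ne q5]
        · simp only [List.foldl, Instr.exec, ne_eq, hre', not_false_eq_true,
            Function.update_of_ne, Function.update_self, g1.one]
          omega
        · simp [Instr.exec, Function.update_of_ne, hre', g1.bd]
        · simp [Instr.exec, Function.update_of_ne, hre', g1.bd]
        · simp [Instr.exec, Function.update_of_ne, hre', g1.bd]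
        · rw [truth_congr hex, truth_or, ← g3, ← g5]
          simp [Instr.exec, Function.update_of_ne, hre', g1.one]
      exact ⟨A', this.1, rfl, g2.trans hE1, this.2.2.1, fun e' he' =>
        ((this.2.2.2 e' he').trans (g4 e' (by omega))).trans (hE3 e' he')⟩
    have hstart : Triple prog L x o (o + 1) 1 (fun r b => r = r₀ ∧ b = b₀)
        (fun r b => ∃ A, Inv x Γ ρ A r ∧ E 0 A r b) := by
      refine Triple.straight _ hc1 (by simp [Instr.Straight]) ?_
      rintro r b ⟨rfl, rfl⟩
      have : Evaluated x Γ ρ A e (∃ j < 0, φ.Sat x A (Function.update ρ v j)) r b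
          (List.foldl (Instr.exec x) r [Instr.set (re e) 0]) b := by
        refine Evaluated.of_scratch hI ?_ ?_ ?_ ?_ ?_ ?_ <;>
          simp +contextual [Instr.exec, hI.bd, Function.update_of_ne, Ne.symm hre.2.1,
            Ne.symm hre.2.2.1, Ne.symm hre.2.2.2.1, Ne.symm hre.2.2.2.2, truth]
      exact ⟨A, this.1, rfl, this.2⟩
    have hl := Triple.loop (L := L) hwf.1 E hc2 ?_ hbody
    · rw [Fm.code, List.length_append, ← Nat.add_assoc]
      refine (hstart.seq hl).weaken (by simp [Fm.time]) (fun _ _ h => h) ?_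
      rintro r b ⟨A', hI', rfl, h⟩
      refine ⟨hI', ?_⟩
      simpa only [Fm.Sat, Nat.lt_succ_iff] using h
    · rintro i A' r r' b hr ⟨rfl, h1, h2, h3⟩
      have hr' : ∀ e, r' (re e) = r (re e) := fun e => by
        refine hr _ ?_ ?_ ?_ ?_ <;> simp only [re, rv, rk, rs] <;> omega
      exact ⟨rfl, h1, (hr' e).trans h2, fun e' he' => (hr' e').trans (h3 e' he')⟩

end Code

/-! ### Commands: semantics, compilation and correctness -/

/-- Programs without unbounded loops. -/
inductive Cmd where
  /-- `A a := {(u, v) | φ}` -/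
  | asg (a u v : ℕ) (φ : Fm)
  | seq (c d : Cmd)
  /-- for `v` from `0` to `|x|` do `c` -/
  | forv (v : ℕ) (c : Cmd)
  /-- if `φ` then `c` -/
  | ifc (φ : Fm) (c : Cmd)
  /-- print the letter with code `n` -/
  | print (n : ℕ)

/-- States of programs: the relations, and the word that is being printed. -/
structure St where
  A : Arrays
  buf : Word 18

/-- Iteration of a state transformer that depends on the round. -/
def iter (f : ℕ → St → St) : ℕ → St → St
  | 0, s => s
  | n + 1, s => f n (iter f n s)

open Classical in
/-- The semantics of programs. -/
noncomputable def Cmd.eval (x : Word 18) : Cmd → (ℕ → ℕ) → St → St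
  | .asg a u v φ, ρ, s =>
    { s with
      A := Function.update s.A a
        (fun i j => φ.Sat x s.A (Function.update (Function.update ρ u i) v j)) }
  | .seq c d, ρ, s => d.eval x ρ (c.eval x ρ s)
  | .forv v c, ρ, s => iter (fun i s => c.eval x (Function.update ρ v i) s) (x.length + 1) s
  | .ifc φ c, ρ, s => if φ.Sat x s.A ρ then c.eval x ρ s else s
  | .print n, _, s => { s with buf := s.buf ++ (letterOf 18 n).toList }

/-- Well-formedness relative to the bound variables `Γ`. -/
def Cmd.wf : List ℕ → Cmd → Bool
  | Γ, .asg a u v φ => !Γ.contains u && !Γ.contains v && !(u == v) && φ.wf (v :: u :: Γ) &&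
      !φ.mentions a && decide (a < 32)
  | Γ, .seq c d => c.wf Γ && d.wf Γ
  | Γ, .forv v c => !Γ.contains v && c.wf (v :: Γ)
  | Γ, .ifc φ c => φ.wf Γ && c.wf Γ
  | _, .print n => decide (n ≤ 64)

/-- The relations that are changed by a program. -/
def Cmd.writes (a : ℕ) : Cmd → Bool
  | .asg b _ _ _ => a == b
  | .seq c d => c.writes a || d.writes a
  | .forv _ c => c.writes a
  | .ifc _ c => c.writes a
  | .print _ => false

/-- The machine code of a program. -/
def Cmd.code : ℕ → Cmd → List Instr
  | o, .asg a u v φ => loopCode o u (loopCode (o + 3) v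
      (φ.code (o + 6) 0 ++ (cellCode a u v ++ [.store 9 (re 0)])))
  | o, .seq c d => c.code o ++ d.code (o + (c.code o).length)
  | o, .forv v c => loopCode o v (c.code (o + 3))
  | o, .ifc φ c => φ.code o 0 ++ ([.sub 9 1 (re 0)] ++
      ([.jpos 9 (o + (φ.code o 0).length + 2 +
        (c.code (o + (φ.code o 0).length + 2)).length)] ++ c.code (o + (φ.code o 0).length + 2)))
  | _, .print n => [.set 9 n, .print 9]

open Polynomial in
/-- Bound on the number of steps of a program, as a function of the length of the input. -/
noncomputable def Cmd.time : Cmd → Polynomial ℕ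
  | .asg _ _ _ φ => 3 + (X + 1) * (3 + (X + 1) * (φ.time + 4 + 4 + 1) + 4 + 1)
  | .seq c d => c.time + d.time
  | .forv _ c => 3 + (X + 1) * (c.time + 4 + 1)
  | .ifc φ c => φ.time + (1 + (c.time + 1))
  | .print _ => 2

/-- The address is a mixed-radix representation: `2 * a < 64` is the lowest digit, then `j ≤ B`,
then `i`. -/
theorem cell_inj {B a i j a' i' j' : ℕ} (ha : a < 32) (ha' : a' < 32) (hj : j ≤ B) (hj' : j' ≤ B)
    (h : cell B a i j = cell B a' i' j') : a = a' ∧ i = i' ∧ j = j' := by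
  unfold cell at h
  rw [Nat.mul_assoc, Nat.mul_assoc] at h
  have h1 : a = a' := by omega
  have h2 : (B + 1) * i + j = (B + 1) * i' + j' := by omega
  have h3 : i = i' := by
    have := congrArg (· / (B + 1)) h2
    simpa [Nat.mul_add_div, Nat.div_eq_of_lt (Nat.lt_succ_of_le hj),
      Nat.div_eq_of_lt (Nat.lt_succ_of_le hj')] using this
  subst h3
  exact ⟨h1, rfl, by omega⟩

/-- `Cmd.writes` is computable, so that `decide` can carry facts about a relation past all commands
that do not touch it. -/
theorem Cmd.eval_frame {x : Word 18} {a : ℕ} (c : Cmd) (h : c.writes a = false) (ρ : ℕ → ℕ)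
    (s : St) : (c.eval x ρ s).A a = s.A a := by
  induction c generalizing ρ s with
  | asg b u v φ =>
    simp only [Cmd.writes, beq_eq_false_iff_ne] at h
    simp [Cmd.eval, h]
  | seq c d ih₁ ih₂ =>
    simp only [Cmd.writes, Bool.or_eq_false_iff] at h
    rw [Cmd.eval, ih₂ h.2, ih₁ h.1]
  | forv v c ih =>
    simp only [Cmd.eval]
    generalize x.length + 1 = n
    induction n with
    | zero => rfl
    | succ n ih' => rw [iter, ih h, ih']
  | ifc φ c ih =>
    simp only [Cmd.eval]
    split_ifs
    · exact ih h _ _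
    · rfl
  | print n => rfl

section Code

variable {l : ℕ} {prog : Program} {L : Set (Word l)} {x : Word 18}

open Classical in
-- The write goes to an even register, so no control register is hit, and by `cell_inj` to the one
-- cell that was meant.
theorem Inv.store {Γ : List ℕ} {ρ : ℕ → ℕ} {A : Arrays} {r : ℕ → ℕ} {a u v : ℕ} {p : Prop}
    (h : Inv x Γ ρ A r) (hu : u ∈ Γ) (hv : v ∈ Γ) (ha : a < 32) (hp : r (re 0) = truth p) :
    Inv x Γ ρ (fun a' i j => if a' = a ∧ i = ρ u ∧ j = ρ v then p else A a' i j)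
      ((cellCode a u v ++ [Instr.store 9 (re 0)]).foldl (Instr.exec x) r) := by
  have h1 : rs u ≠ 9 := by simp only [rs]; omega
  have h2 : rk v ≠ 9 := by simp only [rk]; omega
  have h3 : re 0 ≠ 9 := by simp [re]
  have h4 := h.le u hu
  have h5 := h.le v hv
  have hr : (cellCode a u v ++ [Instr.store 9 (re 0)]).foldl (Instr.exec x) r =
      Function.update (Function.update r 9 (cell x.length a (ρ u) (ρ v)))
        (cell x.length a (ρ u) (ρ v)) (truth p) := by
    simp [cellCode, Instr.exec, h1, h2, h3, h.varS u hu, h.varK v hv, cell, hp]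
  rw [hr]
  have hbd : ∀ q, Function.update (Function.update r 9 (cell x.length a (ρ u) (ρ v)))
        (cell x.length a (ρ u) (ρ v)) (truth p) q ≤ regBound x.length :=
    update_le (update_le h.bd (regBound_ge (by omega) (by omega) (by omega)))
      ((truth_le p).trans (le_regBound (by omega)))
  have heven : ∀ a i j, cell x.length a i j % 2 = 0 := by
    intro a i j; unfold cell; rw [Nat.mul_assoc]; omega
  have hodd : ∀ q, q % 2 = 1 → q ≠ 9 → Function.update (Function.update r 9
      (cell x.length a (ρ u) (ρ v))) (cell x.length a (ρ u) (ρ v)) (truth p) q = r q := by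
    intro q hq hq'
    have := heven a (ρ u) (ρ v)
    rw [Function.update_of_ne (by intro h; rw [h] at hq; omega), Function.update_of_ne hq']
  exact
  { one := by rw [hodd 1 rfl (by simp)]; exact h.one
    cnt := by rw [hodd 3 rfl (by simp)]; exact h.cnt
    row := by rw [hodd 5 rfl (by simp)]; exact h.row
    stride := by rw [hodd 7 rfl (by simp)]; exact h.stride
    le := h.le
    var := fun w hw => by
      rw [hodd _ (by simp only [rv]; omega) (by simp only [rv]; omega)]; exact h.var w hw
    varK := fun w hw => by
      rw [hodd _ (by simp only [rk]; omega) (by simp only [rk]; omega)]; exact h.varK w hw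
    varS := fun w hw => by
      rw [hodd _ (by simp only [rs]; omega) (by simp only [rs]; omega)]; exact h.varS w hw
    arr := fun a' ha' i hi j hj => by
      by_cases hc : a' = a ∧ i = ρ u ∧ j = ρ v
      · obtain ⟨rfl, rfl, rfl⟩ := hc
        simp
      · rw [if_neg hc, Function.update_of_ne, Function.update_of_ne, h.arr a' ha' i hi j hj]
        · have := heven a' i j; omega
        · intro h; exact hc (cell_inj ha' ha hj h5 h)
    bd := hbd }

open Classical in
/-- The relations in the course of the evaluation of an assignment. -/
def partialAsg (A : Arrays) (a : ℕ) (p : ℕ → ℕ → Prop) (i j : ℕ) : Arrays := fun a' i' j' =>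
  if a' = a ∧ (i' < i ∨ i' = i ∧ j' < j) then p i' j' else A a' i' j'

/-- Correctness of the machine code. -/
theorem Cmd.code_spec (c : Cmd) : ∀ {Γ : List ℕ} {ρ : ℕ → ℕ} {o : ℕ},
    c.wf Γ = true → CodeAt prog o (c.code o) → ∀ s : St,
    Triple prog L x o (o + (c.code o).length) (c.time.eval x.length)
      (fun r b => Inv x Γ ρ s.A r ∧ b = s.buf)
      (fun r b => Inv x Γ ρ (c.eval x ρ s).A r ∧ b = (c.eval x ρ s).buf) := by
  induction c with
  | asg a u v φ =>
    intro Γ ρ o hwf hc s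
    simp only [Cmd.wf, Bool.and_eq_true, Bool.not_eq_true', ← Bool.not_eq_true,
      List.contains_iff_mem, decide_eq_true_eq, beq_iff_eq] at hwf
    obtain ⟨⟨⟨⟨⟨hu, hv⟩, huv⟩, hφ⟩, hm⟩, ha⟩ := hwf
    rw [Cmd.code] at hc ⊢
    have hci := hc.append.2.append.1
    have hcb := (hci.append.2.append.1).append
    let p : ℕ → ℕ → Prop := fun i j =>
      φ.Sat x s.A (Function.update (Function.update ρ u i) v j)
    have hvu : v ∉ u :: Γ := by simp [hv, Ne.symm huv]
    have hinner : ∀ i ≤ x.length, Triple prog L x (o + 3) (o + 3 + (loopCode (o + 3) v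
        (φ.code (o + 6) 0 ++ (cellCode a u v ++ [Instr.store 9 (re 0)]))).length)
        (3 + (x.length + 1) * (φ.time.eval x.length + 4 + 4 + 1))
        (fun r b => ∃ A, Inv x (u :: Γ) (Function.update ρ u i) A r ∧
          (A = partialAsg s.A a p i 0 ∧ b = s.buf))
        (fun r b => ∃ A, Inv x (u :: Γ) (Function.update ρ u i) A r ∧
          (A = partialAsg s.A a p (i + 1) 0 ∧ b = s.buf)) := by
      intro i hi
      refine (Triple.loop (L := L) (ρ := Function.update ρ u i) hvu
        (fun j A _ b => A = partialAsg s.A a p i j ∧ b = s.buf) hci (T := φ.time.eval x.length + 4)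
        (fun _ _ _ _ _ _ h => h) ?_).weaken le_rfl (fun _ _ h => h) ?_
      · intro j hj
        refine Triple.of_forall ?_
        rintro r₀ b₀ ⟨A, hI, rfl, rfl⟩
        rw [List.length_append, ← Nat.add_assoc]
        refine (φ.code_spec hφ hcb.1 r₀ s.buf hI).seq
          (Triple.straight _ hcb.2 (by simp [cellCode, Instr.Straight]) ?_)
        rintro r b ⟨h1, h2, h3, -⟩
        have h4 := h1.store (a := a) (u := u) (v := v) (by simp) (by simp) ha h3
        refine ⟨_, h4, ?_, h2⟩
        funext a' i' j'
        simp only [Function.update_self, Function.update_of_ne huv, partialAsg]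
        -- Well-formedness forbids `φ` to mention its own target, so the cells already overwritten
        -- do not influence the evaluation.
        have hsat : φ.Sat x (partialAsg s.A a p i j)
            (Function.update (Function.update ρ u i) v j) = p i j := by
          refine propext (φ.sat_congr _ fun b hb => ?_)
          have : b ≠ a := by rintro rfl; exact hm hb
          funext i' j'
          simp [partialAsg, this]
        by_cases hc : a' = a ∧ i' = i ∧ j' = j
        · obtain ⟨rfl, rfl, rfl⟩ := hc
          rw [if_pos ⟨rfl, rfl, rfl⟩, if_pos ⟨rfl, .inr ⟨rfl, by omega⟩⟩, hsat]
        · rw [if_neg hc]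
          refine if_congr ?_ rfl rfl
          omega
      · rintro r b ⟨A, hI, rfl, h⟩
        -- At the end of a row the progress marker changes from `(i, |x| + 1)` to `(i + 1, 0)`. The
        -- two relations agree only for arguments up to `|x|`, which is all that `Inv` sees.
        refine ⟨_, hI.congr_arr fun a' i' hi' j' hj' => ?_, rfl, h⟩
        unfold partialAsg
        have : (a' = a ∧ (i' < i ∨ i' = i ∧ j' < x.length + 1)) ↔
            (a' = a ∧ (i' < i + 1 ∨ i' = i + 1 ∧ j' < 0)) := by omega
        simp only [this]
    refine (Triple.loop (L := L) hu (fun i A _ b => A = partialAsg s.A a p i 0 ∧ b = s.buf) hc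
      (T := 3 + (x.length + 1) * (φ.time.eval x.length + 4 + 4 + 1))
        (fun _ _ _ _ _ _ h => h) hinner).weaken ?_ ?_ ?_
    · simp [Cmd.time]
    · rintro r b ⟨h1, h2⟩
      exact ⟨s.A, h1, by funext; simp [partialAsg], h2⟩
    · rintro r b ⟨A, hI, rfl, h⟩
      refine ⟨hI.congr_arr fun a' i' hi' j' hj' => ?_, h⟩
      simp only [Cmd.eval, partialAsg]
      by_cases ha' : a' = a
      · subst ha'
        rw [if_pos ⟨rfl, .inl (by omega)⟩, Function.update_self]
      · rw [if_neg (by tauto), Function.update_of_ne ha']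
  | seq c d ih₁ ih₂ =>
    intro Γ ρ o hwf hc s
    simp only [Cmd.wf, Bool.and_eq_true] at hwf
    rw [Cmd.code] at hc ⊢
    rw [List.length_append, ← Nat.add_assoc]
    exact ((ih₁ hwf.1 hc.append.1 s).seq (ih₂ hwf.2 hc.append.2 _)).weaken (by simp [Cmd.time])
      (fun _ _ h => h) (fun _ _ h => h)
  | forv v c ih =>
    intro Γ ρ o hwf hc s
    simp only [Cmd.wf, Bool.and_eq_true, Bool.not_eq_true', ← Bool.not_eq_true,
      List.contains_iff_mem] at hwf
    rw [Cmd.code] at hc ⊢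
    have hcb := hc.append.2.append.1
    let S := fun i => iter (fun i s => c.eval x (Function.update ρ v i) s) i s
    refine (Triple.loop (L := L) (ρ := ρ) hwf.1 (fun i A _ b => A = (S i).A ∧ b = (S i).buf) hc
      (T := c.time.eval x.length) (fun _ _ _ _ _ _ h => h) ?_).weaken ?_ ?_ ?_
    · intro i hi
      refine (ih (ρ := Function.update ρ v i) hwf.2 hcb (S i)).weaken le_rfl ?_ ?_
      · rintro r b ⟨A, h, rfl, hb⟩
        exact ⟨h, hb⟩
      · rintro r b ⟨h, hb⟩
        exact ⟨_, h, rfl, hb⟩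
    · simp [Cmd.time]
    · rintro r b ⟨h, hb⟩
      exact ⟨_, h, rfl, hb⟩
    · rintro r b ⟨A, h, rfl, hb⟩
      exact ⟨h, hb⟩
  | ifc φ c ih =>
    intro Γ ρ o hwf hc s
    simp only [Cmd.wf, Bool.and_eq_true] at hwf
    rw [Cmd.code] at hc
    obtain ⟨hc1, hc2⟩ := hc.append
    obtain ⟨hc3, hc4⟩ := hc2.append
    obtain ⟨hc5, hc6⟩ := hc4.append
    have hlen : o + ((Cmd.ifc φ c).code o).length = o + (φ.code o 0).length + 2 +
        (c.code (o + (φ.code o 0).length + 2)).length := by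
      simp [Cmd.code]; omega
    rw [hlen]
    refine Triple.of_forall ?_
    rintro r₀ b₀ ⟨hI, hb⟩
    have h1 := φ.code_spec hwf.1 hc1 r₀ b₀ hI (L := L)
    have h2 : Triple prog L x (o + (φ.code o 0).length) (o + (φ.code o 0).length + 1) 1
        (Evaluated x Γ ρ s.A 0 (φ.Sat x s.A ρ) r₀ b₀)
        (fun r b => (Inv x Γ ρ s.A r ∧ b = s.buf) ∧ r 9 = truth (¬ φ.Sat x s.A ρ)) := by
      refine Triple.straight _ hc3 (by simp [Instr.Straight]) ?_
      rintro r b ⟨g1, g2, g3, -⟩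
      have g4 : Inv x Γ ρ s.A (List.foldl (Instr.exec x) r [Instr.sub 9 1 (re 0)]) := by
        have h1 : 1 - r (re 0) ≤ regBound x.length := by
          have := le_regBound (B := x.length) (q := 1) (by omega)
          omega
        have h2 : re 0 ≠ 9 := by simp [re]
        refine g1.scratch (e := 0) ?_ ?_ ?_ ?_ ?_ ?_ <;>
          simp +contextual [Instr.exec, g1.one, g1.bd, h1, h2]
      exact ⟨⟨g4, g2.trans hb⟩, by simp [Instr.exec, g1.one, g3, truth_not]⟩
    have h3 := Triple.jump (L := L) (x := x) (T := c.time.eval x.length)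
      (P := fun r b => (Inv x Γ ρ s.A r ∧ b = s.buf) ∧ r 9 = truth (¬ φ.Sat x s.A ρ))
      (R := fun r b => Inv x Γ ρ ((Cmd.ifc φ c).eval x ρ s).A r ∧
        b = ((Cmd.ifc φ c).eval x ρ s).buf) hc5.cons.1 ?_ ?_
    · exact (h1.seq (h2.seq h3)).weaken (by simp [Cmd.time]) (fun _ _ h => h) (fun _ _ h => h)
    · rintro r b ⟨hr, h9⟩ hpos
      have : ¬ φ.Sat x s.A ρ := by
        intro h
        rw [h9, truth_neg (not_not.2 h)] at hpos
        omega
      simpa only [Cmd.eval, if_neg this] using hr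
    · by_cases hφ : φ.Sat x s.A ρ
      · refine (ih hwf.2 hc6 s).weaken le_rfl (fun r b h => h.1.1) ?_
        simp only [Cmd.eval, if_pos hφ]
        exact fun _ _ h => h
      · intro d _ h
        rw [h.1.2, truth_pos hφ] at h
        exact absurd h.2 one_ne_zero
  | print n =>
    intro Γ ρ o hwf hc s
    simp only [Cmd.wf, decide_eq_true_eq] at hwf
    rw [Cmd.code] at hc
    obtain ⟨hc1, hc2⟩ := hc.cons
    refine ((Triple.straight_one hc1 (by simp [Instr.Straight]) (Q := fun r b =>
      (Inv x Γ ρ s.A r ∧ r 9 = n) ∧ b = s.buf) ?_).seq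
      (Triple.print hc2.cons.1 ?_)).weaken (by simp [Cmd.time]) (fun _ _ h => h) (fun _ _ h => h)
    · rintro r b ⟨h, hb⟩
      have h1 : n ≤ regBound x.length := le_regBound (by omega)
      have h2 : re 0 ≠ 9 := by simp [re]
      refine ⟨⟨h.scratch (e := 0) ?_ ?_ ?_ ?_ ?_ ?_, by simp [Instr.exec]⟩, hb⟩ <;>
        simp +contextual [Instr.exec, h.bd, h1, h2]
    · rintro r b ⟨⟨h, h9⟩, rfl⟩
      simp only [Cmd.eval, h9, and_true]
      exact h

end Code

/-! ### Complexity of compiled programs -/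

theorem fine_loopCode {o v : ℕ} {body : List Instr} (h : ∀ a ∈ body, a.Fine 64) :
    ∀ a ∈ loopCode o v body, a.Fine 64 := by
  intro a ha
  simp only [loopCode, List.mem_append, List.mem_cons, List.not_mem_nil, or_false] at ha
  rcases ha with (rfl | rfl | rfl) | (ha | rfl | rfl | rfl | rfl | rfl)
  case inr.inl => exact h a ha
  all_goals simp [Instr.Fine]

theorem Fm.fine_code (φ : Fm) : ∀ {Γ : List ℕ} {o e : ℕ}, φ.wf Γ = true →
    ∀ a ∈ φ.code o e, a.Fine 64 := by
  induction φ with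
  | not φ ih =>
    intro Γ o e hwf a ha
    simp only [Fm.code, List.mem_append, List.mem_singleton] at ha
    rcases ha with ha | rfl
    · exact ih hwf a ha
    · simp [Instr.Fine]
  | and φ ψ ih₁ ih₂ =>
    intro Γ o e hwf a ha
    simp only [Fm.wf, Bool.and_eq_true] at hwf
    simp only [Fm.code, List.mem_append, List.mem_cons, List.not_mem_nil, or_false] at ha
    rcases ha with ha | ha | rfl | rfl
    · exact ih₁ hwf.1 a ha
    · exact ih₂ hwf.2 a ha
    all_goals simp [Instr.Fine]
  | ex v φ ih =>
    intro Γ o e hwf a ha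
    simp only [Fm.wf, Bool.and_eq_true] at hwf
    rw [Fm.code, List.mem_append] at ha
    rcases ha with ha | ha
    · simp only [List.mem_singleton] at ha
      subst ha
      simp [Instr.Fine]
    · refine fine_loopCode (fun b hb => ?_) a ha
      simp only [List.mem_append, List.mem_cons, List.not_mem_nil, or_false] at hb
      rcases hb with hb | rfl | rfl | rfl
      · exact ih hwf.2 b hb
      all_goals simp [Instr.Fine]
  | _ =>
    intro Γ o e hwf
    simp only [Fm.wf, Bool.and_eq_true, decide_eq_true_eq] at hwf
    simp [Fm.code, eqCode, cellCode, Instr.Fine]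
    try omega

/-- `Instr.Fine` serves twice: it bounds the constants for the cost estimate, and it excludes oracle
instructions, which makes the requirements on oracle calls vacuous. -/
theorem Cmd.fine_code (c : Cmd) : ∀ {Γ : List ℕ} {o : ℕ}, c.wf Γ = true →
    ∀ a ∈ c.code o, a.Fine 64 := by
  induction c with
  | asg b u v φ =>
    intro Γ o hwf
    simp only [Cmd.wf, Bool.and_eq_true, decide_eq_true_eq] at hwf
    refine fine_loopCode (fine_loopCode fun a ha => ?_)
    simp only [cellCode, List.mem_append, List.mem_cons, List.not_mem_nil, or_false] at ha
    rcases ha with ha | (rfl | rfl | rfl) | rfl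
    · exact φ.fine_code hwf.1.1.2 a ha
    all_goals simp only [Instr.Fine]
    omega
  | seq c d ih₁ ih₂ =>
    intro Γ o hwf a ha
    simp only [Cmd.wf, Bool.and_eq_true] at hwf
    rw [Cmd.code, List.mem_append] at ha
    rcases ha with ha | ha
    · exact ih₁ hwf.1 a ha
    · exact ih₂ hwf.2 a ha
  | forv v c ih =>
    intro Γ o hwf
    simp only [Cmd.wf, Bool.and_eq_true] at hwf
    exact fine_loopCode (ih hwf.2)
  | ifc φ c ih =>
    intro Γ o hwf a ha
    simp only [Cmd.wf, Bool.and_eq_true] at hwf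
    simp only [Cmd.code, List.mem_append, List.mem_singleton] at ha
    rcases ha with ha | rfl | rfl | ha
    · exact φ.fine_code hwf.1 a ha
    · simp [Instr.Fine]
    · simp [Instr.Fine]
    · exact ih hwf.2 a ha
  | print n =>
    intro Γ o hwf a ha
    simp only [Cmd.wf, decide_eq_true_eq] at hwf
    simp only [Cmd.code, List.mem_cons, List.not_mem_nil, or_false] at ha
    rcases ha with rfl | rfl <;> simp [Instr.Fine, hwf]

/-! ### Initialization of the machine, and membership in `P` -/

/-- Code that measures the input and initializes the constants. -/
def prelude : List Instr :=
  [.set 1 1, .set 5 64] ++ ([.input 9 3, .add 3 3 1, .add 7 7 5] ++ [.jpos 9 2])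

/-- The initial state of programs. -/
def St.init : St := ⟨fun _ _ _ => False, []⟩

section

variable {l : ℕ} {prog : Program} {L : Set (Word l)} {x : Word 18}

/-- Position `|x|` is the first one with letter code `0`, so the loop makes `|x| + 1` rounds;
register 7 collects 64 per round and ends up with the stride of the address computation. The even
registers are still `0`, so all relations are empty. -/
theorem prelude_spec (hc : CodeAt prog 0 prelude) (ρ : ℕ → ℕ) :
    Triple prog L x 0 6 (2 + (x.length + 1) * (3 + 1)) (fun r b => r = (fun _ => 0) ∧ b = [])
      (fun r b => Inv x [] ρ St.init.A r ∧ b = St.init.buf) := by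
  obtain ⟨hc1, hc2⟩ := hc.append
  obtain ⟨hc3, hc4⟩ := hc2.append
  let I : ℕ → (ℕ → ℕ) → Word 18 → Prop := fun i r b => b = [] ∧ r 1 = 1 ∧ r 3 = i ∧ r 5 = 64 ∧
    r 7 = 64 * i ∧ r 9 ≤ 64 ∧ ∀ q, q ≠ 1 → q ≠ 3 → q ≠ 5 → q ≠ 7 → q ≠ 9 → r q = 0
  have h1 : Triple prog L x 0 2 2 (fun r b => r = (fun _ => 0) ∧ b = []) (I 0) := by
    refine Triple.straight _ hc1 (by simp [Instr.Straight]) ?_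
    rintro r b ⟨rfl, rfl⟩
    refine ⟨rfl, ?_⟩
    simp +contextual [Instr.exec]
  have h2 : ∀ i < x.length + 1, Triple prog L x 2 5 3 (I i)
      (fun r b => I (i + 1) r b ∧ (0 < r 9 ↔ i + 1 < x.length + 1)) := by
    intro i hi
    refine Triple.straight _ hc3 (by simp [Instr.Straight]) ?_
    rintro r b ⟨rfl, g1, g3, g5, g7, g9, g⟩
    have hle := letterCode_le x[i]?
    refine ⟨⟨rfl, ?_, ?_, ?_, ?_, ?_, ?_⟩, ?_⟩
    · simp [Instr.exec, g1]
    · simp [Instr.exec, g3, g1]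
    · simp [Instr.exec, g5]
    · simp [Instr.exec, g7, g5]; omega
    · simp [Instr.exec, g3]; omega
    · intro q q1 q3 q5 q7 q9
      simp [Instr.exec, Function.update_of_ne, *]
    · have h9 : List.foldl (Instr.exec x) r [Instr.input 9 3, Instr.add 3 3 1, Instr.add 7 7 5] 9 =
          letterCode x[i]? := by simp [Instr.exec, g3]
      rw [h9]
      by_cases hx : i < x.length
      · simp [hx, letterCode]
      · simp [letterCode, hx]
  have h3 := Triple.doWhile I (Nat.succ_pos _) h2 hc4.cons.1
  refine (h1.seq h3).weaken le_rfl (fun _ _ h => h) ?_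
  rintro r b ⟨rfl, g1, g3, g5, g7, g9, g⟩
  refine ⟨⟨g1, g3, g5, g7, by simp, by simp, by simp, by simp, ?_, ?_⟩, rfl⟩
  · intro a _ i _ j _
    have : cell x.length a i j % 2 = 0 := by unfold cell; rw [Nat.mul_assoc]; omega
    rw [truth_neg (by simp [St.init])]
    refine g _ ?_ ?_ ?_ ?_ ?_ <;> omega
  · intro q
    refine le_regBound ?_
    by_cases q1 : q = 1
    · subst q1; omega
    by_cases q3 : q = 3
    · subst q3; omega
    by_cases q5 : q = 5
    · subst q5; omega
    by_cases q7 : q = 7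
    · subst q7; omega
    by_cases q9 : q = 9
    · subst q9; omega
    rw [g q q1 q3 q5 q7 q9]
    omega

end

open Polynomial in
/-- `regBound` as a polynomial. -/
noncomputable def regPoly : Polynomial ℕ := 64 * (X + 2) * (X + 2) + 64

theorem regPoly_eval (n : ℕ) : regPoly.eval n = regBound n := by
  simp [regPoly, regBound]

/-- A bound for the time of `T` steps. -/
noncomputable def timePoly (T : Polynomial ℕ) : Polynomial ℕ := T * (1 + 2 * (regPoly + T))

theorem timePoly_eval (T : Polynomial ℕ) (n : ℕ) :
    (timePoly T).eval n = T.eval n * (1 + 2 * (regBound n + T.eval n)) := by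
  simp [timePoly, regPoly_eval]

theorem fine_prelude : ∀ a ∈ prelude, a.Fine 64 := by
  intro a ha
  simp only [prelude, List.mem_append, List.mem_cons, List.not_mem_nil, or_false] at ha
  rcases ha with (rfl | rfl) | (rfl | rfl | rfl) | rfl <;> simp [Instr.Fine]

theorem time_le_of_reg_le {l : ℕ} {prog : Program} {L : Set (Word l)} {x : Word 18}
    (hprog : ∀ a ∈ prog, a.Fine 64) {T : Polynomial ℕ} (c : Config 18 l)
    (hc : ∀ q, c.reg q ≤ regBound x.length) {t : ℕ} (ht : t ≤ T.eval x.length) :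
    ((step prog L x)^[t] c).time ≤ c.time + (timePoly T).eval x.length := by
  have h64 : 64 ≤ regBound x.length := le_regBound (by omega)
  have := time_bound (L := L) (x := x) hprog h64 (by omega) c hc ht
  rwa [timePoly_eval]

open Polynomial in
/-- Problems that are decided by a program whose answer is the truth value of `A 0 0 0` are
in `P`. -/
theorem mem_classP_of_cmd {Q : DecisionProblem 18} {c : Cmd} (hwf : c.wf [] = true)
    (h : ∀ x ∈ Q.I, (c.eval x (fun _ => 0) St.init).A 0 0 0 ↔ x ∈ Q.Yes) : Q ∈ classP 18 := by
  have hfine : ∀ a ∈ prelude ++ c.code 6, a.Fine 64 := by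
    intro a ha
    rcases List.mem_append.1 ha with ha | ha
    · exact fine_prelude a ha
    · exact c.fine_code hwf a ha
  refine ⟨prelude ++ c.code 6, timePoly (2 + (X + 1) * (3 + 1) + c.time), fun x hx => ?_⟩
  have hc0 : CodeAt (prelude ++ c.code 6) 0 (prelude ++ c.code 6) := by
    have := codeAt_append_left [] (prelude ++ c.code 6) []
    simpa using this
  have hrun := (prelude_spec (L := (∅ : Set (Word 0))) (x := x) hc0.append.1 (fun _ => 0)).seq
    (c.code_spec hwf hc0.append.2 St.init)
  obtain ⟨t, ht, hpc, ⟨hI, -⟩, -⟩ := hrun (Config.init 18 0) rfl ⟨rfl, rfl⟩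
  refine ⟨t, ?_, ?_, ?_⟩
  · rw [Config.Halted, run, hpc, List.getElem?_eq_none]
    simp [prelude]; omega
  · have := time_le_of_reg_le (L := (∅ : Set (Word 0))) (x := x) hfine
      (T := 2 + (X + 1) * (3 + 1) + c.time) (Config.init 18 0) (fun q => Nat.zero_le _)
      (t := t) (by simpa using ht)
    simpa [Config.init, run] using this
  · rw [← h x hx]
    have := hI.arr 0 (by omega) 0 (by omega) 0 (by omega)
    simp only [cell, Nat.mul_zero, Nat.add_zero] at this
    rw [run, this]
    by_cases hA : (c.eval x (fun _ => 0) St.init).A 0 0 0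
    · simp [hA, truth_pos]
    · simp [hA, truth_neg]

/-! ### The enumeration loop on the machine -/

section Jump

variable {k l : ℕ} {prog : Program} {L : Set (Word l)} {x : Word k} {o o' : ℕ}
  {P Q : (ℕ → ℕ) → Word k → Prop}

theorem Triple.jump_taken {j : ℕ} (ha : prog[o]? = some (.jpos j o'))
    (h : ∀ r b, P r b → 0 < r j ∧ Q r b) : Triple prog L x o o' 1 P Q := by
  intro c hc hP
  refine ⟨1, le_rfl, ?_⟩
  have := h _ _ hP
  subst hc
  simp_all [step]

theorem Triple.jump_not_taken {j : ℕ} (ha : prog[o]? = some (.jpos j o'))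
    (h : ∀ r b, P r b → r j = 0 ∧ Q r b) : Triple prog L x o (o + 1) 1 P Q := by
  intro c hc hP
  refine ⟨1, le_rfl, ?_⟩
  have := h _ _ hP
  subst hc
  simp_all [step]

end Jump

/-- The machine program that, after the initialization `c`, repeats the following as long as
`A 0 0 0` holds: print a solution by means of `p`, output it, execute `d`. -/
def enumProg (c p d : Cmd) : Program :=
  let pre := prelude ++ c.code 6
  let o := pre.length
  let o' := o + 2 + (p.code (o + 2)).length + 1
  pre ++ ([.sub 9 1 0] ++ ([.jpos 9 (o' + (d.code o').length + 1)] ++ (p.code (o + 2) ++ ([.emit] ++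
    (d.code o' ++ [.jpos 1 o])))))

open Classical in
/-- Correctness of the enumeration loop. The predicate `J Y s` says that in state `s` the solutions
in `Y` have still to be output. -/
structure EnumInvariant (x : Word 18) (p d : Cmd) (J : Finset (Word 18) → St → Prop) : Prop where
  buf : ∀ Y s, J Y s → s.buf = []
  flag : ∀ Y s, J Y s → (s.A 0 0 0 ↔ Y.Nonempty)
  mem : ∀ Y s, J Y s → Y.Nonempty → (p.eval x (fun _ => 0) s).buf ∈ Y
  next : ∀ Y s, J Y s → Y.Nonempty → J (Y.erase (p.eval x (fun _ => 0) s).buf)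
    (d.eval x (fun _ => 0) { p.eval x (fun _ => 0) s with buf := [] })

open Polynomial in
/-- A bound for the number of steps of each phase of the enumeration. -/
noncomputable def enumTime (c p d : Cmd) : Polynomial ℕ :=
  2 + (X + 1) * (3 + 1) + c.time + p.time + d.time + 3

section Enum

variable {l : ℕ} {L : Set (Word l)} {x : Word 18}

/-- The cell of `A 0 0 0` is register 0, which the driver loop tests directly. -/
theorem Inv.flag {Γ : List ℕ} {ρ : ℕ → ℕ} {A : Arrays} {r : ℕ → ℕ} (h : Inv x Γ ρ A r) :
    r 0 = truth (A 0 0 0) := by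
  have := h.arr 0 (by omega) 0 (by omega) 0 (by omega)
  simpa only [cell, Nat.mul_zero, Nat.add_zero] using this

open Classical in
-- Induction on the number of pending solutions. Here `tl` is the time of the last output. At the
-- loop head at most `E` has passed since then, the test and the printing take at most another `E`,
-- and `emit` costs one; this gives the delay `2 * E + 1`.
theorem enum_loop {c p d : Cmd} {J : Finset (Word 18) → St → Prop} {o o' : ℕ} {prog : Program}
    (hJ : EnumInvariant x p d J) (hp : p.wf [] = true)
    (hd : d.wf [] = true) (hfine : ∀ a ∈ prog, a.Fine 64)
    (h1 : prog[o]? = some (.sub 9 1 0)) (h2 : prog[o + 1]? = some (.jpos 9 prog.length))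
    (h3 : CodeAt prog (o + 2) (p.code (o + 2)))
    (h4 : o' = o + 2 + (p.code (o + 2)).length + 1) (h5 : prog[o' - 1]? = some .emit)
    (h6 : CodeAt prog o' (d.code o')) (h7 : prog[o' + (d.code o').length]? = some (.jpos 1 o))
    {E : ℕ} (hE : E = (timePoly (enumTime c p d)).eval x.length) (N : ℕ) :
    ∀ (Y : Finset (Word 18)) (s : St) (cfg : Config 18 l) (tl : ℕ), Y.card = N → J Y s →
      cfg.pc = o → Inv x [] (fun _ => 0) s.A cfg.reg → cfg.buf = [] → cfg.time ≤ tl + E →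
      ∃ t, ((step prog L x)^[t] cfg).Halted prog ∧ ∃ news,
        ((step prog L x)^[t] cfg).out = cfg.out ++ news ∧ (news.map Prod.fst).Nodup ∧
        (∀ y, y ∈ news.map Prod.fst ↔ y ∈ Y) ∧
        List.IsChain (fun a b => b ≤ a + (2 * E + 1))
          (tl :: news.map Prod.snd ++ [((step prog L x)^[t] cfg).time]) := by
  -- Each segment is estimated afresh from the register bound contained in `Inv`. Hence register
  -- sizes do not accumulate over the possibly exponentially many rounds.
  have hseg : ∀ (cfg : Config 18 l) (s : St), Inv x [] (fun _ => 0) s.A cfg.reg →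
      ∀ t ≤ (enumTime c p d).eval x.length,
      ((step prog L x)^[t] cfg).time ≤ cfg.time + E := by
    intro cfg s hI t ht
    rw [hE]
    exact time_le_of_reg_le hfine cfg hI.bd ht
  have htime : (enumTime c p d).eval x.length = 2 + (x.length + 1) * (3 + 1) +
      c.time.eval x.length + p.time.eval x.length + d.time.eval x.length + 3 := by
    simp [enumTime]
  have htest : ∀ s : St, Triple prog L x o (o + 1) 1
      (fun r b => Inv x [] (fun _ => 0) s.A r ∧ b = s.buf)
      (fun r b => (Inv x [] (fun _ => 0) s.A r ∧ b = s.buf) ∧ r 9 = truth (¬ s.A 0 0 0)) := by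
    intro s
    refine Triple.straight_one h1 (by simp [Instr.Straight]) ?_
    rintro r b ⟨hI, hb⟩
    have h1 : 1 - r 0 ≤ regBound x.length := by
      have := le_regBound (B := x.length) (q := 1) (by omega)
      omega
    have h2 : re 0 ≠ 9 := by simp [re]
    refine ⟨⟨hI.scratch (e := 0) ?_ ?_ ?_ ?_ ?_ ?_, hb⟩, ?_⟩ <;>
      simp +contextual [Instr.exec, hI.one, hI.bd, h2, truth_not, hI.flag]
    have := hI.flag
    omega
  induction N with
  | zero =>
    intro Y s cfg tl hY hs hpc hI hb ht
    have hA : ¬ s.A 0 0 0 := by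
      rw [hJ.flag Y s hs, Finset.not_nonempty_iff_eq_empty, ← Finset.card_eq_zero, hY]
    obtain ⟨t, ht', g1, g2, g3⟩ := ((htest s).seq (Triple.jump_taken (Q := fun _ _ => True) h2
      (fun r b h => ⟨by rw [h.2, truth_pos hA]; omega, trivial⟩))) cfg hpc
      ⟨hI, hb.trans (hJ.buf Y s hs).symm⟩
    refine ⟨t, ?_, [], ?_, by simp, ?_, ?_⟩
    · rw [Config.Halted, g1, List.getElem?_eq_none le_rfl]
    · simpa using g3
    · simp [Finset.card_eq_zero.1 hY]
    · have := hseg cfg s hI t (by omega)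
      simp only [List.map_nil, List.cons_append, List.nil_append, List.isChain_cons_cons,
        List.isChain_singleton, and_true]
      omega
  | succ N ih =>
    intro Y s cfg tl hY hs hpc hI hb ht
    have hne : Y.Nonempty := Finset.card_pos.1 (by omega)
    have hA : s.A 0 0 0 := (hJ.flag Y s hs).2 hne
    set s₁ := p.eval x (fun _ => 0) s with hs₁
    obtain ⟨t, ht', g1, ⟨g2, g2'⟩, g3⟩ := ((htest s).seq ((Triple.jump_not_taken
      (Q := fun r b => Inv x [] (fun _ => 0) s.A r ∧ b = s.buf) h2
      (fun r b h => ⟨by rw [h.2, truth_neg (not_not.2 hA)], h.1⟩)).seq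
      (p.code_spec hp h3 s))) cfg hpc ⟨hI, hb.trans (hJ.buf Y s hs).symm⟩
    set c₁ := (step prog L x)^[t] cfg with hc₁
    have hpc1 : c₁.pc = o' - 1 := by rw [g1, h4]; omega
    have hemit : step prog L x c₁ = { c₁ with
        pc := c₁.pc + 1, buf := [], out := c₁.out ++ [(c₁.buf, c₁.time + 1)],
        time := c₁.time + 1 } := by
      simp [step, hpc1, h5, Instr.cost]
    have hpc2 : (step prog L x c₁).pc = o' := by rw [hemit]; simp only [hpc1]; omega
    obtain ⟨t', ht'', k1, ⟨k2, k2'⟩, k3⟩ := ((d.code_spec hd h6 ⟨s₁.A, []⟩).seq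
      (Triple.jump_taken (Q := fun r b =>
        Inv x [] (fun _ => 0) (d.eval x (fun _ => 0) ⟨s₁.A, []⟩).A r ∧
          b = (d.eval x (fun _ => 0) ⟨s₁.A, []⟩).buf) h7
      (fun r b h => ⟨by rw [h.1.one]; omega, h⟩))) (step prog L x c₁) hpc2
      ⟨by rw [hemit]; exact g2, by rw [hemit]⟩
    set c₂ := (step prog L x)^[t'] (step prog L x c₁) with hc₂
    have hmem := hJ.mem Y s hs hne
    have hnext := hJ.next Y s hs hne
    have htime1 : c₁.time ≤ cfg.time + E := hseg cfg s hI t (by omega)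
    have htime2 : c₂.time ≤ (c₁.time + 1) + E := by
      have := hseg (step prog L x c₁) s₁ (by rw [hemit]; exact g2) t' (by omega)
      rw [hemit] at this
      rw [hc₂, hemit]
      exact this
    obtain ⟨t'', m1, news, m2, m3, m4, m5⟩ := ih (Y.erase s₁.buf) (d.eval x (fun _ => 0) ⟨s₁.A, []⟩)
      c₂ (c₁.time + 1) (by rw [Finset.card_erase_of_mem hmem, hY]; rfl) hnext k1 k2
      (k2'.trans (hJ.buf _ _ hnext)) htime2
    have hiter : (step prog L x)^[t'' + (t' + (t + 1))] cfg = (step prog L x)^[t''] c₂ := by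
      rw [Function.iterate_add_apply, Function.iterate_add_apply, Function.iterate_succ_apply']
    refine ⟨t'' + (t' + (t + 1)), ?_⟩
    rw [hiter]
    refine ⟨m1, (s₁.buf, c₁.time + 1) :: news, ?_, ?_, ?_, ?_⟩
    · rw [m2, k3, hemit]
      simp only [g3, g2', ← hs₁, List.append_assoc, List.singleton_append]
    · rw [List.map_cons, List.nodup_cons]
      refine ⟨fun h => ?_, m3⟩
      simpa using (m4 _).1 h
    · intro y
      rw [List.map_cons, List.mem_cons, m4, Finset.mem_erase]
      constructor
      · rintro (rfl | h)
        · exact hmem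
        · exact h.2
      · intro h
        by_cases hy : y = s₁.buf
        · exact .inl hy
        · exact .inr ⟨hy, h⟩
    · rw [List.map_cons, List.cons_append, List.cons_append, List.isChain_cons_cons]
      exact ⟨by omega, m5⟩

open Classical Polynomial in
-- The problem `Q` only fills the place of the oracle; the machine is built from commands, which
-- cannot call it.
theorem inDel_of_cmd {C : DecisionClass} {Q : DecisionProblem l} (hQ : Q ∈ C l)
    {P : EnumProblem 18} {c p d : Cmd} (hc : c.wf [] = true) (hp : p.wf [] = true)
    (hd : d.wf [] = true)
    (h : ∀ x ∈ P.I, ∃ (J : Finset (Word 18) → St → Prop) (Y : Finset (Word 18)),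
      EnumInvariant x p d J ∧ J Y (c.eval x (fun _ => 0) St.init) ∧ (Y : Set (Word 18)) = P.Sol x) :
    InDel C P := by
  set prog := enumProg c p d with hprog
  have hfine : ∀ a ∈ prog, a.Fine 64 := by
    intro a ha
    simp only [hprog, enumProg, List.mem_append, List.mem_singleton] at ha
    rcases ha with (ha | ha) | rfl | rfl | ha | rfl | ha | rfl
    · exact fine_prelude a ha
    · exact c.fine_code hc a ha
    · simp [Instr.Fine]
    · simp [Instr.Fine]
    · exact p.fine_code hp a ha
    · simp [Instr.Fine]
    · exact d.fine_code hd a ha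
    · simp [Instr.Fine]
  refine ⟨l, Q, hQ, prog, 2 * timePoly (enumTime c p d) + 1, fun x hx => ⟨?_, fun t m hq => ?_⟩⟩
  swap
  -- No compiled instruction is a query, so there is no oracle call to be checked.
  · exact absurd (hfine _ (List.mem_of_getElem? hq)) (by simp [Instr.Fine])
  obtain ⟨J, Y, hJ, hY, hYS⟩ := h x hx
  have hcode : CodeAt prog 0 prog := by
    have := codeAt_append_left [] prog []
    simpa using this
  set o := (prelude ++ c.code 6).length with ho
  set o' := o + 2 + (p.code (o + 2)).length + 1 with ho'
  have hcode' : CodeAt prog 0 ((prelude ++ c.code 6) ++ ([.sub 9 1 0] ++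
      ([.jpos 9 (o' + (d.code o').length + 1)] ++ (p.code (o + 2) ++ ([.emit] ++
      (d.code o' ++ [.jpos 1 o])))))) := hcode
  have hlen : prog.length = o' + (d.code o').length + 1 := by
    simp only [hprog, enumProg, List.length_append, ← ho, ← ho', List.length_singleton]
    omega
  rw [← hlen] at hcode'
  obtain ⟨a0, a1⟩ := hcode'.append
  obtain ⟨a1, a2⟩ := a1.append
  obtain ⟨a2, a3⟩ := a2.append
  obtain ⟨a3, a4⟩ := a3.append
  obtain ⟨a4, a5⟩ := a4.append
  obtain ⟨a5, a6⟩ := a5.append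
  simp only [← ho, Nat.zero_add, List.length_singleton] at a1 a2 a3 a4 a5 a6
  have hrun := (prelude_spec (L := Q.Yes) (x := x) a0.append.1 (fun _ => 0)).seq
    (c.code_spec hc a0.append.2 St.init)
  obtain ⟨t, ht, hpc, ⟨hI, hb⟩, hout⟩ := hrun (Config.init 18 l) rfl ⟨rfl, rfl⟩
  set c₀ := (step prog Q.Yes x)^[t] (Config.init 18 l) with hc₀
  have htime : c₀.time ≤ 0 + (timePoly (enumTime c p d)).eval x.length :=
    time_le_of_reg_le hfine (Config.init 18 l) (fun q => Nat.zero_le _)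
      (by
        have : (enumTime c p d).eval x.length = 2 + (x.length + 1) * (3 + 1) +
          c.time.eval x.length + p.time.eval x.length + d.time.eval x.length + 3 := by
          simp [enumTime]
        omega)
  obtain ⟨t', m1, news, m2, m3, m4, m5⟩ := enum_loop (L := Q.Yes) (c := c) (o := o) hJ hp hd hfine
    a1.cons.1 a2.cons.1 a3 ho' a4.cons.1 a5 a6.cons.1 rfl Y.card Y _ c₀ 0 rfl hY
    (by rw [hpc, ho, List.length_append]; rfl) hI (hb.trans (hJ.buf _ _ hY)) htime
  have hiter : run prog Q.Yes x (t' + t) = (step prog Q.Yes x)^[t'] c₀ := by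
    rw [run, Function.iterate_add_apply]
  have hnil : (Config.init 18 l).out = [] := rfl
  refine ⟨t' + t, ?_⟩
  simp only [hiter]
  rw [m2, hout, hnil, List.nil_append]
  refine ⟨m1, m3, fun y => ?_, ?_⟩
  · rw [m4, ← hYS, Finset.mem_coe]
  · simpa using m5

end Enum

/-! ### Derived formulas and programs -/

namespace Fm

/-- Disjunction. -/
def or (φ ψ : Fm) : Fm := .not (.and (.not φ) (.not ψ))
/-- Implication. -/
def imp (φ ψ : Fm) : Fm := .not (.and φ (.not ψ))
/-- Universal quantification. -/
def all (v : ℕ) (φ : Fm) : Fm := .not (.ex v (.not φ))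

variable {x : Word 18} {A : Arrays} {ρ : ℕ → ℕ}

@[simp] theorem sat_inp (u c : ℕ) : (Fm.inp u c).Sat x A ρ ↔ letterCode x[ρ u]? = c := Iff.rfl
@[simp] theorem sat_same (u v : ℕ) :
    (Fm.same u v).Sat x A ρ ↔ letterCode x[ρ u]? = letterCode x[ρ v]? := Iff.rfl
@[simp] theorem sat_cst (u c : ℕ) : (Fm.cst u c).Sat x A ρ ↔ ρ u = c := Iff.rfl
@[simp] theorem sat_addc (u c v : ℕ) : (Fm.addc u c v).Sat x A ρ ↔ ρ u + c = ρ v := Iff.rfl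
@[simp] theorem sat_add (u v w : ℕ) : (Fm.add u v w).Sat x A ρ ↔ ρ u + ρ v = ρ w := Iff.rfl
@[simp] theorem sat_lt (u v : ℕ) : (Fm.lt u v).Sat x A ρ ↔ ρ u < ρ v := Iff.rfl
@[simp] theorem sat_arr (a u v : ℕ) : (Fm.arr a u v).Sat x A ρ ↔ A a (ρ u) (ρ v) := Iff.rfl
@[simp] theorem sat_not (φ : Fm) : φ.not.Sat x A ρ ↔ ¬ φ.Sat x A ρ := Iff.rfl
@[simp] theorem sat_and (φ ψ : Fm) : (φ.and ψ).Sat x A ρ ↔ φ.Sat x A ρ ∧ ψ.Sat x A ρ := Iff.rfl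
@[simp] theorem sat_ex (v : ℕ) (φ : Fm) :
    (Fm.ex v φ).Sat x A ρ ↔ ∃ i ≤ x.length, φ.Sat x A (Function.update ρ v i) := Iff.rfl
@[simp] theorem sat_or (φ ψ : Fm) : (φ.or ψ).Sat x A ρ ↔ φ.Sat x A ρ ∨ ψ.Sat x A ρ := by
  simp only [or, sat_not, sat_and]; tauto
@[simp] theorem sat_imp (φ ψ : Fm) : (φ.imp ψ).Sat x A ρ ↔ (φ.Sat x A ρ → ψ.Sat x A ρ) := by
  simp only [imp, sat_not, sat_and]; tauto
@[simp] theorem sat_all (v : ℕ) (φ : Fm) :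
    (Fm.all v φ).Sat x A ρ ↔ ∀ i ≤ x.length, φ.Sat x A (Function.update ρ v i) := by
  simp only [all, sat_not, sat_ex]; push Not; rfl

end Fm

/-- The program does not print. -/
def Cmd.quiet : Cmd → Bool
  | .asg _ _ _ _ => true
  | .seq c d => c.quiet && d.quiet
  | .forv _ c => c.quiet
  | .ifc _ c => c.quiet
  | .print _ => false

theorem Cmd.eval_buf {x : Word 18} (c : Cmd) (h : c.quiet = true) (ρ : ℕ → ℕ) (s : St) :
    (c.eval x ρ s).buf = s.buf := by
  induction c generalizing ρ s with
  | asg b u v φ => rfl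
  | seq c d ih₁ ih₂ =>
    simp only [Cmd.quiet, Bool.and_eq_true] at h
    rw [Cmd.eval, ih₂ h.2, ih₁ h.1]
  | forv v c ih =>
    simp only [Cmd.eval]
    generalize x.length + 1 = n
    induction n with
    | zero => rfl
    | succ n ih' => rw [iter, ih h, ih']
  | ifc φ c ih =>
    simp only [Cmd.eval]
    split_ifs
    · exact ih h _ _
    · rfl
  | print n => simp [Cmd.quiet] at h

/-- The rule for loops. -/
theorem Cmd.eval_forv_induction {x : Word 18} {v : ℕ} {c : Cmd} {ρ : ℕ → ℕ} {s : St}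
    (P : ℕ → St → Prop) (h0 : P 0 s)
    (hs : ∀ i ≤ x.length, ∀ s', P i s' → (∀ a, c.writes a = false → s'.A a = s.A a) →
      P (i + 1) (c.eval x (Function.update ρ v i) s')) :
    P (x.length + 1) ((Cmd.forv v c).eval x ρ s) := by
  have key : ∀ n ≤ x.length + 1,
      P n (iter (fun i s => c.eval x (Function.update ρ v i) s) n s) ∧
      ∀ a, c.writes a = false →
        (iter (fun i s => c.eval x (Function.update ρ v i) s) n s).A a = s.A a := by
    intro n
    induction n with
    | zero => exact fun _ => ⟨h0, fun _ _ => rfl⟩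
    | succ n ih =>
      intro hn
      obtain ⟨h1, h2⟩ := ih (by omega)
      refine ⟨hs n (by omega) _ h1 h2, fun a ha => ?_⟩
      rw [iter, c.eval_frame ha, h2 a ha]
  exact (key _ le_rfl).1

theorem Cmd.eval_asg {x : Word 18} (a u v : ℕ) (φ : Fm) (ρ : ℕ → ℕ) (s : St) :
    ((Cmd.asg a u v φ).eval x ρ s).A a =
      fun i j => φ.Sat x s.A (Function.update (Function.update ρ u i) v j) := by
  simp [Cmd.eval]

/-- Iteration of a definition: `A a` is replaced repeatedly by `{(4, 5) | φ}`. -/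
def Cmd.fix (a : ℕ) (φ : Fm) : Cmd :=
  .forv 3 (.seq (.asg 31 4 5 φ) (.asg a 4 5 (.arr 31 4 5)))

/-- A well-formed assignment may not read its own target, so each round computes into `A 31` and
copies back. All other relations stay fixed, which is why `f` may depend on them. -/
theorem Cmd.eval_fix {x : Word 18} {a : ℕ} {φ : Fm} {ρ : ℕ → ℕ} {s : St}
    (f : (ℕ → ℕ → Prop) → ℕ → ℕ → Prop)
    (hf : ∀ (A : Arrays) (k i j : ℕ), (∀ b, b ≠ a → b ≠ 31 → A b = s.A b) →
      (φ.Sat x A (Function.update (Function.update (Function.update ρ 3 k) 4 i) 5 j) ↔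
        f (A a) i j)) :
    ((Cmd.fix a φ).eval x ρ s).A a = f^[x.length + 1] (s.A a) := by
  refine Cmd.eval_forv_induction (fun i s' => s'.A a = f^[i] (s.A a)) rfl ?_
  intro k _ s' hs' hfr
  have hA : ∀ b, b ≠ a → b ≠ 31 → s'.A b = s.A b := fun b h1 h2 =>
    hfr b (by simp [Cmd.writes, h1, h2])
  rw [Cmd.eval, Cmd.eval_asg, Function.iterate_succ_apply', ← hs']
  funext i j
  simp only [Cmd.eval, Fm.sat_arr, Function.update_self, ne_eq,
    Nat.reduceEqDiff, not_false_eq_true, Function.update_of_ne]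
  rw [← hf s'.A k i j hA]

/-! ### Fixed points on finite sets -/

/-- By `hstep` a chain that pauses once pauses forever. If it still moved at `m ≥ n`, all earlier
inclusions would be strict, and the sets would outgrow `n` elements. -/
theorem stable_of_monotone {n : ℕ} (a : ℕ → Set (Fin n)) (hmono : ∀ k, a k ⊆ a (k + 1))
    (hstep : ∀ k, a k = a (k + 1) → a (k + 1) = a (k + 2)) {m : ℕ} (hm : n ≤ m) :
    a m = a (m + 1) := by
  by_contra hne
  have h1 : ∀ k ≤ m, a k ≠ a (k + 1) := by
    intro k hk heq
    have : ∀ d, a (k + d) = a (k + d + 1) := by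
      intro d
      induction d with
      | zero => exact heq
      | succ d ih => exact hstep _ ih
    have := this (m - k)
    rw [Nat.add_sub_cancel' hk] at this
    exact hne this
  have h2 : ∀ k ≤ m + 1, k ≤ (a k).ncard := by
    intro k
    induction k with
    | zero => simp
    | succ k ih =>
      intro hk
      have := Set.ncard_lt_ncard ((hmono k).ssubset_of_ne (h1 k (by omega))) (Set.toFinite _)
      have := ih (by omega)
      omega
  have h3 := h2 (m + 1) le_rfl
  have h4 : (a (m + 1)).ncard ≤ n := by
    have := Set.ncard_le_ncard (Set.subset_univ (a (m + 1))) (Set.toFinite _)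
    simpa [Set.ncard_univ] using this
  omega

theorem iterate_lfp {n m : ℕ} (hm : n ≤ m) {F : Set (Fin n) → Set (Fin n)} (hF : Monotone F) :
    F (F^[m] ∅) = F^[m] ∅ ∧ ∀ Z, F Z ⊆ Z → F^[m] ∅ ⊆ Z := by
  constructor
  · have := stable_of_monotone (fun k => F^[k] ∅) (fun k => ?_) (fun k h => ?_) hm
    · simp only [Function.iterate_succ_apply'] at this
      exact this.symm
    · induction k with
      | zero => exact Set.empty_subset _
      | succ k ih =>
        simp only [Function.iterate_succ_apply'] at ih ⊢
        exact hF ih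
    · simp only [Function.iterate_succ_apply'] at h ⊢
      exact congrArg F h
  · intro Z hZ
    clear hm
    induction m with
    | zero => exact Set.empty_subset _
    | succ m ih =>
      rw [Function.iterate_succ_apply']
      exact (hF ih).trans hZ

/-- The iterates decrease, so the stabilization argument is applied to their complements. -/
theorem iterate_gfp {n m : ℕ} (hm : n ≤ m) {F : Set (Fin n) → Set (Fin n)} (hF : Monotone F) :
    F (F^[m] Set.univ) = F^[m] Set.univ ∧ ∀ Z, Z ⊆ F Z → Z ⊆ F^[m] Set.univ := by
  constructor
  · have := stable_of_monotone (fun k => (F^[k] Set.univ)ᶜ) (fun k => ?_) (fun k h => ?_) hm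
    · simp only [Function.iterate_succ_apply', compl_inj_iff] at this
      exact this.symm
    · rw [Set.compl_subset_compl]
      induction k with
      | zero => exact Set.subset_univ _
      | succ k ih =>
        simp only [Function.iterate_succ_apply'] at ih ⊢
        exact hF ih
    · simp only [Function.iterate_succ_apply', compl_inj_iff] at h ⊢
      exact congrArg F h
  · intro Z hZ
    clear hm
    induction m with
    | zero => exact Set.subset_univ _
    | succ m ih =>
      rw [Function.iterate_succ_apply']
      exact hZ.trans (hF ih)

/-! ### Paths, submodels and fixed-point characterizations -/

namespace KripkeModel

variable {V P : Type*}

theorem mem_W_of_mem_paths {M : KripkeModel V P} {w : V} {π : ℕ → V} (hw : w ∈ M.W)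
    (hπ : π ∈ M.paths w) (i : ℕ) : π i ∈ M.W := by
  cases i with
  | zero => rw [hπ.1]; exact hw
  | succ i => exact (M.R_subset (hπ.2 i)).2

theorem exists_path {M : KripkeModel V P} {w : V} (hw : w ∈ M.W) : (M.paths w).Nonempty := by
  choose f hf using M.R_total
  let g : M.W → M.W := fun u => ⟨f u u.2, (M.R_subset (hf u u.2)).2⟩
  refine ⟨fun i => (g^[i] ⟨w, hw⟩ : M.W), rfl, fun i => ?_⟩
  simp only [Function.iterate_succ_apply']
  exact hf _ _

/-- The path that starts with `w` and continues with `π`. -/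
def consPath (w : V) (π : ℕ → V) : ℕ → V
  | 0 => w
  | i + 1 => π i

theorem consPath_mem {M : KripkeModel V P} {w v : V} {π : ℕ → V} (h : (w, v) ∈ M.R)
    (hπ : π ∈ M.paths v) : consPath w π ∈ M.paths w := by
  refine ⟨rfl, fun i => ?_⟩
  cases i with
  | zero => simpa [consPath, hπ.1] using h
  | succ i => exact hπ.2 i

theorem tail_mem {M : KripkeModel V P} {w : V} {π : ℕ → V} (hπ : π ∈ M.paths w) :
    (fun i => π (i + 1)) ∈ M.paths (π 1) := ⟨rfl, fun i => hπ.2 (i + 1)⟩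

/-- Induction on the formula: a witnessing path of the submodel is a path of the model, and it stays
among the worlds of the submodel, where the induction hypotheses apply. The negation in `⊥` is
harmless, since `⊥` holds nowhere. -/
theorem IsSubmodel.sat {M M' : KripkeModel V P} (h : M'.IsSubmodel M) {φ : CTL P}
    (hφ : φ.PosExistential) : ∀ w ∈ M'.W, M'.Sat φ w → M.Sat φ w := by
  have hpath : ∀ w π, π ∈ M'.paths w → π ∈ M.paths w := fun w π hπ =>
    ⟨hπ.1, fun i => h.R_subset (hπ.2 i)⟩
  induction hφ with
  | top => intro w _ _; trivial
  | bot => intro w _ hw; exact hw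
  | prop p => intro w hw hp; simpa only [Sat, ← h.η_eq w hw] using hp
  | or _ _ ih₁ ih₂ => intro w hw hs; exact hs.imp (ih₁ w hw) (ih₂ w hw)
  | and _ _ ih₁ ih₂ => intro w hw hs; exact ⟨ih₁ w hw hs.1, ih₂ w hw hs.2⟩
  | EX _ ih =>
    rintro w hw ⟨π, hπ, hs⟩
    exact ⟨π, hpath w π hπ, ih _ (mem_W_of_mem_paths hw hπ 1) hs⟩
  | EU _ _ ih₁ ih₂ =>
    rintro w hw ⟨π, hπ, k, hs, hs'⟩
    exact ⟨π, hpath w π hπ, k, ih₂ _ (mem_W_of_mem_paths hw hπ k) hs,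
      fun i hi => ih₁ _ (mem_W_of_mem_paths hw hπ i) (hs' i hi)⟩
  | ER _ _ ih₁ ih₂ =>
    rintro w hw ⟨π, hπ, hs⟩
    refine ⟨π, hpath w π hπ, fun k => (hs k).imp (ih₂ _ (mem_W_of_mem_paths hw hπ k)) ?_⟩
    rintro ⟨i, hi, hs⟩
    exact ⟨i, hi, ih₁ _ (mem_W_of_mem_paths hw hπ i) hs⟩

theorem IsSubmodel.models {M M' : KripkeModel V P} (h : M'.IsSubmodel M) {φ : CTL P}
    (hφ : φ.PosExistential) (hs : M'.Models φ) : M.Models φ := by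
  have := h.sat hφ _ M'.r_mem hs
  rwa [h.r_eq] at this

theorem IsDeletion.isSubmodel {M N N' : KripkeModel V P} {D D' : Set V × Set (V × V)}
    (h : M.IsDeletion D N) (h' : M.IsDeletion D' N') (h1 : D.1 ⊆ D'.1) (h2 : D.2 ⊆ D'.2) :
    N'.IsSubmodel N where
  W_subset := by rw [h.W_eq, h'.W_eq]; exact Set.sdiff_subset_sdiff_right h1
  R_subset := by rw [h.R_eq, h'.R_eq]; exact Set.sdiff_subset_sdiff_right h2
  η_eq w hw := by
    rw [h'.η_eq w hw, h.η_eq w]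
    rw [h.W_eq]
    rw [h'.W_eq] at hw
    exact Set.sdiff_subset_sdiff_right h1 hw
  r_eq := by rw [h.r_eq, h'.r_eq]

/-- Any further deletion gives a submodel of `N`, from which `φ` is inherited by `N`; conversely `D'
= D` is a witness. -/
theorem extendable_iff {M N : KripkeModel V P} {φ : CTL P} {D : Set V × Set (V × V)}
    (hφ : φ.PosExistential) (h : M.IsDeletion D N) : M.Extendable φ D ↔ N.Models φ := by
  constructor
  · rintro ⟨D', h1, h2, N', hN', hs⟩
    exact (h.isSubmodel hN' h1 h2).models hφ hs
  · exact fun hs => ⟨D, subset_rfl, subset_rfl, N, h, hs⟩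

theorem sat_EX_iff {M : KripkeModel V P} {φ : CTL P} {w : V} :
    M.Sat (.EX φ) w ↔ ∃ v, (w, v) ∈ M.R ∧ M.Sat φ v := by
  constructor
  · rintro ⟨π, hπ, hs⟩
    refine ⟨π 1, ?_, hs⟩
    have := hπ.2 0
    rwa [hπ.1] at this
  · rintro ⟨v, hv, hs⟩
    obtain ⟨π, hπ⟩ := exists_path (M.R_subset hv).2
    refine ⟨_, consPath_mem hv hπ, ?_⟩
    change M.Sat φ (π 0)
    rwa [hπ.1]

/-- The operator whose least fixed point is `EU`. -/
def untilOp (M : KripkeModel V P) (φ ψ : CTL P) (Z : Set V) : Set V :=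
  {w | w ∈ M.W ∧ (M.Sat ψ w ∨ M.Sat φ w ∧ ∃ v, (w, v) ∈ M.R ∧ v ∈ Z)}

/-- The operator whose greatest fixed point is `ER`. -/
def releaseOp (M : KripkeModel V P) (φ ψ : CTL P) (Z : Set V) : Set V :=
  {w | w ∈ M.W ∧ M.Sat ψ w ∧ (M.Sat φ w ∨ ∃ v, (w, v) ∈ M.R ∧ v ∈ Z)}

theorem untilOp_mono (M : KripkeModel V P) (φ ψ : CTL P) : Monotone (M.untilOp φ ψ) := by
  rintro Z Z' h w ⟨hw, hs⟩
  exact ⟨hw, hs.imp_right fun ⟨h1, v, hv, hv'⟩ => ⟨h1, v, hv, h hv'⟩⟩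

theorem releaseOp_mono (M : KripkeModel V P) (φ ψ : CTL P) : Monotone (M.releaseOp φ ψ) := by
  rintro Z Z' h w ⟨hw, hs, hs'⟩
  exact ⟨hw, hs, hs'.imp_right fun ⟨v, hv, hv'⟩ => ⟨v, hv, h hv'⟩⟩

/-- Induction on the position where `ψ` is reached puts `w` into the fixed point. Conversely, the
worlds satisfying the formula are closed under the operator: a witness is prolonged backwards by an
edge, and totality supplies a path where `ψ` holds at once. -/
theorem sat_EU_iff {n m : ℕ} (hm : n ≤ m) (M : KripkeModel (Fin n) P) (φ ψ : CTL P) (w : Fin n)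
    (hw : w ∈ M.W) : M.Sat (.EU φ ψ) w ↔ w ∈ (M.untilOp φ ψ)^[m] ∅ := by
  obtain ⟨h1, h2⟩ := iterate_lfp hm (M.untilOp_mono φ ψ)
  constructor
  · rintro ⟨π, hπ, k, hk, hlt⟩
    induction k generalizing w π with
    | zero =>
      rw [← h1]
      exact ⟨hw, .inl (by rw [hπ.1] at hk; exact hk)⟩
    | succ k ih =>
      rw [← h1]
      have h0 := hlt 0 (by omega)
      have hR := hπ.2 0
      rw [hπ.1] at h0 hR
      refine ⟨hw, .inr ⟨h0, π 1, hR, ?_⟩⟩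
      exact ih (π 1) (mem_W_of_mem_paths hw hπ 1) _ (tail_mem hπ) hk
        fun i hi => hlt (i + 1) (by omega)
  · intro h
    refine h2 {w | M.Sat (.EU φ ψ) w} ?_ h
    rintro u ⟨hu, hs | ⟨hs, v, hv, π, hπ, k, hk, hlt⟩⟩
    · obtain ⟨π, hπ⟩ := exists_path hu
      exact ⟨π, hπ, 0, by rwa [hπ.1], by simp⟩
    · refine ⟨_, consPath_mem hv hπ, k + 1, hk, fun i hi => ?_⟩
      cases i with
      | zero => exact hs
      | succ i => exact hlt i (by omega)

theorem sat_ER_iff {n m : ℕ} (hm : n ≤ m) (M : KripkeModel (Fin n) P) (φ ψ : CTL P) (w : Fin n)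
    (hw : w ∈ M.W) : M.Sat (.ER φ ψ) w ↔ w ∈ (M.releaseOp φ ψ)^[m] Set.univ := by
  obtain ⟨h1, h2⟩ := iterate_gfp hm (M.releaseOp_mono φ ψ)
  constructor
  · intro hs
    refine h2 {w | w ∈ M.W ∧ M.Sat (.ER φ ψ) w} ?_ ⟨hw, hs⟩
    rintro u ⟨hu, π, hπ, hs⟩
    have h0 := hs 0
    rw [hπ.1] at h0
    refine ⟨hu, h0.resolve_right (by simp), ?_⟩
    by_cases hφ : M.Sat φ u
    · exact .inl hφ
    · have hR := hπ.2 0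
      rw [hπ.1] at hR
      refine .inr ⟨π 1, hR, mem_W_of_mem_paths hu hπ 1, _, tail_mem hπ, fun k => ?_⟩
      -- As `φ` fails in `u`, a releasing position on the path is not `0`, so it survives the shift
      -- to the tail.
      refine (hs (k + 1)).imp_right ?_
      rintro ⟨i, hi, hs⟩
      cases i with
      | zero => rw [hπ.1] at hs; exact absurd hs hφ
      | succ i => exact ⟨i, by omega, hs⟩
  · intro h
    set Z := (M.releaseOp φ ψ)^[m] Set.univ with hZ
    -- A successor function on all worlds, so that it can be iterated forever. It stays in `Z` as
    -- long as `φ` has not yet occurred; after that, totality alone is enough.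
    have hnext : ∀ u : M.W, ∃ v : M.W, (u.1, v.1) ∈ M.R ∧
        (u.1 ∈ Z → ¬ M.Sat φ u.1 → v.1 ∈ Z) := by
      rintro ⟨u, hu⟩
      by_cases hc : u ∈ Z ∧ ¬ M.Sat φ u
      · obtain ⟨hc1, hc2⟩ := hc
        rw [← h1] at hc1
        obtain ⟨v, hv, hv'⟩ := hc1.2.2.resolve_left hc2
        exact ⟨⟨v, (M.R_subset hv).2⟩, hv, fun _ _ => hv'⟩
      · obtain ⟨v, hv⟩ := M.R_total u hu
        exact ⟨⟨v, (M.R_subset hv).2⟩, hv, fun h1 h2 => absurd ⟨h1, h2⟩ hc⟩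
    choose g hg1 hg2 using hnext
    refine ⟨fun i => (g^[i] ⟨w, hw⟩ : M.W), ⟨rfl, fun i => ?_⟩, fun k => ?_⟩
    · simp only [Function.iterate_succ_apply']
      exact hg1 _
    · have key : ∀ k, (g^[k] ⟨w, hw⟩).1 ∈ Z ∨ ∃ i < k, M.Sat φ (g^[i] ⟨w, hw⟩).1 := by
        intro k
        induction k with
        | zero => exact .inl h
        | succ k ih =>
          rcases ih with ih | ⟨i, hi, ih⟩
          · by_cases hφ : M.Sat φ (g^[k] ⟨w, hw⟩).1
            · exact .inr ⟨k, by omega, hφ⟩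
            · rw [Function.iterate_succ_apply']
              exact .inl (hg2 _ ih hφ)
          · exact .inr ⟨i, by omega, ih⟩
      refine (key k).imp_left fun hk => ?_
      rw [← h1] at hk
      exact hk.2.1

end KripkeModel

/-! ### Positions in encodings -/

/-- The word `w` occurs in `x` at position `a`. -/
def Occ (x w : Word 18) (a : ℕ) : Prop := w <+: x.drop a

theorem Occ.append {x w₁ w₂ : Word 18} {a : ℕ} (h : Occ x (w₁ ++ w₂) a) :
    Occ x w₁ a ∧ Occ x w₂ (a + w₁.length) := by
  obtain ⟨t, ht⟩ := h
  refine ⟨⟨w₂ ++ t, by rw [← ht, List.append_assoc]⟩, ⟨t, ?_⟩⟩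
  rw [← List.drop_drop, ← ht, List.append_assoc, List.drop_left]

theorem Occ.append_right {x w₁ w₂ : Word 18} {a b : ℕ} (h : Occ x (w₁ ++ w₂) a)
    (hb : b = a + w₁.length) : Occ x w₂ b := hb ▸ h.append.2

theorem Occ.getElem? {x w : Word 18} {a i : ℕ} (h : Occ x w a) (hi : i < w.length) :
    x[a + i]? = w[i]? := by
  obtain ⟨t, ht⟩ := h
  rw [← List.getElem?_drop, ← ht, List.getElem?_append_left hi]

theorem Occ.le {x w : Word 18} {a : ℕ} (h : Occ x w a) (hw : w ≠ []) :
    a + w.length ≤ x.length := by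
  have := h.length_le
  rw [List.length_drop] at this
  have := List.length_pos_of_ne_nil hw
  omega

theorem Occ.of_eq {x pre w suf : Word 18} (h : x = pre ++ w ++ suf) : Occ x w pre.length := by
  refine ⟨suf, ?_⟩
  rw [h, List.append_assoc, List.drop_left]

theorem Occ.head {x w : Word 18} {c : Fin 18} {a : ℕ} (h : Occ x (c :: w) a) :
    letterCode x[a]? = c + 1 := by
  have := h.getElem? (i := 0) (by simp)
  simp at this
  rw [this]
  rfl

theorem Occ.letter {x w : Word 18} {a i : ℕ} (h : Occ x w a) (hi : i < w.length) :
    letterCode x[a + i]? = w[i] + 1 := by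
  rw [h.getElem? hi, List.getElem?_eq_getElem hi]
  rfl

theorem letterCode_inj {k : ℕ} {a b : Option (Fin k)} (h : letterCode a = letterCode b) : a = b := by
  cases a <;> cases b <;> simp [letterCode] at h ⊢
  exact Fin.ext h

theorem letterCode_pos {x : Word 18} {i : ℕ} : 0 < letterCode x[i]? ↔ i < x.length := by
  by_cases h : i < x.length
  · simp [h, letterCode]
  · simp [h, letterCode]

theorem getElem?_flatMap_of_length {α β : Type*} {n : ℕ} (g : α → List β)
    (hg : ∀ a, (g a).length = n) (l : List α) (i j : ℕ) (hj : j < n) :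
    (l.flatMap g)[i * n + j]? = l[i]?.bind fun a => (g a)[j]? := by
  induction l generalizing i with
  | nil => simp
  | cons a l ih =>
    cases i with
    | zero => simp [List.getElem?_append_left, hg, hj]
    | succ i =>
      rw [List.flatMap_cons, List.getElem?_append_right (by rw [hg]; nlinarith)]
      rw [hg, show (i + 1) * n + j - n = i * n + j by rw [Nat.succ_mul]; omega, ih]
      simp

/-- The letters of the encoding of a graph with `n` vertices, which starts at position `s`. -/
structure GraphAt (x : Word 18) (n s : ℕ) (A : Set (Fin n)) (B : Set (Fin n × Fin n)) : Prop where
  le : s + (n + 1 + n * n + 1) ≤ x.length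
  world : ∀ i : Fin n, letterCode x[s + i]? = 2 ↔ i ∈ A
  edge : ∀ i j : Fin n, letterCode x[s + n + 1 + i * n + j]? = 2 ↔ (i, j) ∈ B
  ne_sep : ∀ i < n, letterCode x[s + i]? ≠ 3
  sep : letterCode x[s + n]? = 3

open Classical in
theorem Occ.graphAt {x : Word 18} {n s : ℕ} {A : Set (Fin n)} {B : Set (Fin n × Fin n)}
    (h : Occ x (encGraph A B) s) : GraphAt x n s A B := by
  have hne : encGraph A B ≠ [] := by simp [encGraph]
  have hle := h.le hne
  rw [encGraph_length] at hle
  unfold encGraph at h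
  obtain ⟨h1, h4⟩ := h.append
  obtain ⟨h1, h3⟩ := h1.append
  obtain ⟨h1, h2⟩ := h1.append
  simp only [List.length_append, List.length_ofFn, List.length_singleton] at h2 h3 h4
  have hw : ∀ i, ∀ hi : i < n, letterCode x[s + i]? = 2 ↔ (⟨i, hi⟩ : Fin n) ∈ A := by
    intro i hi
    rw [h1.letter (by simpa using hi)]
    simp only [List.getElem_ofFn]
    split_ifs with hA <;> simp [hA]
  refine ⟨hle, fun i => hw i i.2, fun i j => ?_, fun i hi => ?_, h2.head⟩
  · have hlt : (i : ℕ) * n + j < n * n := by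
      have h1 := i.2
      have h2 := j.2
      have : ((i : ℕ) + 1) * n ≤ n * n := Nat.mul_le_mul_right n h1
      rw [Nat.succ_mul] at this
      omega
    rw [show s + n + 1 + i * n + j = s + (n + 1) + (i * n + j) by ring]
    have hlen : ((List.finRange n).flatMap fun i => List.ofFn fun j : Fin n =>
        (if (i, j) ∈ B then 1 else 0 : Fin 18)).length = n * n := by
      simp [List.length_flatMap]
    rw [h3.getElem? (by rw [hlen]; exact hlt),
      getElem?_flatMap_of_length (n := n) _ (by simp) _ _ _ j.2]
    have hi : (List.finRange n)[(i : ℕ)]? = some i := by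
      rw [List.getElem?_eq_getElem (by simp), List.getElem_finRange]
      simp
    simp only [hi, Option.bind_some]
    rw [List.getElem?_eq_getElem (by simp), List.getElem_ofFn]
    by_cases hB : (i, j) ∈ B <;> simp [hB, letterCode]
  · rw [h1.letter (by simpa using hi)]
    simp only [List.getElem_ofFn]
    split_ifs <;> simp

theorem encGraph_inj {n : ℕ} {A A' : Set (Fin n)} {B B' : Set (Fin n × Fin n)}
    (h : encGraph A B = encGraph A' B') : B = B' := by
  have h1 := (Occ.of_eq (x := encGraph A B) (pre := []) (w := encGraph A B) (suf := [])
    (by simp)).graphAt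
  have h2 := (Occ.of_eq (x := encGraph A B) (pre := []) (w := encGraph A' B') (suf := [])
    (by simp [h])).graphAt
  ext ⟨i, j⟩
  rw [← h1.edge, ← h2.edge]

/-! ### Labels -/

/-- The block of the propositions of a world. -/
def labelBlock (ps : List ℕ) : Word 18 := ps.flatMap encProp ++ [2]

/-- Every proposition starts with the letter `4` and contains a single separator, at its end. Hence
two adjacent separators mark the end of a block of labels, even of an empty one when the separator
in front of the block is counted. -/
theorem chain_labels (ps : List ℕ) :
    List.IsChain (fun a b : Fin 18 => ¬ (a = 2 ∧ b = 2)) (2 :: ps.flatMap encProp) := by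
  induction ps with
  | nil => simp
  | cons p ps ih =>
    have key : ∀ bs : List Bool, ∀ c : Fin 18, c ≠ 2 →
        List.IsChain (fun a b : Fin 18 => ¬ (a = 2 ∧ b = 2))
          (c :: (bs.map (fun b => if b then 1 else 0) ++ (2 :: ps.flatMap encProp))) := by
      intro bs
      induction bs with
      | nil => intro c hc; exact List.isChain_cons_cons.2 ⟨by simp [hc], ih⟩
      | cons b bs ih' =>
        intro c hc
        refine List.isChain_cons_cons.2 ⟨by simp [hc], ih' _ ?_⟩
        cases b <;> simp
    simpa [encProp] using key p.bits 4 (by simp)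

theorem getElem_last_labels (ps : List ℕ) (h : (ps.flatMap encProp).length <
    (2 :: ps.flatMap encProp : Word 18).length) :
    (2 :: ps.flatMap encProp : Word 18)[(ps.flatMap encProp).length] = 2 := by
  have hps : ps.flatMap encProp = [] ∨ ∃ u, ps.flatMap encProp = u ++ [2] := by
    rcases List.eq_nil_or_concat ps with rfl | ⟨qs, p, rfl⟩
    · exact .inl rfl
    · refine .inr ⟨qs.flatMap encProp ++ 4 :: p.bits.map (fun b => if b then 1 else 0), ?_⟩
      simp [encProp]
  revert h
  generalize ps.flatMap encProp = w at hps
  intro h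
  rcases hps with rfl | ⟨u, rfl⟩
  · rfl
  · simp [List.getElem_cons]

/-- The final separator is not a bit, so the code is prefix-free. -/
theorem bits_prefix {u u' : List Bool} {v : Word 18}
    (h : (u.map (fun b => if b then 1 else 0) ++ [2] : Word 18) <+:
      u'.map (fun b => if b then 1 else 0) ++ 2 :: v) : u = u' := by
  induction u generalizing u' with
  | nil =>
    cases u' with
    | nil => rfl
    | cons b u' =>
      exfalso
      cases b <;> simp at h
  | cons b u ih =>
    cases u' with
    | nil =>
      exfalso
      cases b <;> simp at h
    | cons b' u' =>
      simp only [List.map_cons, List.cons_append, List.cons_prefix_cons] at h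
      rw [ih h.2]
      congr 1
      cases b <;> cases b' <;> simp_all

theorem encProp_prefix {p p' : ℕ} {v : Word 18} (h : encProp p <+: encProp p' ++ v) : p = p' := by
  simp only [encProp, List.cons_append, List.cons_prefix_cons, true_and, List.append_assoc] at h
  have := bits_prefix h
  refine Nat.digits.injective 2 ?_
  rw [Nat.digits_two_eq_bits, Nat.digits_two_eq_bits, this]

/-- The letter `4` opens each encoded proposition and occurs nowhere else in the block. So any
occurrence of `encProp p` that begins inside the block is aligned with an entry of the list. -/
theorem mem_iff_prefix_drop (ps : List ℕ) (p : ℕ) (v : Word 18) :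
    p ∈ ps ↔ ∃ a < (labelBlock ps).length, encProp p <+: (labelBlock ps ++ v).drop a := by
  induction ps with
  | nil => simp [labelBlock, encProp]
  | cons p' ps ih =>
    have hb : labelBlock (p' :: ps) = encProp p' ++ labelBlock ps := by
      simp [labelBlock]
    rw [List.mem_cons, ih, hb]
    constructor
    · rintro (rfl | ⟨a, ha, h⟩)
      · refine ⟨0, by simp [labelBlock], ?_⟩
        rw [List.drop_zero, List.append_assoc]
        exact List.prefix_append _ _
      · refine ⟨(encProp p').length + a, by rw [List.length_append]; omega, ?_⟩
        rw [List.append_assoc, ← List.drop_drop, List.drop_left]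
        exact h
    · rintro ⟨a, ha, h⟩
      rw [List.append_assoc] at h
      by_cases h0 : a = 0
      · subst h0
        rw [List.drop_zero] at h
        exact .inl (encProp_prefix h)
      by_cases h1 : a < (encProp p').length
      · exfalso
        rw [List.drop_append_of_le_length h1.le] at h
        obtain ⟨a, rfl⟩ := Nat.exists_eq_succ_of_ne_zero h0
        have h2 : ∀ c ∈ (p'.bits.map (fun b => if b then 1 else 0) ++ [2] : Word 18), c ≠ 4 := by
          intro c hc
          simp only [List.mem_append, List.mem_map, List.mem_singleton] at hc
          rcases hc with ⟨b, -, rfl⟩ | rfl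
          · split_ifs <;> simp
          · simp
        simp only [encProp, List.drop_succ_cons, List.length_cons, Nat.succ_lt_succ_iff] at h h1
        rw [List.drop_eq_getElem_cons h1, List.cons_append, List.cons_prefix_cons] at h
        exact h2 _ (List.getElem_mem h1) h.1.symm
      · refine .inr ⟨a - (encProp p').length, by rw [List.length_append] at ha; omega, ?_⟩
        obtain ⟨d, rfl⟩ := Nat.exists_eq_add_of_le (Nat.le_of_not_lt h1)
        rw [← List.drop_drop, List.drop_left] at h
        rwa [Nat.add_sub_cancel_left]

/-- The position of the root in the encoding of a model. -/
def rootStart (F : FinModel) : ℕ := F.n + 1 + F.n * F.n + 1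

/-- The start of the block of labels of the world `i`. -/
def labelStart (F : FinModel) (i : ℕ) : ℕ :=
  rootStart F + ((F.M.r : ℕ) + 1) +
    (((List.finRange F.n).take i).flatMap fun i => labelBlock (F.lab i)).length

theorem labelStart_succ (F : FinModel) (i : Fin F.n) :
    labelStart F (i + 1) = labelStart F i + (labelBlock (F.lab i)).length := by
  have : (List.finRange F.n).take (i + 1) = (List.finRange F.n).take i ++ [i] := by
    rw [List.take_add_one, List.getElem?_eq_getElem (by simp), List.getElem_finRange]
    simp
  simp [labelStart, this, Nat.add_assoc]

/-- The position is the end of a block of labels. -/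
def IsTerm (x : Word 18) (e : ℕ) : Prop :=
  letterCode x[e]? = 3 ∧ ∃ k, k + 1 = e ∧ letterCode x[k]? = 3

/-- What the encoding of a model looks like. -/
structure ModelAt (x : Word 18) (F : FinModel) : Prop where
  graph : GraphAt x F.n 0 F.M.W F.M.R
  root_ne : ∀ i < (F.M.r : ℕ), letterCode x[rootStart F + i]? ≠ 3
  root_sep : letterCode x[rootStart F + F.M.r]? = 3
  le : labelStart F F.n ≤ x.length
  term : ∀ i : Fin F.n, ∀ e, labelStart F i ≤ e → e < labelStart F (i + 1) →
    (IsTerm x e ↔ e + 1 = labelStart F (i + 1))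
  label : ∀ (i : Fin F.n) (p : ℕ), p ∈ F.M.η i ↔
    ∃ a, labelStart F i ≤ a ∧ a < labelStart F (i + 1) ∧ Occ x (encProp p) a

theorem Occ.modelAt {x : Word 18} {F : FinModel} (h : Occ x (encModel F) 0) : ModelAt x F := by
  unfold encModel at h
  have hroot : 0 + (encGraph F.M.W F.M.R).length = rootStart F := by
    rw [encGraph_length, rootStart, Nat.zero_add]
  obtain ⟨h1, h3⟩ := h.append
  obtain ⟨h1, h2⟩ := h1.append
  rw [hroot] at h2
  rw [List.length_append, ← Nat.add_assoc, hroot] at h3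
  have h3' : Occ x ((List.finRange F.n).flatMap fun i => labelBlock (F.lab i))
      (rootStart F + ((F.M.r : ℕ) + 1)) := by
    simpa [labelBlock] using h3
  have hblock : ∀ i : Fin F.n, Occ x (labelBlock (F.lab i)) (labelStart F i) := by
    intro i
    have hsplit : List.finRange F.n = (List.finRange F.n).take i ++
        (i :: (List.finRange F.n).drop (i + 1)) := by
      conv_lhs => rw [← List.take_append_drop i (List.finRange F.n)]
      rw [List.drop_eq_getElem_cons (by simp), List.getElem_finRange]
      simp
    rw [hsplit, List.flatMap_append, List.flatMap_cons] at h3'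
    exact h3'.append.2.append.1
  have hrs : letterCode x[rootStart F + F.M.r]? = 3 := by
    have := h2.append.2
    rw [List.length_replicate] at this
    exact this.head
  -- In front of each block there is a separator: the one behind the root, or the end of the
  -- previous block. This makes the criterion of two adjacent separators uniform.
  have hprev : ∀ i, i ≤ F.n → letterCode x[labelStart F i - 1]? = 3 := by
    intro i hi
    cases i with
    | zero => simpa [labelStart] using hrs
    | succ i =>
      have h1 := (hblock ⟨i, hi⟩)
      have h2 := labelStart_succ F ⟨i, hi⟩
      simp only at h2
      unfold labelBlock at h1
      have h3 := h1.append.2.head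
      rw [h2, labelBlock, List.length_append, List.length_singleton]
      exact h3
  refine ⟨h1.graphAt, fun i hi => ?_, hrs, ?_, fun i e h1 h2 => ?_, fun i p => ?_⟩
  · rw [h2.letter (by simp; omega), List.getElem_append_left (by simpa using hi)]
    simp
  · by_cases hnil : (List.finRange F.n).flatMap (fun i => labelBlock (F.lab i)) = []
    · rw [labelStart, List.take_of_length_le (by simp), hnil]
      have := h2.le (by simp)
      simpa using this
    · have := h3'.le hnil
      rwa [labelStart, List.take_of_length_le (by simp)]
  · have hb := hblock i
    have hs := labelStart_succ F i
    have hp := hprev i i.2.le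
    have hpos : 0 < labelStart F i := by unfold labelStart; omega
    unfold labelBlock at hb hs
    rw [List.length_append, List.length_singleton] at hs
    have hchain := chain_labels (F.lab i)
    set w := (F.lab i).flatMap encProp with hw
    have hletter : ∀ j, ∀ hj : j < w.length + 1, letterCode x[labelStart F i - 1 + j]? =
        ((2 :: w)[j]'(by simpa using hj) : Fin 18) + 1 := by
      intro j hj
      cases j with
      | zero => simpa using hp
      | succ j =>
        have := hb.append.1.letter (i := j) (by omega)
        rw [show labelStart F i - 1 + (j + 1) = labelStart F i + j by omega, this]
        rfl
    obtain ⟨j, rfl⟩ := Nat.exists_eq_add_of_le h1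
    by_cases hj : j < w.length
    · refine iff_of_false ?_ (by omega)
      rintro ⟨e1, k, hk, e2⟩
      rw [List.isChain_iff_getElem] at hchain
      refine hchain j (by simpa using hj) ⟨?_, ?_⟩
      · rw [show k = labelStart F i - 1 + j by omega, hletter j (by omega)] at e2
        exact Fin.ext (by simpa using e2)
      · rw [show labelStart F i + j = labelStart F i - 1 + (j + 1) by omega,
          hletter (j + 1) (by omega)] at e1
        exact Fin.ext (by simpa using e1)
    · have hj' : j = w.length := by omega
      refine iff_of_true ⟨?_, labelStart F i + j - 1, by omega, ?_⟩ (by omega)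
      · rw [hj']
        exact hb.append.2.head
      · rw [show labelStart F i + j - 1 = labelStart F i - 1 + w.length by omega,
          hletter _ (by omega), getElem_last_labels]
        rfl
  · rw [← F.lab_spec]
    obtain ⟨v, hv⟩ := hblock i
    rw [mem_iff_prefix_drop _ _ v, hv, labelStart_succ]
    constructor
    · rintro ⟨a, ha, h⟩
      rw [List.drop_drop] at h
      exact ⟨labelStart F i + a, by omega, by omega, h⟩
    · rintro ⟨a, ha, ha', h⟩
      obtain ⟨d, rfl⟩ := Nat.exists_eq_add_of_le ha
      exact ⟨d, by omega, by rw [List.drop_drop]; exact h⟩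

/-! ### Parsing of instances -/

infixr:35 " ⋏ " => Fm.and
infixr:30 " ⋎ " => Fm.or

/-- Bundled for `simp only`; updates of assignments become conditionals that are decided by
comparing numerals. -/
theorem Fm.sat_simps :
    (∀ (x : Word 18) A ρ u c, (Fm.inp u c).Sat x A ρ ↔ letterCode x[ρ u]? = c) ∧
    (∀ (x : Word 18) A ρ u v,
      (Fm.same u v).Sat x A ρ ↔ letterCode x[ρ u]? = letterCode x[ρ v]?) ∧
    (∀ x A ρ u c, (Fm.cst u c).Sat x A ρ ↔ ρ u = c) ∧
    (∀ x A ρ u c v, (Fm.addc u c v).Sat x A ρ ↔ ρ u + c = ρ v) ∧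
    (∀ x A ρ u v w, (Fm.add u v w).Sat x A ρ ↔ ρ u + ρ v = ρ w) ∧
    (∀ x A ρ u v, (Fm.lt u v).Sat x A ρ ↔ ρ u < ρ v) ∧
    (∀ x A ρ a u v, (Fm.arr a u v).Sat x A ρ ↔ A a (ρ u) (ρ v)) ∧
    (∀ x A ρ φ, (Fm.not φ).Sat x A ρ ↔ ¬ φ.Sat x A ρ) ∧
    (∀ x A ρ φ ψ, (Fm.and φ ψ).Sat x A ρ ↔ φ.Sat x A ρ ∧ ψ.Sat x A ρ) ∧
    (∀ x A ρ φ ψ, (Fm.or φ ψ).Sat x A ρ ↔ φ.Sat x A ρ ∨ ψ.Sat x A ρ) ∧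
    (∀ x A ρ φ ψ, (Fm.imp φ ψ).Sat x A ρ ↔ (φ.Sat x A ρ → ψ.Sat x A ρ)) ∧
    (∀ x A ρ v φ, (Fm.ex v φ).Sat x A ρ ↔ ∃ i ≤ x.length, φ.Sat x A (Function.update ρ v i)) ∧
    (∀ x A ρ v φ, (Fm.all v φ).Sat x A ρ ↔ ∀ i ≤ x.length, φ.Sat x A (Function.update ρ v i)) ∧
    (∀ (ρ : ℕ → ℕ) u i v, Function.update ρ u i v = if v = u then i else ρ v) := by
  simp [Function.update_apply]

/-- `A 1 = {(n, _)}`, where `n` is the number of worlds. -/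
def Cmd.size : Cmd := .asg 1 4 5 (.inp 4 3 ⋏ .all 6 (.imp (.lt 6 4) (.not (.inp 6 3))))

/-- The vector of worlds contains only bits, so the first separator stands at position `n`. Codes
exceed letters by one: the separator `2` has the code `3`. -/
theorem Cmd.eval_size {x : Word 18} {n : ℕ} {W : Set (Fin n)} {R : Set (Fin n × Fin n)}
    (h : GraphAt x n 0 W R) (ρ : ℕ → ℕ) (s : St) (i j : ℕ) :
    (Cmd.size.eval x ρ s).A 1 i j ↔ i = n := by
  rw [Cmd.size, Cmd.eval_asg]
  have h1 := h.ne_sep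
  have h2 := h.sep
  have h3 := h.le
  simp only [Nat.zero_add] at h1 h2 h3
  simp
  constructor
  · rintro ⟨g1, g2⟩
    rcases lt_trichotomy i n with h | h | h
    · exact absurd g1 (h1 i h)
    · exact h
    · exact absurd h2 (g2 n (by omega) h)
  · rintro rfl
    exact ⟨h2, fun k _ hk => h1 k hk⟩

/-- The rows of the adjacency matrix of a graph that starts at the position given by `S`:
`P = {(i, p) | row i starts at p}`. -/
def Cmd.rows (S P : ℕ) : Cmd :=
  .fix P ((.cst 4 0 ⋏ .ex 6 (.ex 7 (.ex 8 (.arr S 6 6 ⋏ .arr 1 7 7 ⋏ .add 6 7 8 ⋏ .addc 8 1 5)))) ⋎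
    .ex 6 (.ex 7 (.ex 8 (.arr 1 8 8 ⋏ .addc 6 1 4 ⋏ .add 7 8 5 ⋏ .arr P 6 7))))

theorem Cmd.eval_rows {x : Word 18} {n q S P : ℕ} {W : Set (Fin n)} {R : Set (Fin n × Fin n)}
    (h : GraphAt x n q W R) (ρ : ℕ → ℕ) {s : St} (hN : ∀ i j, s.A 1 i j ↔ i = n)
    (hS : ∀ i j, s.A S i j ↔ i = q) (hSP : [S, P, 1, 31].Nodup) {i p : ℕ} (hi : i ≤ n)
    (hp : p ≤ x.length) :
    ((Cmd.rows S P).eval x ρ s).A P i p ↔ p = q + n + 1 + i * n := by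
  have hle := h.le
  simp only [List.nodup_cons, List.mem_cons, List.not_mem_nil, or_false, not_or] at hSP
  rw [Cmd.rows, Cmd.eval_fix (fun X i p => (i = 0 ∧ p = q + n + 1) ∨
    ∃ i' ≤ x.length, ∃ p' ≤ x.length, i' + 1 = i ∧ p' + n = p ∧ X i' p')]
  -- The formulas have addition but no multiplication, so `i * n` is built up row by row. After `k`
  -- rounds all rows `i < k` are right, whatever the relation contained before.
  · suffices H : ∀ k i p, i < k → i ≤ n → p ≤ x.length →
        ((fun (X : ℕ → ℕ → Prop) i p => (i = 0 ∧ p = q + n + 1) ∨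
          ∃ i' ≤ x.length, ∃ p' ≤ x.length, i' + 1 = i ∧ p' + n = p ∧ X i' p')^[k] (s.A P) i p ↔
          p = q + n + 1 + i * n) from H _ _ _ (by omega) hi hp
    intro k
    induction k with
    | zero => intro i p h; omega
    | succ k ih =>
      intro i p hik hi hp
      rw [Function.iterate_succ_apply']
      cases i with
      | zero => simp
      | succ i =>
        rw [Nat.succ_mul]
        constructor
        · rintro (⟨h, -⟩ | ⟨i', hi', p', hp', h1, h2, h3⟩)
          · omega
          · obtain rfl : i' = i := by omega
            rw [ih _ _ (by omega) (by omega) hp'] at h3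
            omega
        · intro h
          refine .inr ⟨i, by omega, q + n + 1 + i * n, by omega, rfl, by omega, ?_⟩
          rw [ih _ _ (by omega) (by omega) (by omega)]
  · intro A k i j hA
    have h1 : A 1 = s.A 1 := hA _ (by tauto) (by simp)
    have h2 : A S = s.A S := hA _ (by tauto) (by tauto)
    simp only [Fm.sat_simps, Nat.reduceEqDiff, if_true, if_false, h1, h2, hN, hS]
    refine or_congr (and_congr_right fun _ => ⟨?_, ?_⟩) ?_
    · rintro ⟨_, _, _, _, _, _, hh⟩
      omega
    · intro hh
      exact ⟨q, by omega, n, by omega, q + n, by omega, rfl, rfl, rfl, hh.symm⟩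
    · constructor
      · rintro ⟨i', hi', p', hp', _, _, rfl, hh⟩
        exact ⟨i', hi', p', hp', hh⟩
      · rintro ⟨i', hi', p', hp', hh⟩
        exact ⟨i', hi', p', hp', n, by omega, rfl, hh⟩

/-- The vertices of a graph. -/
def Cmd.worlds (S a : ℕ) : Cmd :=
  .asg a 4 5 (.ex 6 (.ex 7 (.ex 8 (.arr 1 6 6 ⋏ .lt 4 6 ⋏ .arr S 7 7 ⋏ .add 7 4 8 ⋏ .inp 8 2))))

/-- The edges of a graph. -/
def Cmd.edges (P a : ℕ) : Cmd :=
  .asg a 4 5 (.ex 6 (.ex 7 (.ex 8 (.arr 1 6 6 ⋏ .lt 4 6 ⋏ .lt 5 6 ⋏ .arr P 4 7 ⋏ .add 7 5 8 ⋏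
    .inp 8 2))))

/-- The binary relation on natural numbers that represents a set of vertices. -/
def worldRel {n : ℕ} (W : Set (Fin n)) (i _j : ℕ) : Prop := ∃ h : i < n, ⟨i, h⟩ ∈ W

/-- The binary relation on natural numbers that represents a relation on vertices. -/
def edgeRel {n : ℕ} (R : Set (Fin n × Fin n)) (i j : ℕ) : Prop :=
  ∃ (h : i < n) (h' : j < n), (⟨i, h⟩, ⟨j, h'⟩) ∈ R

theorem Cmd.eval_worlds {x : Word 18} {n q S a : ℕ} {W : Set (Fin n)} {R : Set (Fin n × Fin n)}
    (h : GraphAt x n q W R) (ρ : ℕ → ℕ) {s : St} (hN : ∀ i j, s.A 1 i j ↔ i = n)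
    (hS : ∀ i j, s.A S i j ↔ i = q) : ((Cmd.worlds S a).eval x ρ s).A a = worldRel W := by
  have hle := h.le
  funext i j
  rw [Cmd.worlds, Cmd.eval_asg, eq_iff_iff]
  simp only [Fm.sat_simps, Nat.reduceEqDiff, if_true, if_false, hN, hS]
  constructor
  · rintro ⟨_, _, _, _, _, _, rfl, h2, rfl, rfl, h5⟩
    exact ⟨h2, (h.world ⟨i, h2⟩).1 h5⟩
  · rintro ⟨h2, h3⟩
    exact ⟨n, by omega, q, by omega, q + i, by omega, rfl, h2, rfl, rfl, (h.world ⟨i, h2⟩).2 h3⟩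

theorem Cmd.eval_edges {x : Word 18} {n q P a : ℕ} {W : Set (Fin n)} {R : Set (Fin n × Fin n)}
    (h : GraphAt x n q W R) (ρ : ℕ → ℕ) {s : St} (hN : ∀ i j, s.A 1 i j ↔ i = n)
    (hP : ∀ i p, i ≤ n → p ≤ x.length → (s.A P i p ↔ p = q + n + 1 + i * n)) :
    ((Cmd.edges P a).eval x ρ s).A a = edgeRel R := by
  have hle := h.le
  funext i j
  rw [Cmd.edges, Cmd.eval_asg, eq_iff_iff]
  simp only [Fm.sat_simps, Nat.reduceEqDiff, if_true, if_false, hN]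
  constructor
  · rintro ⟨_, _, p, hp, _, _, rfl, h2, h3, h4, rfl, h5⟩
    rw [hP _ _ h2.le hp] at h4
    subst h4
    exact ⟨h2, h3, (h.edge ⟨i, h2⟩ ⟨j, h3⟩).1 h5⟩
  · rintro ⟨h2, h3, h4⟩
    have : i * n + n ≤ n * n := by
      have := Nat.mul_le_mul_right n h2
      rwa [Nat.succ_mul] at this
    exact ⟨n, by omega, q + n + 1 + i * n, by omega, q + n + 1 + i * n + j, by omega, rfl, h2, h3,
      (hP _ _ h2.le (by omega)).2 rfl, rfl, (h.edge ⟨i, h2⟩ ⟨j, h3⟩).2 h4⟩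

/-- `A 27 = {(e, _)}`, where `e` is the position after the unary number of the root. -/
def Cmd.rootEnd : Cmd :=
  .asg 27 4 5 (.inp 4 3 ⋏ .ex 6 (.ex 7 (.ex 8 (.arr 1 6 6 ⋏ .arr 2 6 7 ⋏ .addc 7 1 8 ⋏
    .not (.lt 4 8) ⋏ .all 9 (.imp (.lt 9 4) (.imp (.not (.lt 9 8)) (.not (.inp 9 3))))))))

/-- `A 5 = {(r, _)}`, where `r` is the root. -/
def Cmd.root : Cmd :=
  .asg 5 4 5 (.ex 6 (.ex 7 (.ex 8 (.ex 9 (.arr 1 6 6 ⋏ .arr 2 6 7 ⋏ .addc 7 1 8 ⋏ .arr 27 9 9 ⋏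
    .add 8 4 9)))))

/-- `A 25` is the set of the ends of blocks of labels. -/
def Cmd.terms : Cmd := .asg 25 4 5 (.inp 4 3 ⋏ .ex 6 (.addc 6 1 4 ⋏ .inp 6 3))

/-- `A 6 = {(i, p) | the labels of i start at p}`. -/
def Cmd.labels : Cmd :=
  .fix 6 ((.cst 4 0 ⋏ .ex 6 (.arr 27 6 6 ⋏ .addc 6 1 5)) ⋎
    .ex 6 (.ex 7 (.ex 8 (.addc 6 1 4 ⋏ .arr 6 6 7 ⋏ .addc 8 1 5 ⋏ .not (.lt 8 7) ⋏ .arr 25 8 8 ⋏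
      .all 9 (.imp (.not (.lt 9 7)) (.imp (.lt 9 8) (.not (.arr 25 9 9))))))))

section Model

variable {x : Word 18} {F : FinModel} (h : ModelAt x F) (ρ : ℕ → ℕ) {s : St}

include h

theorem ModelAt.root_lt : rootStart F + F.M.r < x.length := by
  rw [← letterCode_pos, h.root_sep]
  omega

/-- "Row `n`" of the matrix would start at the separator behind it, so the unary number of the root
begins one position later. It consists of ones, and the first separator from there on ends it. -/
theorem Cmd.eval_rootEnd (hN : ∀ i j, s.A 1 i j ↔ i = F.n)
    (hP : ∀ i p, i ≤ F.n → p ≤ x.length → (s.A 2 i p ↔ p = 0 + F.n + 1 + i * F.n)) (i j : ℕ) :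
    (Cmd.rootEnd.eval x ρ s).A 27 i j ↔ i = rootStart F + F.M.r := by
  have hlt := h.root_lt
  have h0 : rootStart F = F.n + 1 + F.n * F.n + 1 := rfl
  rw [Cmd.rootEnd, Cmd.eval_asg]
  simp only [Fm.sat_simps, Nat.reduceEqDiff, not_lt, if_true, if_false, hN]
  constructor
  · rintro ⟨h1, _, _, p, hp, _, _, rfl, h2, rfl, h3, h4⟩
    rw [hP _ _ le_rfl hp] at h2
    have h5 : p + 1 = rootStart F := by omega
    rw [h5] at h3 h4
    rcases lt_trichotomy i (rootStart F + F.M.r) with h6 | h6 | h6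
    · refine absurd h1 ?_
      have := h.root_ne (i - rootStart F) (by omega)
      rwa [Nat.add_sub_cancel' h3] at this
    · exact h6
    · exact absurd h.root_sep (h4 _ (by omega) h6 (by omega))
  · rintro rfl
    refine ⟨h.root_sep, F.n, by omega, F.n + 1 + F.n * F.n, by omega, rootStart F, by omega, rfl, ?_,
      rfl, by omega, fun k _ h1 h2 => ?_⟩
    · rw [hP _ _ le_rfl (by omega), Nat.zero_add]
    · have := h.root_ne (k - rootStart F) (by omega)
      rwa [Nat.add_sub_cancel' h2] at this

theorem Cmd.eval_root (hN : ∀ i j, s.A 1 i j ↔ i = F.n)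
    (hP : ∀ i p, i ≤ F.n → p ≤ x.length → (s.A 2 i p ↔ p = 0 + F.n + 1 + i * F.n))
    (hE : ∀ i j, s.A 27 i j ↔ i = rootStart F + F.M.r) (i j : ℕ) :
    (Cmd.root.eval x ρ s).A 5 i j ↔ i = F.M.r := by
  have hlt := h.root_lt
  have h0 : rootStart F = F.n + 1 + F.n * F.n + 1 := rfl
  rw [Cmd.root, Cmd.eval_asg]
  simp only [Fm.sat_simps, Nat.reduceEqDiff, if_true, if_false, hN, hE]
  constructor
  · rintro ⟨_, _, p, hp, _, _, _, _, rfl, h2, rfl, rfl, h3⟩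
    rw [hP _ _ le_rfl hp] at h2
    omega
  · rintro rfl
    refine ⟨F.n, by omega, F.n + 1 + F.n * F.n, by omega, rootStart F, by omega, _, by omega, rfl, ?_,
      rfl, rfl, rfl⟩
    rw [hP _ _ le_rfl (by omega), Nat.zero_add]

omit h in
theorem Cmd.eval_terms {i : ℕ} (hi : i ≤ x.length) (j : ℕ) :
    (Cmd.terms.eval x ρ s).A 25 i j ↔ IsTerm x i := by
  rw [Cmd.terms, Cmd.eval_asg]
  simp only [Fm.sat_simps, Nat.reduceEqDiff, if_true, if_false, IsTerm]
  refine and_congr_right fun _ => ?_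
  constructor
  · rintro ⟨k, _, h1, h2⟩
    exact ⟨k, h1, h2⟩
  · rintro ⟨k, h1, h2⟩
    exact ⟨k, by omega, h1, h2⟩

theorem ModelAt.labelStart_le {i : ℕ} (hi : i ≤ F.n) : labelStart F i ≤ x.length := by
  refine le_trans ?_ h.le
  induction hi using Nat.decreasingInduction with
  | of_succ k hk ih =>
    have := labelStart_succ F ⟨k, hk⟩
    simp only at this
    omega
  | self => exact le_rfl

/-- The first terminator from the start of a block onwards ends that block, so the starts are found
by recursion on the world. The value for `F.n` is the end of the encoded model. -/
theorem Cmd.eval_labels (hE : ∀ i j, s.A 27 i j ↔ i = rootStart F + F.M.r)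
    (hT : ∀ i j, i ≤ x.length → (s.A 25 i j ↔ IsTerm x i)) {i p : ℕ} (hi : i ≤ F.n)
    (hp : p ≤ x.length) :
    (Cmd.labels.eval x ρ s).A 6 i p ↔ p = labelStart F i := by
  have hlt := h.root_lt
  have hle := h.graph.le
  rw [Cmd.labels, Cmd.eval_fix (fun X i p => (i = 0 ∧ p = labelStart F 0) ∨
    ∃ i' ≤ x.length, ∃ a ≤ x.length, ∃ e ≤ x.length, i' + 1 = i ∧ X i' a ∧ e + 1 = p ∧ a ≤ e ∧
      IsTerm x e ∧ ∀ e' ≤ x.length, a ≤ e' → e' < e → ¬ IsTerm x e')]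
  · suffices H : ∀ k i p, i < k → i ≤ F.n → p ≤ x.length →
        ((fun (X : ℕ → ℕ → Prop) i p => (i = 0 ∧ p = labelStart F 0) ∨
    ∃ i' ≤ x.length, ∃ a ≤ x.length, ∃ e ≤ x.length, i' + 1 = i ∧ X i' a ∧ e + 1 = p ∧ a ≤ e ∧
      IsTerm x e ∧ ∀ e' ≤ x.length, a ≤ e' → e' < e → ¬ IsTerm x e')^[k] (s.A 6) i p ↔
          p = labelStart F i) from H _ _ _ (by omega) hi hp
    intro k
    induction k with
    | zero => intro i p h; omega
    | succ k ih =>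
      intro i p hik hi hp
      rw [Function.iterate_succ_apply']
      cases i with
      | zero => simp
      | succ i =>
        have hs := labelStart_succ F ⟨i, hi⟩
        have ht := h.term ⟨i, hi⟩
        have hl := h.labelStart_le hi
        have hpos : 0 < (labelBlock (F.lab ⟨i, hi⟩)).length := by simp [labelBlock]
        simp only at hs ht
        have ih' : ∀ a ≤ x.length, _ := fun a ha => ih i a (by omega) (by omega) ha
        constructor
        · rintro (⟨h, -⟩ | ⟨i', hi', a, ha, e, he, h1, h2, rfl, h3, h4, h5⟩)
          · omega
          · obtain rfl : i' = i := by omega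
            rw [ih' a ha] at h2
            subst h2
            rcases lt_trichotomy (e + 1) (labelStart F (i' + 1)) with h6 | h6 | h6
            · exact (ht e h3 (by omega)).1 h4
            · exact h6
            · refine absurd ?_ (h5 (labelStart F (i' + 1) - 1) (by omega) (by omega) (by omega))
              exact (ht _ (by omega) (by omega)).2 (by omega)
        · rintro rfl
          refine .inr ⟨i, by omega, labelStart F i, by omega, labelStart F (i + 1) - 1, by omega,
            rfl, (ih' _ (by omega)).2 rfl, by omega, by omega,
            (ht _ (by omega) (by omega)).2 (by omega), fun e' h1 h2 h3 h4 => ?_⟩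
          have := (ht e' h2 (by omega)).1 h4
          omega
  · intro A k i j hA
    have h1 : A 27 = s.A 27 := hA _ (by simp) (by simp)
    have h2 : A 25 = s.A 25 := hA _ (by simp) (by simp)
    have h3 : labelStart F 0 = rootStart F + F.M.r + 1 := by simp [labelStart, Nat.add_assoc]
    simp only [Fm.sat_simps, Nat.reduceEqDiff, not_lt, if_true, if_false, h1, h2, hE]
    refine or_congr (and_congr_right fun _ => ⟨?_, ?_⟩) ?_
    · rintro ⟨_, _, hh⟩
      omega
    · intro hh
      exact ⟨_, hlt.le, rfl, by omega⟩
    · refine exists_congr fun i' => and_congr_right fun _ => exists_congr fun a =>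
        and_congr_right fun _ => exists_congr fun e => and_congr_right fun he => ?_
      rw [hT e _ he]
      refine and_congr_right fun _ => and_congr_right fun _ => and_congr_right fun _ =>
        and_congr_right fun _ => and_congr_right fun _ => forall_congr' fun e' =>
        forall_congr' fun he' => ?_
      rw [hT e' _ he']

end Model

/-! ### Parsing of formulas -/

/-- `A 7` relates the end of a subformula to its start. -/
def Cmd.starts : Cmd :=
  .fix 7 ((.inp 4 4 ⋏ .addc 4 0 5) ⋎ (.inp 4 6 ⋏ .addc 5 1 4) ⋎
    (.inp 4 3 ⋏ .lt 5 4 ⋏ .inp 5 5 ⋏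
      .all 6 (.imp (.lt 5 6) (.imp (.lt 6 4) (.inp 6 1 ⋎ .inp 6 2)))) ⋎
    (.inp 4 9 ⋏ .ex 6 (.addc 6 1 4 ⋏ .arr 7 6 5)) ⋎
    ((.inp 4 7 ⋎ .inp 4 8 ⋎ .inp 4 15 ⋎ .inp 4 17) ⋏
      .ex 6 (.ex 7 (.ex 8 (.addc 6 1 4 ⋏ .arr 7 6 7 ⋏ .addc 8 1 7 ⋏ .arr 7 8 5)))))

/-- `A 26` relates the end of a formula with a binary main connective to the end of its left
operand. -/
def Cmd.lefts : Cmd :=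
  .asg 26 4 5 (.ex 6 (.ex 7 (.addc 6 1 4 ⋏ .arr 7 6 7 ⋏ .addc 5 1 7)))

/-- `A 8` relates the end of a proposition to the worlds where it holds. -/
def Cmd.props : Cmd :=
  .asg 8 4 5 (.inp 4 3 ⋏ .ex 6 (.arr 7 4 6 ⋏ .ex 7 (.ex 8 (.ex 9 (.ex 10 (
    .arr 6 5 8 ⋏ .addc 5 1 10 ⋏ .arr 6 10 9 ⋏ .not (.lt 7 8) ⋏ .lt 7 9 ⋏
    .all 11 (.all 12 (.imp (.add 6 11 12) (.imp (.not (.lt 4 12))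
      (.ex 13 (.add 7 11 13 ⋏ .same 12 13)))))))))))

/-- The operator that is iterated by `Cmd.starts`. -/
def startOp (x : Word 18) (X : ℕ → ℕ → Prop) (p q : ℕ) : Prop :=
  (letterCode x[p]? = 4 ∧ p = q) ∨ (letterCode x[p]? = 6 ∧ q + 1 = p) ∨
  (letterCode x[p]? = 3 ∧ q < p ∧ letterCode x[q]? = 5 ∧
    ∀ i ≤ x.length, q < i → i < p → letterCode x[i]? = 1 ∨ letterCode x[i]? = 2) ∨
  (letterCode x[p]? = 9 ∧ ∃ i ≤ x.length, i + 1 = p ∧ X i q) ∨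
  ((letterCode x[p]? = 7 ∨ letterCode x[p]? = 8 ∨ letterCode x[p]? = 15 ∨ letterCode x[p]? = 17) ∧
    ∃ i ≤ x.length, ∃ j ≤ x.length, ∃ k ≤ x.length, i + 1 = p ∧ X i j ∧ k + 1 = j ∧ X k q)

theorem Cmd.eval_starts {x : Word 18} (ρ : ℕ → ℕ) (s : St) :
    (Cmd.starts.eval x ρ s).A 7 = (startOp x)^[x.length + 1] (s.A 7) := by
  rw [Cmd.starts, Cmd.eval_fix (startOp x)]
  intro A k i j _
  simp only [Fm.sat_simps, Nat.reduceEqDiff, if_true, if_false, startOp, Nat.add_zero]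

theorem encFormula_length_pos (φ : CTL ℕ) : 0 < (encFormula φ).length := by
  cases φ <;> simp [encFormula, encProp]

theorem encFormula_ne_nil (φ : CTL ℕ) : encFormula φ ≠ [] :=
  List.ne_nil_of_length_pos (encFormula_length_pos φ)

section

variable {x : Word 18}

/-- Between the opening letter and the final separator there are only bits. An earlier opening
letter would have `a` in between, and a later one would be a bit. -/
theorem startOp_prop {P a : ℕ} (h : Occ x (encProp P) a) (X : ℕ → ℕ → Prop) {p q : ℕ}
    (hp : p + 1 = a + (encProp P).length) : startOp x X p q ↔ q = a := by
  have hle := h.le (by simp [encProp])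
  have hlen : (encProp P).length = P.bits.length + 2 := by simp [encProp]
  unfold encProp at h
  have h0 := h.head
  rw [← List.cons_append] at h
  have h1 : letterCode x[p]? = 3 :=
    (h.append_right (b := p) (by rw [List.length_cons, List.length_map]; omega)).head
  have h2 : ∀ i, a < i → i < p → letterCode x[i]? = 1 ∨ letterCode x[i]? = 2 := by
    intro i hi hi'
    obtain ⟨j, rfl⟩ := Nat.exists_eq_add_of_lt hi
    have := h.append.1.letter (i := j + 1) (by rw [List.length_cons, List.length_map]; omega)
    rw [← Nat.add_assoc] at this
    rw [this]
    simp only [List.getElem_cons_succ, List.getElem_map]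
    split_ifs <;> simp
  simp only [startOp, h1]
  simp only [Nat.reduceEqDiff, false_and, or_false, false_or, true_and]
  constructor
  · rintro ⟨h3, h4, h5⟩
    rcases lt_trichotomy q a with h6 | h6 | h6
    · have := h5 a (by omega) h6 (by omega)
      rw [h0] at this
      simp at this
    · exact h6
    · have := h2 q h6 h3
      rw [h4] at this
      simp at this
  · rintro rfl
    exact ⟨by omega, h0, fun i _ => h2 i⟩

/-- In reverse Polish notation the end of a subformula determines its start, and the starts of the
operands give that of the whole. As operands are strictly shorter, as many rounds as letters
suffice, from any initial relation. -/
theorem startOp_iterate {φ : CTL ℕ} (hφ : φ.PosExistential) (X : ℕ → ℕ → Prop) :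
    ∀ a k p q, Occ x (encFormula φ) a → (encFormula φ).length ≤ k →
      p + 1 = a + (encFormula φ).length → q ≤ x.length →
      ((startOp x)^[k] X p q ↔ q = a) := by
  have hun : ∀ (φ : CTL ℕ) (c : Fin 18), c = 8 →
      (∀ a k p q, Occ x (encFormula φ) a → (encFormula φ).length ≤ k →
        p + 1 = a + (encFormula φ).length → q ≤ x.length → ((startOp x)^[k] X p q ↔ q = a)) →
      ∀ a k p q, Occ x (encFormula φ ++ [c]) a → (encFormula φ ++ [c]).length ≤ k →
        p + 1 = a + (encFormula φ ++ [c]).length → q ≤ x.length →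
        ((startOp x)^[k] X p q ↔ q = a) := by
    rintro φ _ rfl ih a k p q h hk hp hq
    have hle := h.le (by simp)
    have hpos := encFormula_length_pos φ
    rw [List.length_append, List.length_singleton] at hk hp hle
    obtain ⟨k, rfl⟩ := Nat.exists_eq_add_of_lt (show 0 < k by omega)
    have h1 : letterCode x[p]? = 9 := (h.append_right (by omega)).head
    rw [Function.iterate_succ_apply', startOp, h1]
    simp only [Nat.reduceEqDiff, false_and, or_false, false_or, true_and]
    constructor
    · rintro ⟨i, hi, rfl, h2⟩
      exact (ih a (0 + k) i q h.append.1 (by omega) (by omega) hq).1 h2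
    · rintro rfl
      exact ⟨p - 1, by omega, by omega,
        (ih q (0 + k) (p - 1) q h.append.1 (by omega) (by omega) hq).2 rfl⟩
  have hbin : ∀ (φ ψ : CTL ℕ) (c : Fin 18), c = 6 ∨ c = 7 ∨ c = 14 ∨ c = 16 →
      (∀ a k p q, Occ x (encFormula φ) a → (encFormula φ).length ≤ k →
        p + 1 = a + (encFormula φ).length → q ≤ x.length → ((startOp x)^[k] X p q ↔ q = a)) →
      (∀ a k p q, Occ x (encFormula ψ) a → (encFormula ψ).length ≤ k →
        p + 1 = a + (encFormula ψ).length → q ≤ x.length → ((startOp x)^[k] X p q ↔ q = a)) →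
      ∀ a k p q, Occ x (encFormula φ ++ encFormula ψ ++ [c]) a →
        (encFormula φ ++ encFormula ψ ++ [c]).length ≤ k →
        p + 1 = a + (encFormula φ ++ encFormula ψ ++ [c]).length → q ≤ x.length →
        ((startOp x)^[k] X p q ↔ q = a) := by
    intro φ ψ c hc ih₁ ih₂ a k p q h hk hp hq
    have hle := h.le (by simp)
    have hpos := encFormula_length_pos φ
    have hpos' := encFormula_length_pos ψ
    rw [List.length_append, List.length_append, List.length_singleton] at hk hp hle
    obtain ⟨k, rfl⟩ := Nat.exists_eq_add_of_lt (show 0 < k by omega)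
    have h1 := (h.append_right (b := p) (by rw [List.length_append]; omega)).head
    obtain ⟨h2, h3⟩ := h.append.1.append
    -- The right operand ends just before the connective, and the left one ends just before the
    -- start of the right one.
    have key : (∃ i ≤ x.length, ∃ j ≤ x.length, ∃ l ≤ x.length, i + 1 = p ∧
        (startOp x)^[0 + k] X i j ∧ l + 1 = j ∧ (startOp x)^[0 + k] X l q) ↔ q = a := by
      constructor
      · rintro ⟨i, hi, j, hj, l, hl, rfl, h4, rfl, h5⟩
        have h6 := (ih₂ _ (0 + k) i (l + 1) h3 (by omega) (by omega) hj).1 h4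
        exact (ih₁ a (0 + k) l q h2 (by omega) (by omega) hq).1 h5
      · rintro rfl
        refine ⟨p - 1, by omega, q + (encFormula φ).length, by omega,
          q + (encFormula φ).length - 1, by omega, by omega, ?_, by omega, ?_⟩
        · exact (ih₂ _ (0 + k) _ _ h3 (by omega) (by omega) (by omega)).2 rfl
        · exact (ih₁ q (0 + k) _ q h2 (by omega) (by omega) hq).2 rfl
    rw [Function.iterate_succ_apply', startOp, h1]
    rcases hc with rfl | rfl | rfl | rfl <;> simpa using key
  induction hφ with
  | top =>
    intro a k p q h hk hp hq
    obtain ⟨k, rfl⟩ := Nat.exists_eq_add_of_lt (show 0 < k from hk)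
    obtain rfl : p = a := by simpa [encFormula] using hp
    have h1 : letterCode x[p]? = 4 := h.head
    rw [Function.iterate_succ_apply', startOp, h1]
    simp only [Nat.reduceEqDiff, false_and, or_false, true_and]
    exact eq_comm
  | bot =>
    intro a k p q h hk hp hq
    have hk' : 2 ≤ k := hk
    obtain ⟨k, rfl⟩ := Nat.exists_eq_add_of_lt (show 0 < k by omega)
    obtain rfl : p = a + 1 := by
      have : p + 1 = a + 2 := hp
      omega
    have h1 : letterCode x[a + 1]? = 6 := (Occ.append_right (w₁ := [3]) h rfl).head
    rw [Function.iterate_succ_apply', startOp, h1]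
    simp
  | prop P =>
    intro a k p q h hk hp hq
    have := encFormula_length_pos (.prop P)
    obtain ⟨k, rfl⟩ := Nat.exists_eq_add_of_lt (show 0 < k by omega)
    rw [Function.iterate_succ_apply']
    exact startOp_prop h _ hp
  | or _ _ ih₁ ih₂ => exact hbin _ _ 6 (by simp) ih₁ ih₂
  | and _ _ ih₁ ih₂ => exact hbin _ _ 7 (by simp) ih₁ ih₂
  | EX _ ih => exact hun _ 8 (by simp) ih
  | EU _ _ ih₁ ih₂ => exact hbin _ _ 14 (by simp) ih₁ ih₂
  | ER _ _ ih₁ ih₂ => exact hbin _ _ 16 (by simp) ih₁ ih₂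

/-- The program for parsing. -/
def Cmd.parse : Cmd :=
  .seq (.size) <| .seq (.asg 24 4 5 (.cst 4 0)) <| .seq (.rows 24 2) <|
  .seq (.edges 2 4) <| .seq .rootEnd <| .seq .root <| .seq .terms <| .seq .labels <|
  .seq .starts <| .seq .lefts .props

/-- The information that is extracted from an instance. -/
structure Parsed (x : Word 18) (F : FinModel) (A : Arrays) : Prop where
  le : F.n ≤ x.length
  size : ∀ i j, A 1 i j ↔ i = F.n
  edge : A 4 = edgeRel F.M.R
  root : ∀ i j, A 5 i j ↔ i = F.M.r
  labelEnd : ∀ p ≤ x.length, A 6 F.n p ↔ p = labelStart F F.n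
  left : ∀ (φ ψ : CTL ℕ) (c : Fin 18) (a p l : ℕ), ψ.PosExistential →
    Occ x (encFormula φ ++ encFormula ψ ++ [c]) a →
    p + 1 = a + (encFormula φ ++ encFormula ψ ++ [c]).length →
    (A 26 p l ↔ l + 1 = a + (encFormula φ).length)
  prop : ∀ (P a p : ℕ) (w : Fin F.n), Occ x (encProp P) a → p + 1 = a + (encProp P).length →
    (A 8 p w ↔ P ∈ F.M.η w)

/-- Two occurrences of a word are compared letter by letter; in this form the comparison is
first-order over positions. -/
theorem occ_encProp_iff {P a b p : ℕ} (h : Occ x (encProp P) a)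
    (hp : p + 1 = a + (encProp P).length) :
    Occ x (encProp P) b ↔ ∀ i ≤ x.length, ∀ j ≤ x.length, a + i = j → j ≤ p →
      ∃ k ≤ x.length, b + i = k ∧ letterCode x[j]? = letterCode x[k]? := by
  have hle := h.le (by simp [encProp])
  constructor
  · rintro hb i hi _ hj rfl hjp
    have hle' := hb.le (by simp [encProp])
    refine ⟨b + i, by omega, rfl, ?_⟩
    rw [h.letter (i := i) (by omega), hb.letter (i := i) (by omega)]
  · intro hb
    rw [Occ, List.prefix_iff_getElem?]
    intro i hi
    obtain ⟨_, -, rfl, h2⟩ := hb i (by omega) _ (by omega) rfl (by omega)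
    rw [List.getElem?_drop, ← letterCode_inj h2, h.getElem? hi, List.getElem?_eq_getElem hi]

theorem Cmd.eval_parse {F : FinModel} (h : ModelAt x F) (ρ : ℕ → ℕ) (s : St) :
    Parsed x F (Cmd.parse.eval x ρ s).A := by
  have hle := h.graph.le
  -- `Cmd.eval.eq_2` is the equation for `seq`. Each intermediate state gets a name, and what a
  -- stage computes is carried to later states by `Cmd.eval_frame`.
  simp only [Cmd.parse, Cmd.eval.eq_2]
  set s1 := Cmd.size.eval x ρ s with hs1
  have hN : ∀ i j, s1.A 1 i j ↔ i = F.n := Cmd.eval_size h.graph ρ s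
  set s2 := (Cmd.asg 24 4 5 (.cst 4 0)).eval x ρ s1 with hs2
  have h24 : ∀ i j, s2.A 24 i j ↔ i = 0 := by
    intro i j
    rw [hs2, Cmd.eval_asg]
    simp only [Fm.sat_simps, Nat.reduceEqDiff, if_true, if_false]
  set s3 := (Cmd.rows 24 2).eval x ρ s2 with hs3
  have hP : ∀ i p, i ≤ F.n → p ≤ x.length → (s3.A 2 i p ↔ p = 0 + F.n + 1 + i * F.n) :=
    fun i p hi hp => Cmd.eval_rows h.graph ρ
      (by simpa (disch := decide) only [hs2, Cmd.eval_frame] using hN) h24 (by simp) hi hp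
  set s5 := (Cmd.edges 2 4).eval x ρ s3 with hs5
  have h4 : s5.A 4 = _ := Cmd.eval_edges h.graph ρ
    (by simpa (disch := decide) only [hs2, hs3, Cmd.eval_frame] using hN)
    hP
  set s6 := Cmd.rootEnd.eval x ρ s5 with hs6
  have h27 : ∀ i j, s6.A 27 i j ↔ _ := Cmd.eval_rootEnd h ρ
    (by simpa (disch := decide) only [hs2, hs3, hs5, Cmd.eval_frame] using hN)
    (by simpa (disch := decide) only [hs5, Cmd.eval_frame] using hP)
  set s7 := Cmd.root.eval x ρ s6 with hs7
  have h5 : ∀ i j, s7.A 5 i j ↔ _ := Cmd.eval_root h ρ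
    (by simpa (disch := decide) only [hs2, hs3, hs5, hs6, Cmd.eval_frame] using hN)
    (by simpa (disch := decide) only [hs5, hs6, Cmd.eval_frame] using hP) h27
  set s8 := Cmd.terms.eval x ρ s7 with hs8
  have h25 : ∀ i j, i ≤ x.length → (s8.A 25 i j ↔ IsTerm x i) :=
    fun i j hi => Cmd.eval_terms ρ hi j
  set s9 := Cmd.labels.eval x ρ s8 with hs9
  have h6 : ∀ i p, i ≤ F.n → p ≤ x.length → (s9.A 6 i p ↔ p = labelStart F i) :=
    fun i p => Cmd.eval_labels h ρ
      (by simpa (disch := decide) only [hs7, hs8, Cmd.eval_frame] using h27) h25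
  set s10 := Cmd.starts.eval x ρ s9 with hs10
  have h7 : ∀ φ : CTL ℕ, φ.PosExistential → ∀ a p q, Occ x (encFormula φ) a →
      p + 1 = a + (encFormula φ).length → q ≤ x.length → (s10.A 7 p q ↔ q = a) := by
    intro φ hφ a p q h1 h2 h3
    rw [hs10, Cmd.eval_starts]
    refine startOp_iterate hφ _ a _ p q h1 ?_ h2 h3
    have := h1.le (encFormula_ne_nil φ)
    omega
  set s11 := Cmd.lefts.eval x ρ s10 with hs11
  set s12 := Cmd.props.eval x ρ s11 with hs12
  refine ⟨by omega, ?_, ?_, ?_, ?_, ?_, ?_⟩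
  · simpa (disch := decide) only [hs2, hs3, hs5, hs6, hs7, hs8, hs9, hs10, hs11, hs12,
      Cmd.eval_frame] using hN
  · simpa (disch := decide) only [hs6, hs7, hs8, hs9, hs10, hs11, hs12, Cmd.eval_frame] using h4
  · simpa (disch := decide) only [hs8, hs9, hs10, hs11, hs12, Cmd.eval_frame] using h5
  · intro p hp
    simpa (disch := decide) only [hs10, hs11, hs12, Cmd.eval_frame] using h6 F.n p le_rfl hp
  · intro φ ψ c a p l hψ ho hp
    have hlex := ho.le (by simp)
    have hpos := encFormula_length_pos ψ
    rw [List.length_append, List.length_append, List.length_singleton] at hp hlex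
    have ho' := ho.append.1.append.2
    simp (disch := decide) only [hs12, Cmd.eval_frame]
    rw [hs11, Cmd.lefts, Cmd.eval_asg]
    simp only [Fm.sat_simps, Nat.reduceEqDiff, if_true, if_false]
    constructor
    · rintro ⟨i, hi, j, hj, rfl, h1, rfl⟩
      exact (h7 ψ hψ _ i _ ho' (by omega) hj).1 h1
    · intro h1
      refine ⟨p - 1, by omega, l + 1, by omega, by omega, ?_, rfl⟩
      exact (h7 ψ hψ _ (p - 1) _ ho' (by omega) (by omega)).2 h1
  · intro P a p w ho hp
    have hlex := ho.le (by simp [encProp])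
    have hw := w.2
    have h6' : ∀ i p, i ≤ F.n → p ≤ x.length → (s11.A 6 i p ↔ p = labelStart F i) := by
      simpa (disch := decide) only [hs10, hs11, Cmd.eval_frame] using h6
    have h7' : ∀ q ≤ x.length, (s11.A 7 p q ↔ q = a) := by
      intro q hq
      simpa (disch := decide) only [hs11, Cmd.eval_frame] using h7 (.prop P) (.prop P) a p q ho hp hq
    have hlet : letterCode x[p]? = 3 := by
      have h1 := ho
      unfold encProp at h1 hp
      rw [← List.cons_append] at h1 hp
      rw [List.length_append, List.length_singleton] at hp
      exact (h1.append_right (b := p) (by omega)).head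
    rw [hs12, Cmd.props, Cmd.eval_asg]
    simp only [Fm.sat_simps, Nat.reduceEqDiff, if_true, if_false, not_lt, hlet, true_and]
    rw [h.label]
    constructor
    · rintro ⟨q, hq, g1, b, hb, l, hl, r, hr, w', hw', g2, rfl, g3, g4, g5, g6⟩
      rw [h7' _ hq] at g1
      rw [h6' _ _ hw.le hl] at g2
      rw [h6' _ _ hw hr] at g3
      subst g1 g2 g3
      exact ⟨b, g4, g5, (occ_encProp_iff ho hp).2 g6⟩
    · rintro ⟨b, g4, g5, g6⟩
      have e1 := h.labelStart_le hw.le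
      have e2 : labelStart F (w + 1) ≤ x.length := h.labelStart_le hw
      exact ⟨a, by omega, (h7' _ (by omega)).2 rfl, b, by omega, _, e1, _, e2, w + 1, by omega,
        (h6' _ _ hw.le e1).2 rfl, rfl, (h6' _ _ hw e2).2 rfl, g4, g5, (occ_encProp_iff ho hp).1 g6⟩

end

/-! ### Model checking -/

/-- A false formula. -/
def Fm.fls : Fm := .cst 4 0 ⋏ .not (.cst 4 0)

/-- One round of model checking: the truth values `A 15` of the subformulas are computed from those
of their operands. -/
def Cmd.round : Cmd :=
  .seq (.asg 16 4 5 (.ex 6 (.addc 6 1 4 ⋏ .arr 15 6 5))) <|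
  .seq (.asg 17 4 5 (.ex 6 (.arr 26 4 6 ⋏ .arr 15 6 5))) <|
  .seq (.asg 18 4 5 .fls) <|
  .seq (.fix 18 (.arr 16 4 5 ⋎ (.arr 17 4 5 ⋏ .ex 6 (.arr 14 5 6 ⋏ .arr 18 4 6)))) <|
  .seq (.asg 19 4 5 (.not .fls)) <|
  .seq (.fix 19 (.arr 16 4 5 ⋏ (.arr 17 4 5 ⋎ .ex 6 (.arr 14 5 6 ⋏ .arr 19 4 6)))) <|
  .asg 15 4 5 (.inp 4 4 ⋎ (.inp 4 3 ⋏ .arr 8 4 5) ⋎ (.inp 4 7 ⋏ (.arr 17 4 5 ⋎ .arr 16 4 5)) ⋎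
    (.inp 4 8 ⋏ .arr 17 4 5 ⋏ .arr 16 4 5) ⋎
    (.inp 4 9 ⋏ .ex 6 (.arr 14 5 6 ⋏ .arr 16 4 6)) ⋎ (.inp 4 15 ⋏ .arr 18 4 5) ⋎
    (.inp 4 17 ⋏ .arr 19 4 5))

/-- Model checking of all subformulas in the model with the transitions `A 14`. -/
def Cmd.check : Cmd := .forv 2 .round

section Round

variable (B : ℕ) (C L T Y₁ Y₂ X : ℕ → ℕ → Prop) (p w : ℕ)

/-- The truth of the last operand. -/
def lastArg : Prop := ∃ i ≤ B, i + 1 = p ∧ T i w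

/-- The truth of the left operand. -/
def leftArg : Prop := ∃ i ≤ B, L p i ∧ T i w

/-- The iteration for `EU`. -/
def untilStep : Prop := Y₁ p w ∨ (Y₂ p w ∧ ∃ v ≤ B, C w v ∧ X p v)

/-- The iteration for `ER`. -/
def releaseStep : Prop := Y₁ p w ∧ (Y₂ p w ∨ ∃ v ≤ B, C w v ∧ X p v)

end Round

/-- The effect of `Cmd.round`. -/
def roundOp (x : Word 18) (V C L T : ℕ → ℕ → Prop) (p w : ℕ) : Prop :=
  let Y₁ := lastArg x.length T
  let Y₂ := leftArg x.length L T
  letterCode x[p]? = 4 ∨ (letterCode x[p]? = 3 ∧ V p w) ∨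
  (letterCode x[p]? = 7 ∧ (Y₂ p w ∨ Y₁ p w)) ∨ (letterCode x[p]? = 8 ∧ Y₂ p w ∧ Y₁ p w) ∨
  (letterCode x[p]? = 9 ∧ ∃ v ≤ x.length, C w v ∧ Y₁ p v) ∨
  (letterCode x[p]? = 15 ∧
    (untilStep x.length C Y₁ Y₂)^[x.length + 1] (fun _ _ => False) p w) ∨
  (letterCode x[p]? = 17 ∧
    (releaseStep x.length C Y₁ Y₂)^[x.length + 1] (fun _ _ => True) p w)

theorem Cmd.eval_round (x : Word 18) (ρ : ℕ → ℕ) (s : St) :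
    (Cmd.round.eval x ρ s).A 15 = roundOp x (s.A 8) (s.A 14) (s.A 26) (s.A 15) := by
  simp only [Cmd.round, Cmd.eval.eq_2]
  set s1 := (Cmd.asg 16 4 5 _).eval x ρ s with hs1
  have h16 : s1.A 16 = lastArg x.length (s.A 15) := by
    rw [hs1, Cmd.eval_asg]
    simp only [Fm.sat_simps, Nat.reduceEqDiff, if_true, if_false]
    rfl
  set s2 := (Cmd.asg 17 4 5 _).eval x ρ s1 with hs2
  have h17 : s2.A 17 = leftArg x.length (s.A 26) (s.A 15) := by
    rw [hs2, Cmd.eval_asg]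
    simp only [Fm.sat_simps, Nat.reduceEqDiff, if_true, if_false]
    simp (disch := decide) only [hs1, Cmd.eval_frame]
    rfl
  set s3 := (Cmd.asg 18 4 5 .fls).eval x ρ s2 with hs3
  have h18 : s3.A 18 = fun _ _ => False := by
    rw [hs3, Cmd.eval_asg]
    simp [Fm.fls]
  set s4 := (Cmd.fix 18 _).eval x ρ s3 with hs4
  have h18' : s4.A 18 = (untilStep x.length (s.A 14) (lastArg x.length (s.A 15))
      (leftArg x.length (s.A 26) (s.A 15)))^[x.length + 1] (fun _ _ => False) := by
    rw [hs4, Cmd.eval_fix (untilStep x.length (s.A 14) (lastArg x.length (s.A 15))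
      (leftArg x.length (s.A 26) (s.A 15))), h18]
    intro A k i j hA
    have e1 : A 16 = s1.A 16 := by
      rw [hA _ (by decide) (by decide)]
      simp (disch := decide) only [hs3, hs2, Cmd.eval_frame]
    have e2 : A 17 = s2.A 17 := by
      rw [hA _ (by decide) (by decide)]
      simp (disch := decide) only [hs3, Cmd.eval_frame]
    have e3 : A 14 = s.A 14 := by
      rw [hA _ (by decide) (by decide)]
      simp (disch := decide) only [hs3, hs2, hs1, Cmd.eval_frame]
    simp only [Fm.sat_simps, Nat.reduceEqDiff, if_true, if_false, e1, e2, e3, h16, h17]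
    rfl
  set s5 := (Cmd.asg 19 4 5 (.not .fls)).eval x ρ s4 with hs5
  have h19 : s5.A 19 = fun _ _ => True := by
    rw [hs5, Cmd.eval_asg]
    simp [Fm.fls]
  set s6 := (Cmd.fix 19 _).eval x ρ s5 with hs6
  have h19' : s6.A 19 = (releaseStep x.length (s.A 14) (lastArg x.length (s.A 15))
      (leftArg x.length (s.A 26) (s.A 15)))^[x.length + 1] (fun _ _ => True) := by
    rw [hs6, Cmd.eval_fix (releaseStep x.length (s.A 14) (lastArg x.length (s.A 15))
      (leftArg x.length (s.A 26) (s.A 15))), h19]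
    intro A k i j hA
    have e1 : A 16 = s1.A 16 := by
      rw [hA _ (by decide) (by decide)]
      simp (disch := decide) only [hs5, hs4, hs3, hs2, Cmd.eval_frame]
    have e2 : A 17 = s2.A 17 := by
      rw [hA _ (by decide) (by decide)]
      simp (disch := decide) only [hs5, hs4, hs3, Cmd.eval_frame]
    have e3 : A 14 = s.A 14 := by
      rw [hA _ (by decide) (by decide)]
      simp (disch := decide) only [hs5, hs4, hs3, hs2, hs1, Cmd.eval_frame]
    simp only [Fm.sat_simps, Nat.reduceEqDiff, if_true, if_false, e1, e2, e3, h16, h17]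
    rfl
  have f16 : s6.A 16 = s1.A 16 := by
    simp (disch := decide) only [hs6, hs5, hs4, hs3, hs2, Cmd.eval_frame]
  have f17 : s6.A 17 = s2.A 17 := by
    simp (disch := decide) only [hs6, hs5, hs4, hs3, Cmd.eval_frame]
  have f18 : s6.A 18 = s4.A 18 := by
    simp (disch := decide) only [hs6, hs5, Cmd.eval_frame]
  have f14 : s6.A 14 = s.A 14 := by
    simp (disch := decide) only [hs6, hs5, hs4, hs3, hs2, hs1, Cmd.eval_frame]
  have f8 : s6.A 8 = s.A 8 := by
    simp (disch := decide) only [hs6, hs5, hs4, hs3, hs2, hs1, Cmd.eval_frame]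
  rw [Cmd.eval_asg]
  simp only [Fm.sat_simps, Nat.reduceEqDiff, if_true, if_false, f16, f17, f18, f14, f8, h16, h17,
    h18', h19']
  rfl

theorem Cmd.eval_check_iterate (x : Word 18) (ρ : ℕ → ℕ) (s : St) :
    (Cmd.check.eval x ρ s).A 15 =
      (roundOp x (s.A 8) (s.A 14) (s.A 26))^[x.length + 1] (s.A 15) := by
  refine Cmd.eval_forv_induction
    (fun i s' => s'.A 15 = (roundOp x (s.A 8) (s.A 14) (s.A 26))^[i] (s.A 15)) rfl ?_
  intro i _ s' hs' hfr
  rw [Cmd.eval_round, Function.iterate_succ_apply', ← hs', hfr 8 (by decide), hfr 14 (by decide),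
    hfr 26 (by decide)]

section Iterate

variable {n B : ℕ} {N : KripkeModel (Fin n) ℕ} {φ ψ : CTL ℕ} {Y₁ Y₂ : ℕ → ℕ → Prop} {p : ℕ}

theorem edgeRel_iff {R : Set (Fin n × Fin n)} {u v : Fin n} :
    edgeRel R u v ↔ (u, v) ∈ R := ⟨fun ⟨_, _, h⟩ => h, fun h => ⟨u.2, v.2, h⟩⟩

theorem exists_edge_iff (hn : n ≤ B) {R : Set (Fin n × Fin n)} {u : Fin n} {X : ℕ → Prop} :
    (∃ v ≤ B, edgeRel R u v ∧ X v) ↔ ∃ v : Fin n, (u, v) ∈ R ∧ X v := by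
  constructor
  · rintro ⟨v, _, ⟨h1, h2, h3⟩, h4⟩
    exact ⟨⟨v, h2⟩, h3, h4⟩
  · rintro ⟨v, h1, h2⟩
    exact ⟨v, by omega, edgeRel_iff.2 h1, h2⟩

/-- The operator acts on every position `p` separately, so one iteration serves all subformulas at
once. Only worlds of `N` are controlled, which is enough because edges of `N` do not leave them. -/
theorem untilStep_iterate (hn : n ≤ B) (h₁ : ∀ w ∈ N.W, Y₁ p w ↔ N.Sat ψ w)
    (h₂ : ∀ w ∈ N.W, Y₂ p w ↔ N.Sat φ w) (k : ℕ) :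
    ∀ w ∈ N.W, (untilStep B (edgeRel N.R) Y₁ Y₂)^[k] (fun _ _ => False) p w ↔
      w ∈ (N.untilOp φ ψ)^[k] ∅ := by
  induction k with
  | zero => intro w _; simp
  | succ k ih =>
    intro w hw
    rw [Function.iterate_succ_apply', Function.iterate_succ_apply', untilStep, h₁ w hw, h₂ w hw,
      exists_edge_iff hn, KripkeModel.untilOp]
    simp only [Set.mem_ofPred_eq, hw, true_and]
    refine or_congr_right (and_congr_right fun _ => exists_congr fun v =>
      and_congr_right fun hv => ih v (N.R_subset hv).2)

theorem releaseStep_iterate (hn : n ≤ B) (h₁ : ∀ w ∈ N.W, Y₁ p w ↔ N.Sat ψ w)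
    (h₂ : ∀ w ∈ N.W, Y₂ p w ↔ N.Sat φ w) (k : ℕ) :
    ∀ w ∈ N.W, (releaseStep B (edgeRel N.R) Y₁ Y₂)^[k] (fun _ _ => True) p w ↔
      w ∈ (N.releaseOp φ ψ)^[k] Set.univ := by
  induction k with
  | zero => intro w _; simp
  | succ k ih =>
    intro w hw
    rw [Function.iterate_succ_apply', Function.iterate_succ_apply', releaseStep, h₁ w hw, h₂ w hw,
      exists_edge_iff hn, KripkeModel.releaseOp]
    simp only [Set.mem_ofPred_eq, hw, true_and]
    refine and_congr_right fun _ => or_congr_right (exists_congr fun v =>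
      and_congr_right fun hv => ih v (N.R_subset hv).2)

end Iterate

/-- Each round makes the values right for formulas whose operands were already right. Operands have
shorter encodings, so after `k` rounds all subformulas of length at most `k` are settled, whatever
`T` was. -/
theorem roundOp_iterate {x : Word 18} {F : FinModel} {A : Arrays} (h : Parsed x F A)
    {N : KripkeModel (Fin F.n) ℕ} (hη : ∀ w ∈ N.W, N.η w = F.M.η w) (T : ℕ → ℕ → Prop) {φ : CTL ℕ}
    (hφ : φ.PosExistential) : ∀ a k p, Occ x (encFormula φ) a → (encFormula φ).length ≤ k →
      p + 1 = a + (encFormula φ).length → ∀ w ∈ N.W,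
      ((roundOp x (A 8) (edgeRel N.R) (A 26))^[k] T p w ↔ N.Sat φ w) := by
  have hn := h.le
  have hlast : ∀ (T : ℕ → ℕ → Prop) {p q : ℕ} (w : ℕ), p < x.length → q + 1 = p →
      (lastArg x.length T p w ↔ T q w) := by
    rintro T p q w hp rfl
    constructor
    · rintro ⟨i, -, h1, h2⟩
      obtain rfl : i = q := by omega
      exact h2
    · exact fun h => ⟨q, by omega, rfl, h⟩
  have hbin : ∀ {φ ψ : CTL ℕ} {c : Fin 18}, ψ.PosExistential →
      (∀ a k p, Occ x (encFormula φ) a → (encFormula φ).length ≤ k →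
        p + 1 = a + (encFormula φ).length → ∀ w ∈ N.W,
        ((roundOp x (A 8) (edgeRel N.R) (A 26))^[k] T p w ↔ N.Sat φ w)) →
      (∀ a k p, Occ x (encFormula ψ) a → (encFormula ψ).length ≤ k →
        p + 1 = a + (encFormula ψ).length → ∀ w ∈ N.W,
        ((roundOp x (A 8) (edgeRel N.R) (A 26))^[k] T p w ↔ N.Sat ψ w)) →
      ∀ a k p, Occ x (encFormula φ ++ encFormula ψ ++ [c]) a →
        (encFormula φ ++ encFormula ψ ++ [c]).length ≤ k →
        p + 1 = a + (encFormula φ ++ encFormula ψ ++ [c]).length →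
        letterCode x[p]? = c + 1 ∧ ∃ k', k = k' + 1 ∧
        (∀ w ∈ N.W, lastArg x.length ((roundOp x (A 8) (edgeRel N.R) (A 26))^[k'] T) p w ↔
          N.Sat ψ w) ∧
        (∀ w ∈ N.W, leftArg x.length (A 26) ((roundOp x (A 8) (edgeRel N.R) (A 26))^[k'] T) p w ↔
          N.Sat φ w) := by
    intro φ ψ c hψ ih₁ ih₂ a k p ho hk hp
    have hleft := fun l => h.left φ ψ c a p l hψ ho hp
    have hle := ho.le (by simp)
    have hpos := encFormula_length_pos φ
    have hpos' := encFormula_length_pos ψ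
    rw [List.length_append, List.length_append, List.length_singleton] at hk hp hle
    obtain ⟨h2, h3⟩ := ho.append.1.append
    refine ⟨(ho.append_right (b := p) (by rw [List.length_append]; omega)).head, k - 1, by omega,
      fun w hw => ?_, fun w hw => ?_⟩
    · rw [hlast _ _ (by omega) (show (p - 1) + 1 = p by omega)]
      exact ih₂ _ (k - 1) (p - 1) h3 (by omega) (by omega) w hw
    · rw [← ih₁ _ (k - 1) (a + (encFormula φ).length - 1) h2 (by omega) (by omega) w hw]
      constructor
      · rintro ⟨l, _, h4, h5⟩
        rw [hleft] at h4
        rwa [show a + (encFormula φ).length - 1 = l by omega]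
      · intro h4
        exact ⟨_, by omega, (hleft _).2 (by omega), h4⟩
  induction hφ with
  | top =>
    intro a k p ho hk hp w hw
    obtain ⟨k, rfl⟩ := Nat.exists_eq_add_of_lt (show 0 < k from hk)
    obtain rfl : p = a := by simpa [encFormula] using hp
    have h1 : letterCode x[p]? = 4 := ho.head
    rw [Function.iterate_succ_apply', roundOp, h1]
    simp [KripkeModel.Sat]
  | bot =>
    intro a k p ho hk hp w hw
    have hk' : 2 ≤ k := hk
    obtain ⟨k, rfl⟩ := Nat.exists_eq_add_of_lt (show 0 < k by omega)
    obtain rfl : p = a + 1 := by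
      have : p + 1 = a + 2 := hp
      omega
    -- `roundOp` has no clause for the code `6` of negation, so the position gets the value false;
    -- in this fragment negation occurs only in `⊥`.
    have h1 : letterCode x[a + 1]? = 6 := (Occ.append_right (w₁ := [3]) ho rfl).head
    rw [Function.iterate_succ_apply', roundOp, h1]
    simp [KripkeModel.Sat, CTL.bot]
  | prop P =>
    intro a k p ho hk hp w hw
    have := encFormula_length_pos (.prop P)
    obtain ⟨k, rfl⟩ := Nat.exists_eq_add_of_lt (show 0 < k by omega)
    have h1 : letterCode x[p]? = 3 := by
      simp only [encFormula] at ho hp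
      unfold encProp at ho hp
      rw [← List.cons_append] at ho hp
      rw [List.length_append, List.length_singleton] at hp
      exact (ho.append_right (b := p) (by omega)).head
    rw [Function.iterate_succ_apply', roundOp, h1]
    simp only [Nat.reduceEqDiff, false_and, or_false, false_or, true_and]
    rw [h.prop P a p w ho hp, KripkeModel.Sat, hη w hw]
  | @or φ ψ _ hψ ih₁ ih₂ =>
    intro a k p ho hk hp w hw
    obtain ⟨h1, k, rfl, h2, h3⟩ := hbin (c := 6) hψ ih₁ ih₂ a k p ho hk hp
    rw [Function.iterate_succ_apply', roundOp, h1]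
    simp [h2 w hw, h3 w hw, KripkeModel.Sat]
  | @and φ ψ _ hψ ih₁ ih₂ =>
    intro a k p ho hk hp w hw
    obtain ⟨h1, k, rfl, h2, h3⟩ := hbin (c := 7) hψ ih₁ ih₂ a k p ho hk hp
    rw [Function.iterate_succ_apply', roundOp, h1]
    simp [h2 w hw, h3 w hw, KripkeModel.Sat]
  | @EX φ _ ih =>
    intro a k p ho hk hp w hw
    have ho' : Occ x (encFormula φ ++ [8]) a := ho
    have hle := ho'.le (by simp)
    have hpos := encFormula_length_pos φ
    change (encFormula φ ++ [8]).length ≤ k at hk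
    change p + 1 = a + (encFormula φ ++ [8]).length at hp
    rw [List.length_append, List.length_singleton] at hk hp hle
    obtain ⟨k, rfl⟩ := Nat.exists_eq_add_of_lt (show 0 < k by omega)
    have h1 : letterCode x[p]? = 9 := (ho'.append_right (by omega)).head
    rw [Function.iterate_succ_apply', roundOp, h1, KripkeModel.sat_EX_iff]
    simp only [Nat.reduceEqDiff, false_and, or_false, false_or, true_and]
    rw [exists_edge_iff hn]
    refine exists_congr fun v => and_congr_right fun hv => ?_
    rw [hlast _ _ (by omega) (show (p - 1) + 1 = p by omega)]
    exact ih a _ (p - 1) ho'.append.1 (by omega) (by omega) v (N.R_subset hv).2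
  | @EU φ ψ _ hψ ih₁ ih₂ =>
    intro a k p ho hk hp w hw
    obtain ⟨h1, k, rfl, h2, h3⟩ := hbin (c := 14) hψ ih₁ ih₂ a k p ho hk hp
    rw [Function.iterate_succ_apply', roundOp, h1,
      KripkeModel.sat_EU_iff (m := x.length + 1) (by omega) N φ ψ w hw]
    simpa using untilStep_iterate hn h2 h3 (x.length + 1) w hw
  | @ER φ ψ _ hψ ih₁ ih₂ =>
    intro a k p ho hk hp w hw
    obtain ⟨h1, k, rfl, h2, h3⟩ := hbin (c := 16) hψ ih₁ ih₂ a k p ho hk hp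
    rw [Function.iterate_succ_apply', roundOp, h1,
      KripkeModel.sat_ER_iff (m := x.length + 1) (by omega) N φ ψ w hw]
    simpa using releaseStep_iterate hn h2 h3 (x.length + 1) w hw

theorem Cmd.eval_check {x : Word 18} {F : FinModel} (ρ : ℕ → ℕ) {s : St} (h : Parsed x F s.A)
    {N : KripkeModel (Fin F.n) ℕ} (hη : ∀ w ∈ N.W, N.η w = F.M.η w) (hR : s.A 14 = edgeRel N.R)
    {φ : CTL ℕ} (hφ : φ.PosExistential) {a p : ℕ} (ho : Occ x (encFormula φ) a)
    (hp : p + 1 = a + (encFormula φ).length) {w : Fin F.n} (hw : w ∈ N.W) :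
    (Cmd.check.eval x ρ s).A 15 p w ↔ N.Sat φ w := by
  have hle := ho.le (encFormula_ne_nil φ)
  rw [Cmd.eval_check_iterate, hR]
  exact roundOp_iterate h hη _ hφ a _ p ho (by omega) hp w hw

/-! ### Pruning -/

namespace KripkeModel

variable {V P : Type*}

/-- Every element of `S` has an `E`-successor in `S`. -/
def Serial (E : Set (V × V)) (S : Set V) : Prop := ∀ u ∈ S, ∃ v ∈ S, (u, v) ∈ E

/-- The largest serial set. -/
def alive (E : Set (V × V)) : Set V := {u | ∃ S, Serial E S ∧ u ∈ S}

theorem serial_alive (E : Set (V × V)) : Serial E (alive E) := by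
  rintro u ⟨S, hS, hu⟩
  obtain ⟨v, hv, huv⟩ := hS u hu
  exact ⟨v, ⟨S, hS, hv⟩, huv⟩

open Classical in
/-- The model with the worlds `S` and the transitions of `E` within `S`. -/
noncomputable def restrict (M : KripkeModel V P) (E : Set (V × V)) (S : Set V) (hS : Serial E S)
    (hr : M.r ∈ S) : KripkeModel V P where
  W := S
  R := E ∩ S ×ˢ S
  η w := if w ∈ S then M.η w else ∅
  r := M.r
  r_mem := hr
  R_subset := Set.inter_subset_right
  R_total u hu := by
    obtain ⟨v, hv, huv⟩ := hS u hu
    exact ⟨v, huv, hu, hv⟩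
  η_off v hv := if_neg hv

/-- The restriction of the model to a serial set that contains the root satisfies the formula. -/
def RestrictModels (M : KripkeModel V P) (E : Set (V × V)) (S : Set V) (φ : CTL P) : Prop :=
  ∃ (hS : Serial E S) (hr : M.r ∈ S), (M.restrict E S hS hr).Models φ

/-- The transitions that remain after the deletions. -/
def remaining (M : KripkeModel V P) (D : Set V × Set (V × V)) : Set (V × V) :=
  {e | e ∈ M.R ∧ e ∉ D.2 ∧ e.1 ∉ D.1 ∧ e.2 ∉ D.1}

/-- `N` is a submodel of the restriction of `M` to `E` and `S`, so upward preservation applies. -/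
theorem restrictModels_of_submodel {M N : KripkeModel V P} {E : Set (V × V)} {S : Set V}
    {φ : CTL P} (hφ : φ.PosExistential) (hS : Serial E S) (hN : N.IsSubmodel M) (hW : N.W ⊆ S)
    (hR : N.R ⊆ E) (h : N.Models φ) : M.RestrictModels E S φ := by
  have hr : M.r ∈ S := by rw [← hN.r_eq]; exact hW N.r_mem
  refine ⟨hS, hr, IsSubmodel.models (M := M.restrict E S hS hr) (M' := N)
    ⟨hW, ?_, ?_, hN.r_eq⟩ hφ h⟩
  · exact fun e he => ⟨hR he, hW (N.R_subset he).1, hW (N.R_subset he).2⟩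
  · intro w hw
    rw [hN.η_eq w hw]
    exact (if_pos (hW hw)).symm

theorem subset_alive {N : KripkeModel V P} {E : Set (V × V)} (hR : N.R ⊆ E) :
    N.W ⊆ alive E := by
  refine fun u hu => ⟨N.W, fun u hu => ?_, hu⟩
  obtain ⟨v, hv⟩ := N.R_total u hu
  exact ⟨v, (N.R_subset hv).2, hR hv⟩

/-- What is left after deleting a superset of `D` is total, so all its worlds are alive for the
remaining transitions, and upward preservation passes `φ` on to the largest such model. This also
covers the `D` for which `M - D` is not total. -/
theorem extendable_iff_restrictModels {M : KripkeModel V P} {φ : CTL P}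
    {D : Set V × Set (V × V)} (hφ : φ.PosExistential) :
    M.Extendable φ D ↔ M.RestrictModels (M.remaining D) (alive (M.remaining D)) φ := by
  constructor
  · rintro ⟨D', h1, h2, N, hN, hs⟩
    have hsub : N.IsSubmodel M := ⟨by rw [hN.W_eq]; exact Set.sdiff_subset,
      by rw [hN.R_eq]; exact Set.sdiff_subset, hN.η_eq, hN.r_eq⟩
    have hR : N.R ⊆ M.remaining D := by
      intro e he
      have hW := N.R_subset he
      rw [hN.W_eq] at hW
      rw [hN.R_eq] at he
      exact ⟨he.1, fun h => he.2 (h2 h), fun h => hW.1.2 (h1 h), fun h => hW.2.2 (h1 h)⟩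
    exact restrictModels_of_submodel hφ (serial_alive _) hsub
      (subset_alive hR) hR hs
  · rintro ⟨hS, hr, hs⟩
    set N := M.restrict _ _ hS hr with hN
    have hrem : ∀ u ∈ alive (M.remaining D), u ∈ M.W ∧ u ∉ D.1 := by
      intro u hu
      obtain ⟨v, -, huv⟩ := serial_alive _ u hu
      exact ⟨(M.R_subset huv.1).1, huv.2.2.1⟩
    -- Everything outside the pruned model is deleted. This includes `D`, since alive worlds and
    -- remaining transitions avoid it.
    refine ⟨((alive (M.remaining D))ᶜ, N.Rᶜ), fun u hu h => (hrem u h).2 hu,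
      fun e he h => h.1.2.1 he, N, ⟨?_, ?_, ?_, rfl⟩, hs⟩
    · ext u
      simp only [Set.mem_sdiff, Set.mem_compl_iff, not_not]
      exact ⟨fun h => ⟨(hrem u h).1, h⟩, fun h => h.2⟩
    · ext e
      simp only [Set.mem_sdiff, Set.mem_compl_iff, not_not]
      exact ⟨fun h => ⟨h.1.1, h⟩, fun h => h.2⟩
    · intro w hw
      exact if_pos hw

end KripkeModel

open KripkeModel

/-- `A 12` becomes the set of the worlds that are alive with respect to the transitions `A 11`. -/
def Cmd.prune : Cmd :=
  .seq (.asg 12 4 5 (.not .fls)) (.fix 12 (.ex 6 (.arr 11 4 6 ⋏ .arr 12 6 5)))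

/-- The position is the last one of the input. -/
def Fm.isLast (u v : ℕ) : Fm := .ex v (.addc u 1 v ⋏ .inp v 0 ⋏ .not (.inp u 0))

/-- With transitions `A 11` and worlds `A 13`, the transitions are restricted to the worlds and
stored in `A 14`, and `A 20` is the truth value of the formula in the root. -/
def Cmd.test : Cmd :=
  .seq (.asg 14 4 5 (.arr 11 4 5 ⋏ .arr 13 4 4 ⋏ .arr 13 5 5)) <|
  .seq .check <|
  .asg 20 4 5 (.ex 6 (.arr 5 6 6 ⋏ .arr 13 6 6 ⋏ .ex 7 (.isLast 7 8 ⋏ .arr 15 7 6)))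

theorem Parsed.of_eq {x : Word 18} {F : FinModel} {A A' : Arrays} (h : Parsed x F A)
    (e : ∀ a ∈ [1, 4, 5, 6, 8, 26], A' a = A a) : Parsed x F A' := by
  obtain ⟨g0, g1, g3, g4, g5, g6, g7⟩ := h
  rw [← e _ (by decide)] at g3
  exact ⟨g0, by rwa [e _ (by decide)], g3, by rwa [e _ (by decide)], by rwa [e _ (by decide)],
    by rwa [e _ (by decide)], by rwa [e _ (by decide)]⟩

/-- The parsed data occupy six relations; for a concrete command `decide` checks that it writes none
of them. -/
theorem Parsed.frame {x : Word 18} {F : FinModel} {ρ : ℕ → ℕ} {s : St} (h : Parsed x F s.A)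
    (c : Cmd) (hc : ∀ a ∈ [1, 4, 5, 6, 8, 26], c.writes a = false) :
    Parsed x F (c.eval x ρ s).A :=
  h.of_eq fun a ha => c.eval_frame (hc a ha) ρ s

/-- A binary relation on numbers represents a set of vertices. -/
def Represents {n : ℕ} (X : ℕ → ℕ → Prop) (S : Set (Fin n)) : Prop :=
  ∀ (u : Fin n) (j : ℕ), X u j ↔ u ∈ S

theorem Fm.sat_isLast {x : Word 18} {A : Arrays} {ρ : ℕ → ℕ} {u v : ℕ} (h : u ≠ v) :
    (Fm.isLast u v).Sat x A ρ ↔ ρ u + 1 = x.length := by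
  have h0 : ∀ i, letterCode x[i]? = 0 ↔ ¬ i < x.length := by
    intro i
    rw [← letterCode_pos (x := x)]
    omega
  simp only [Fm.isLast, Fm.sat_simps, if_true, if_neg h, h0]
  constructor
  · rintro ⟨_, h1, rfl, h2, h3⟩
    omega
  · rintro h1
    exact ⟨_, h1.le, rfl, by omega, by omega⟩

section

variable {x : Word 18} {F : FinModel} (ρ : ℕ → ℕ) {s : St}

/-- The largest serial set is the greatest fixed point of the map that sends a set to its
predecessors, and `|x| + 1` rounds exceed the number of worlds. -/
theorem Cmd.eval_prune (hn : F.n ≤ x.length) {E : Set (Fin F.n × Fin F.n)}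
    (hE : s.A 11 = edgeRel E) : Represents ((Cmd.prune.eval x ρ s).A 12) (alive E) := by
  intro u j
  let G : Set (Fin F.n) → Set (Fin F.n) := fun Z => {u | ∃ v, (u, v) ∈ E ∧ v ∈ Z}
  have hG : Monotone G := fun Z Z' h u ⟨v, hv, hv'⟩ => ⟨v, hv, h hv'⟩
  obtain ⟨h1, h2⟩ := iterate_gfp (m := x.length + 1) (by omega) hG
  have halive : G^[x.length + 1] Set.univ = alive E := by
    ext u
    constructor
    · refine fun hu => ⟨_, fun u hu => ?_, hu⟩
      rw [← h1] at hu
      obtain ⟨v, hv, hv'⟩ := hu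
      exact ⟨v, hv', hv⟩
    · refine fun hu => h2 (alive E) (fun u hu => ?_) hu
      obtain ⟨v, hv, hv'⟩ := serial_alive E u hu
      exact ⟨v, hv', hv⟩
  rw [← halive, Cmd.prune, Cmd.eval.eq_2]
  rw [Cmd.eval_fix (fun X i j => ∃ v ≤ x.length, edgeRel E i v ∧ X v j), Cmd.eval_asg]
  · generalize x.length + 1 = k
    induction k generalizing u with
    | zero => simp [Fm.fls]
    | succ k ih =>
      rw [Function.iterate_succ_apply', Function.iterate_succ_apply', exists_edge_iff hn]
      exact exists_congr fun v => and_congr_right fun hv => ih v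
  · intro A k i j hA
    have e1 : A 11 = s.A 11 := by
      rw [hA _ (by decide) (by decide)]
      simp (disch := decide) only [Cmd.eval_frame]
    simp only [Fm.sat_simps, Nat.reduceEqDiff, if_true, if_false, e1, hE]

/-- The formula is the last component of the input, so its truth values are found at the last
position. Seriality of `S` makes the restriction a model, to which model checking applies. -/
theorem Cmd.eval_test (h : Parsed x F s.A) {E : Set (Fin F.n × Fin F.n)} {S : Set (Fin F.n)}
    (hE : s.A 11 = edgeRel E) (hS : Represents (s.A 13) S) (hser : Serial E S) {φ : CTL ℕ}
    (hφ : φ.PosExistential) {a : ℕ} (ho : Occ x (encFormula φ) a)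
    (hlast : x.length = a + (encFormula φ).length) :
    (Cmd.test.eval x ρ s).A 14 = edgeRel (E ∩ S ×ˢ S) ∧
      ∀ i j, (Cmd.test.eval x ρ s).A 20 i j ↔ F.M.RestrictModels E S φ := by
  have hpos := encFormula_length_pos φ
  have hle := h.le
  simp only [Cmd.test, Cmd.eval.eq_2]
  set s1 := (Cmd.asg 14 4 5 _).eval x ρ s with hs1
  have h14 : s1.A 14 = edgeRel (E ∩ S ×ˢ S) := by
    rw [hs1, Cmd.eval_asg]
    funext i j
    simp only [Fm.sat_simps, Nat.reduceEqDiff, if_true, if_false, hE]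
    rw [eq_iff_iff]
    constructor
    · rintro ⟨⟨hi, hj, h1⟩, h2, h3⟩
      exact ⟨hi, hj, h1, (hS ⟨i, hi⟩ i).1 h2, (hS ⟨j, hj⟩ j).1 h3⟩
    · rintro ⟨hi, hj, h1, h2, h3⟩
      exact ⟨⟨hi, hj, h1⟩, (hS ⟨i, hi⟩ i).2 h2, (hS ⟨j, hj⟩ j).2 h3⟩
  have hpar : Parsed x F s1.A := h.frame _ (by decide)
  set s2 := Cmd.check.eval x ρ s1 with hs2
  refine ⟨by simpa (disch := decide) only [hs2, Cmd.eval_frame] using h14, fun i j => ?_⟩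
  have e13 : s2.A 13 = s.A 13 := by simp (disch := decide) only [hs2, hs1, Cmd.eval_frame]
  have e5 : s2.A 5 = s.A 5 := by simp (disch := decide) only [hs2, hs1, Cmd.eval_frame]
  rw [Cmd.eval_asg]
  simp only [Fm.sat_simps, Fm.sat_isLast (show 7 ≠ 8 by decide), Nat.reduceEqDiff, if_true,
    if_false, e13, e5, h.root]
  have hcheck : ∀ hr : F.M.r ∈ S, ∀ p, p + 1 = x.length →
      (s2.A 15 p F.M.r ↔ (F.M.restrict E S hser hr).Models φ) := by
    intro hr p hp
    exact Cmd.eval_check (N := F.M.restrict E S hser hr) ρ hpar (fun w hw => if_pos hw) h14 hφ ho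
      (by omega) hr
  constructor
  · rintro ⟨_, _, rfl, h2, p, _, h3, h4⟩
    have hr := (hS _ _).1 h2
    exact ⟨hser, hr, (hcheck hr p h3).1 h4⟩
  · rintro ⟨_, hr, h4⟩
    have := F.M.r.2
    exact ⟨F.M.r, by omega, rfl, (hS _ _).2 hr, x.length - 1, by omega, by omega,
      (hcheck hr _ (by omega)).2 h4⟩

end

/-! ### The extension problem -/

/-- The program for the extension problem. -/
def Cmd.extend : Cmd :=
  .seq .parse <|
  .seq (.asg 28 4 5 (.ex 6 (.ex 7 (.arr 1 6 6 ⋏ .arr 6 6 7 ⋏ .addc 7 0 4)))) <|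
  .seq (.rows 28 9) <| .seq (.worlds 28 10) <| .seq (.edges 9 29) <|
  .seq (.asg 11 4 5 (.arr 4 4 5 ⋏ .not (.arr 29 4 5) ⋏ .not (.arr 10 4 4) ⋏ .not (.arr 10 5 5))) <|
  .seq .prune <| .seq (.asg 13 4 5 (.arr 12 4 5)) <| .seq .test (.asg 0 4 5 (.arr 20 4 5))

theorem encModel_length (F : FinModel) : (encModel F).length = labelStart F F.n := by
  rw [labelStart, List.take_of_length_le (by simp), encModel, List.length_append,
    List.length_append, encGraph_length, List.length_append, List.length_replicate,
    List.length_singleton]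
  rfl

theorem Cmd.eval_extend {F : FinModel} {φ : CTL ℕ} (hφ : φ.PosExistential)
    (D : Set (Fin F.n) × Set (Fin F.n × Fin F.n)) (ρ : ℕ → ℕ) (s : St) :
    (Cmd.extend.eval (encExtInstance F φ D) ρ s).A 0 0 0 ↔ F.M.Extendable φ D := by
  set x := encExtInstance F φ D with hx
  have hM : ModelAt x F := (Occ.of_eq (x := x) (pre := []) (w := encModel F)
    (suf := encGraph D.1 D.2 ++ encFormula φ) (by simp [hx, encExtInstance])).modelAt
  -- The deletions follow the model, whose end is where an additional block of labels would start.
  have hD : GraphAt x F.n (labelStart F F.n) D.1 D.2 := by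
    rw [← encModel_length]
    exact (Occ.of_eq (suf := encFormula φ) rfl).graphAt
  have hφo : Occ x (encFormula φ) (encModel F ++ encGraph D.1 D.2).length :=
    Occ.of_eq (suf := []) (by simp [hx, encExtInstance])
  have hlast : x.length = (encModel F ++ encGraph D.1 D.2).length + (encFormula φ).length := by
    simp [hx, encExtInstance]
    ring
  have hle := hD.le
  clear_value x
  rw [extendable_iff_restrictModels hφ]
  simp only [Cmd.extend, Cmd.eval.eq_2]
  set s1 := Cmd.parse.eval x ρ s with hs1
  have h1 : Parsed x F s1.A := Cmd.eval_parse hM ρ s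
  set s2 := (Cmd.asg 28 4 5 _).eval x ρ s1 with hs2
  have h28 : ∀ i j, s2.A 28 i j ↔ i = labelStart F F.n := by
    intro i j
    rw [hs2, Cmd.eval_asg]
    simp only [Fm.sat_simps, Nat.reduceEqDiff, if_true, if_false, h1.size]
    constructor
    · rintro ⟨_, _, p, hp, rfl, h3, rfl⟩
      exact (h1.labelEnd p hp).1 h3
    · rintro rfl
      exact ⟨_, h1.le, _, by omega, rfl, (h1.labelEnd _ (by omega)).2 rfl, rfl⟩
  have h2 : Parsed x F s2.A := h1.frame _ (by decide)
  set s3 := (Cmd.rows 28 9).eval x ρ s2 with hs3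
  have h3 : Parsed x F s3.A := h2.frame _ (by decide)
  have h9 : ∀ i p, i ≤ F.n → p ≤ x.length → (s3.A 9 i p ↔ p = labelStart F F.n + F.n + 1 + i * F.n) :=
    fun i p hi hp => Cmd.eval_rows hD ρ h2.size h28 (by simp) hi hp
  set s4 := (Cmd.worlds 28 10).eval x ρ s3 with hs4
  have h4 : Parsed x F s4.A := h3.frame _ (by decide)
  have h10 : s4.A 10 = worldRel D.1 := Cmd.eval_worlds hD ρ h3.size
    (by simpa (disch := decide) only [hs3, Cmd.eval_frame] using h28)
  set s5 := (Cmd.edges 9 29).eval x ρ s4 with hs5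
  have h5 : Parsed x F s5.A := h4.frame _ (by decide)
  have h29 : s5.A 29 = edgeRel D.2 := Cmd.eval_edges hD ρ h4.size
    (by simpa (disch := decide) only [hs4, Cmd.eval_frame] using h9)
  set s6 := (Cmd.asg 11 4 5 _).eval x ρ s5 with hs6
  have h6 : Parsed x F s6.A := h5.frame _ (by decide)
  have h11 : s6.A 11 = edgeRel (F.M.remaining D) := by
    have e10 : s5.A 10 = s4.A 10 := by simp (disch := decide) only [hs5, Cmd.eval_frame]
    rw [hs6, Cmd.eval_asg]
    funext i j
    simp only [Fm.sat_simps, Nat.reduceEqDiff, if_true, if_false, h5.edge, h29, e10, h10,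
      eq_iff_iff]
    constructor
    · rintro ⟨⟨hi, hj, g1⟩, g2, g3, g4⟩
      exact ⟨hi, hj, g1, fun g => g2 ⟨hi, hj, g⟩, fun g => g3 ⟨hi, g⟩, fun g => g4 ⟨hj, g⟩⟩
    · rintro ⟨hi, hj, g1, g2, g3, g4⟩
      exact ⟨⟨hi, hj, g1⟩, fun ⟨_, _, g⟩ => g2 g, fun ⟨_, g⟩ => g3 g, fun ⟨_, g⟩ => g4 g⟩
  set s7 := Cmd.prune.eval x ρ s6 with hs7
  have h7 : Parsed x F s7.A := h6.frame _ (by decide)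
  have h12 : Represents (s7.A 12) (alive (F.M.remaining D)) := Cmd.eval_prune ρ h1.le h11
  set s8 := (Cmd.asg 13 4 5 _).eval x ρ s7 with hs8
  have h8 : Parsed x F s8.A := h7.frame _ (by decide)
  have h13 : Represents (s8.A 13) (alive (F.M.remaining D)) := by
    intro u j
    rw [hs8, Cmd.eval_asg]
    simp only [Fm.sat_simps, Nat.reduceEqDiff, if_true, if_false]
    exact h12 u j
  rw [Cmd.eval_asg]
  simp only [Fm.sat_simps, Nat.reduceEqDiff, if_true, if_false]
  exact (Cmd.eval_test ρ h8
    (by simpa (disch := decide) only [hs7, hs8, Cmd.eval_frame] using h11) h13 (serial_alive _) hφ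
    hφo hlast).2 0 0

theorem extendSubmodel_mem_classP :
    ExtendSubmodel {φ : CTL ℕ | φ.PosExistential} ∈ classP 18 := by
  refine mem_classP_of_cmd (c := .extend) (by decide) ?_
  rintro x ⟨F, φ, D, hφ, rfl⟩
  constructor
  · intro h
    exact ⟨F, φ, D, hφ, rfl, (Cmd.eval_extend hφ D _ _).1 h⟩
  -- The word may be decoded differently here. The program is correct for this decoding as well, so
  -- no injectivity of the encoding is needed.
  · rintro ⟨F', φ', D', hφ', hx, h⟩
    rw [hx]
    exact (Cmd.eval_extend hφ' D' _ _).2 h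

/-- The program for the extension problem is reused: if `M - D` is a model, `extendable_iff`
identifies the two questions. -/
theorem deletionModelChecking_mem_classP :
    DeletionModelChecking {φ : CTL ℕ | φ.PosExistential} ∈ classP 18 := by
  refine mem_classP_of_cmd (c := .extend) (by decide) ?_
  rintro x ⟨F, φ, D, hφ, rfl, N, hN⟩
  constructor
  · intro h
    exact ⟨F, φ, D, hφ, rfl, N, hN, (extendable_iff hφ hN).1 ((Cmd.eval_extend hφ D _ _).1 h)⟩
  · rintro ⟨F', φ', D', hφ', hx, N', hN', h⟩
    rw [hx]
    exact (Cmd.eval_extend hφ' D' _ _).2 ((extendable_iff hφ' hN').2 h)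

/-! ### Connected submodels -/

namespace KripkeModel

section

variable {V P : Type*}

/-- The worlds that are alive and reachable from `r` through such worlds. -/
def live (E : Set (V × V)) (r : V) : Set V :=
  {u | r ∈ alive E ∧ Relation.ReflTransGen (fun u v => (u, v) ∈ E ∧ v ∈ alive E) r u}

theorem live_subset_alive (E : Set (V × V)) (r : V) : live E r ⊆ alive E := by
  rintro u ⟨hr, h⟩
  cases h with
  | refl => exact hr
  | tail _ h => exact h.2

theorem live_tail {E : Set (V × V)} {r u v : V} (hu : u ∈ live E r) (h : (u, v) ∈ E)
    (hv : v ∈ alive E) : v ∈ live E r := ⟨hu.1, hu.2.tail ⟨h, hv⟩⟩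

theorem serial_live (E : Set (V × V)) (r : V) : Serial E (live E r) := by
  intro u hu
  obtain ⟨v, hv, huv⟩ := serial_alive E u (live_subset_alive E r hu)
  exact ⟨v, live_tail hu huv hv, huv⟩

/-- The transition relations of the connected submodels that satisfy the formula. -/
def solutions (M : KripkeModel V P) (φ : CTL P) : Set (Set (V × V)) :=
  {R | ∃ N : KripkeModel V P, N.IsConnectedSubmodel M ∧ N.Models φ ∧ N.R = R}

/-- The transitions of the largest connected submodel with transitions from `E`. -/
def best (M : KripkeModel V P) (E : Set (V × V)) : Set (V × V) :=
  E ∩ live E M.r ×ˢ live E M.r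

/-- Live worlds are reached from the root through live worlds, so the restriction to them is
connected. -/
theorem best_mem_solutions {M : KripkeModel V P} {E : Set (V × V)} {φ : CTL P} (hE : E ⊆ M.R)
    (h : M.RestrictModels E (live E M.r) φ) : M.best E ∈ M.solutions φ := by
  obtain ⟨hS, hr, hs⟩ := h
  set N := M.restrict E (live E M.r) hS hr with hN
  refine ⟨N, ⟨⟨fun u hu => ?_, fun e he => hE he.1, fun w hw => if_pos hw, rfl⟩, ?_⟩, hs, rfl⟩
  · obtain ⟨v, _, huv⟩ := serial_live E M.r u hu
    exact (M.R_subset (hE huv)).1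
  · rintro w ⟨hr, hw⟩
    have key : Relation.ReflTransGen (fun u v => (u, v) ∈ N.R) M.r w ∧ w ∈ live E M.r := by
      induction hw with
      | refl => exact ⟨.refl, hr, .refl⟩
      | tail _ h ih =>
        have := live_tail ih.2 h.1 h.2
        exact ⟨ih.1.tail ⟨h.1, ih.2, this⟩, this⟩
    have hwW : w ∈ N.W := key.2
    change ∃ π ∈ N.paths M.r, ∃ i, π i = w
    -- A finite walk to `w` is continued forever behind `w` by totality, and its edges are prepended
    -- one by one.
    refine Relation.ReflTransGen.head_induction_on key.1 ?_ ?_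
    · obtain ⟨π, hπ⟩ := exists_path hwW
      exact ⟨π, hπ, 0, hπ.1⟩
    · rintro u v huv _ ⟨π, hπ, i, hi⟩
      exact ⟨_, consPath_mem huv hπ, i + 1, hi⟩

/-- The worlds of a solution inside `E` are alive because the solution is total, and live because
its own paths lead to them. So it is a submodel of the largest candidate, which inherits `φ`. -/
theorem subset_best {M : KripkeModel V P} {E R : Set (V × V)} {φ : CTL P}
    (hφ : φ.PosExistential) (hR : R ∈ M.solutions φ) (hE : R ⊆ E) :
    R ⊆ M.best E ∧ M.RestrictModels E (live E M.r) φ := by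
  obtain ⟨N, hN, hs, rfl⟩ := hR
  have hW : N.W ⊆ live E M.r := by
    intro w hw
    obtain ⟨π, hπ, i, rfl⟩ := hN.connected w hw
    have hal : ∀ i, π i ∈ alive E := fun i =>
      subset_alive hE (mem_W_of_mem_paths N.r_mem hπ i)
    rw [hN.r_eq] at hπ
    clear hw
    induction i with
    | zero =>
      have := hal 0
      rw [hπ.1] at this ⊢
      exact ⟨this, .refl⟩
    | succ i ih => exact live_tail ih (hE (hπ.2 i)) (hal (i + 1))
  exact ⟨fun e he => ⟨hE he, hW (N.R_subset he).1, hW (N.R_subset he).2⟩,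
    restrictModels_of_submodel hφ (serial_live _ _) hN.toIsSubmodel hW hE hs⟩

theorem solutions_subset {M : KripkeModel V P} {R : Set (V × V)} {φ : CTL P}
    (hR : R ∈ M.solutions φ) : R ⊆ M.R := by
  obtain ⟨N, hN, -, rfl⟩ := hR
  exact hN.R_subset

/-- The domain of a relation. -/
def dom (R : Set (V × V)) : Set V := {u | ∃ v, (u, v) ∈ R}

/-- Totality lets the enumeration work with transition relations alone; the worlds are recovered for
the output. -/
theorem W_eq_dom (N : KripkeModel V P) : N.W = dom N.R := by
  ext u
  exact ⟨N.R_total u, fun ⟨v, hv⟩ => (N.R_subset hv).1⟩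

end

/-! ### The order of the enumeration -/

section Order

variable {n : ℕ} {P : Type*}

/-- Relations are compared lexicographically. -/
def key (R : Set (Fin n × Fin n)) : Lex (Fin n ×ₗ Fin n → Prop) := toLex fun e => ofLex e ∈ R

theorem key_injective : Function.Injective (key (n := n)) := by
  intro R R' h
  ext e
  exact iff_of_eq (congrFun (congrArg ofLex h) (toLex e))

/-- Since false is below true, larger sets have larger keys. Hence largest submodels come first in a
decreasing enumeration. -/
theorem key_mono {R R' : Set (Fin n × Fin n)} (h : R ⊆ R') : key R ≤ key R' :=
  Pi.toLex_monotone fun _ he => h he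

theorem key_lt_iff {R R' : Set (Fin n × Fin n)} : key R < key R' ↔
    ∃ e : Fin n × Fin n, (∀ e', toLex e' < toLex e → (e' ∈ R ↔ e' ∈ R')) ∧ e ∉ R ∧ e ∈ R' := by
  constructor
  · rintro ⟨e, h1, h2⟩
    refine ⟨ofLex e, fun e' he' => iff_of_eq (h1 (toLex e') he'), ?_⟩
    have h3 : ¬ (ofLex e ∈ R' → ofLex e ∈ R) := fun h => not_le_of_gt h2 h
    tauto
  · rintro ⟨e, h1, h2, h3⟩
    refine ⟨toLex e, fun e' he' => propext (h1 (ofLex e') he'), ?_⟩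
    exact lt_of_le_not_ge (fun h => absurd h h2) (fun h => h2 (h h3))

/-- The transitions that are allowed for a smaller relation whose first difference to `R` is `e`. -/
def candidates (M : KripkeModel (Fin n) P) (R : Set (Fin n × Fin n)) (e : Fin n × Fin n) :
    Set (Fin n × Fin n) :=
  {e' | (e' ∈ M.R ∧ toLex e < toLex e') ∨ (e' ∈ R ∧ toLex e' < toLex e)}

/-- There is a solution that is smaller than `R` and whose first difference to `R` is `e`. -/
def Branches (M : KripkeModel (Fin n) P) (φ : CTL P) (R : Set (Fin n × Fin n))
    (e : Fin n × Fin n) : Prop :=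
  e ∈ R ∧ M.RestrictModels (M.candidates R e) (live (M.candidates R e) M.r) φ ∧
    ∀ e' ∈ R, toLex e' < toLex e → e' ∈ M.best (M.candidates R e)

variable {M : KripkeModel (Fin n) P} {φ : CTL P} {R : Set (Fin n × Fin n)} {e : Fin n × Fin n}

theorem Branches.mem_solutions (h : M.Branches φ R e) (hR : R ∈ M.solutions φ) :
    M.best (M.candidates R e) ∈ M.solutions φ := by
  refine best_mem_solutions ?_ h.2.1
  rintro e' (he' | he')
  · exact he'.1
  · exact solutions_subset hR he'.1

theorem Branches.agree (h : M.Branches φ R e) (e' : Fin n × Fin n) (he' : toLex e' < toLex e) :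
    e' ∈ M.best (M.candidates R e) ↔ e' ∈ R := by
  refine ⟨fun h1 => ?_, fun h1 => h.2.2 e' h1 he'⟩
  rcases h1.1 with h2 | h2
  · exact absurd h2.2 he'.not_gt
  · exact h2.1

theorem not_mem_best_candidates : e ∉ M.best (M.candidates R e) := by
  rintro ⟨h | h, -⟩
  · exact lt_irrefl _ h.2
  · exact lt_irrefl _ h.2

/-- Such an `R'` uses only candidate transitions, so the best relation contains it, and with it all
of `R` before `e`. -/
theorem branches_of_solution (hφ : φ.PosExistential) {R' : Set (Fin n × Fin n)}
    (hR' : R' ∈ M.solutions φ) (h : ∀ e', toLex e' < toLex e → (e' ∈ R' ↔ e' ∈ R)) (h1 : e ∉ R')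
    (h2 : e ∈ R) : M.Branches φ R e ∧ R' ⊆ M.best (M.candidates R e) := by
  have hsub : R' ⊆ M.candidates R e := by
    intro e' he'
    rcases lt_trichotomy (toLex e') (toLex e) with h3 | h3 | h3
    · exact .inr ⟨(h e' h3).1 he', h3⟩
    · rw [toLex.injective h3] at he'
      exact absurd he' h1
    · exact .inl ⟨solutions_subset hR' he', h3⟩
  obtain ⟨h3, h4⟩ := subset_best hφ hR' hsub
  exact ⟨⟨h2, h4, fun e' he' hlt => h3 ((h e' hlt).2 he')⟩, h3⟩

theorem next_none (hφ : φ.PosExistential) (h : ∀ e, ¬ M.Branches φ R e)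
    {R' : Set (Fin n × Fin n)} (hR' : R' ∈ M.solutions φ) : ¬ key R' < key R := by
  rw [key_lt_iff]
  rintro ⟨e, h1, h2, h3⟩
  exact h e (branches_of_solution hφ hR' h1 h2 h3).1

/-- Among relations smaller than `R`, a later first difference means a larger key, and for equal
first difference the best relation is the largest. So the last branching pair yields the immediate
predecessor of `R` among the solutions. -/
theorem next_some (hφ : φ.PosExistential) (he : M.Branches φ R e)
    (h : ∀ e', M.Branches φ R e' → toLex e' ≤ toLex e) {R' : Set (Fin n × Fin n)}
    (hR' : R' ∈ M.solutions φ) :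
    key R' < key R ↔ key R' ≤ key (M.best (M.candidates R e)) := by
  constructor
  · intro hlt
    obtain ⟨e', h1, h2, h3⟩ := key_lt_iff.1 hlt
    obtain ⟨h4, h5⟩ := branches_of_solution hφ hR' h1 h2 h3
    -- If `e'` precedes `e`, the best relation still agrees with `R` at `e'` and before, so `R'`
    -- falls below it there. If `e' = e`, then `R'` is contained in it.
    rcases (h e' h4).lt_or_eq with h6 | h6
    · refine le_of_lt (key_lt_iff.2 ⟨e', fun e'' h7 => ?_, h2, (he.agree e' h6).2 h3⟩)
      rw [h1 e'' h7, he.agree e'' (h7.trans h6)]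
    · rw [toLex.injective h6] at h5
      exact key_mono h5
  · refine fun hle => hle.trans_lt (key_lt_iff.2 ⟨e, fun e' h7 => he.agree e' h7, ?_, he.1⟩)
    exact not_mem_best_candidates

end Order

end KripkeModel

open Classical in
-- The state alone determines whether anything is pending, which word is printed next, and the
-- following state. So the pending set can be read off from the run, whichever invariant describes
-- it.
theorem EnumInvariant.unique {x : Word 18} {p d : Cmd} {J J' : Finset (Word 18) → St → Prop}
    (h : EnumInvariant x p d J) (h' : EnumInvariant x p d J') {Y Y' : Finset (Word 18)} {s : St}
    (hY : J Y s) (hY' : J' Y' s) : Y = Y' := by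
  induction hN : Y.card generalizing Y Y' s with
  | zero =>
    obtain rfl := Finset.card_eq_zero.1 hN
    have := (h.flag _ _ hY).symm.trans (h'.flag _ _ hY')
    rw [← Finset.not_nonempty_iff_eq_empty.1 (fun hn => by simpa using this.2 hn)]
  | succ N ih =>
    have hne : Y.Nonempty := Finset.card_pos.1 (by omega)
    have hne' : Y'.Nonempty := (h'.flag _ _ hY').1 ((h.flag _ _ hY).2 hne)
    have := ih (h.next _ _ hY hne) (h'.next _ _ hY' hne')
      (by rw [Finset.card_erase_of_mem (h.mem _ _ hY hne)]; omega)
    rw [← Finset.insert_erase (h.mem _ _ hY hne), this,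
      Finset.insert_erase (h'.mem _ _ hY' hne')]

/-! ### The enumeration program -/

/-- With transitions `A 11`, the transitions of the largest connected submodel are stored in `A 14`,
and `A 20` becomes the truth value of the formula in its root. -/
def Cmd.largest : Cmd :=
  .seq .prune <| .seq (.asg 13 4 5 .fls) <|
  .seq (.fix 13 (.arr 12 4 4 ⋏ (.arr 5 4 4 ⋎ .ex 6 (.arr 13 6 5 ⋏ .arr 11 6 4)))) .test

/-- The pair `(a, b)` precedes `(c, d)`. -/
def Fm.before (a b c d : ℕ) : Fm := .lt a c ⋎ (.addc a 0 c ⋏ .lt b d)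

/-- The test whether there is a smaller solution that differs from `A 21` first at `(0, 1)`. -/
def Cmd.branch : Cmd :=
  .ifc (.arr 21 0 1) <|
  .seq (.asg 11 4 5 ((.arr 4 4 5 ⋏ .before 0 1 4 5) ⋎ (.arr 21 4 5 ⋏ .before 4 5 0 1))) <|
  .seq .largest <|
  .ifc (.arr 20 0 1 ⋏ .all 6 (.all 7 (.imp (.arr 21 6 7) (.imp (.before 6 7 0 1) (.arr 14 6 7))))) <|
  .seq (.asg 22 4 5 (.arr 14 4 5)) (.asg 23 4 5 (.not .fls))

/-- The step to the next solution. -/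
def Cmd.next : Cmd :=
  .seq (.asg 23 4 5 .fls) <| .seq (.forv 0 (.forv 1 .branch)) <|
  .seq (.asg 21 4 5 (.arr 22 4 5)) (.asg 0 4 5 (.arr 23 4 5))

/-- The search for the first solution. -/
def Cmd.first : Cmd :=
  .seq .parse <| .seq (.asg 11 4 5 (.arr 4 4 5)) <| .seq .largest <|
  .seq (.asg 21 4 5 (.arr 14 4 5)) (.asg 0 4 5 (.arr 20 4 5))

/-- Output of a bit. -/
def Cmd.bit (φ : Fm) : Cmd := .seq (.ifc φ (.print 2)) (.ifc (.not φ) (.print 1))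

/-- Output of the current solution. -/
def Cmd.output : Cmd :=
  .seq (.forv 0 (.ifc (.ex 6 (.arr 1 6 6 ⋏ .lt 0 6)) (.bit (.ex 6 (.arr 21 0 6))))) <|
  .seq (.print 3) <|
  .seq (.forv 0 (.forv 1 (.ifc (.ex 6 (.arr 1 6 6 ⋏ .lt 0 6 ⋏ .lt 1 6)) (.bit (.arr 21 0 1))))) <|
  .print 3

theorem Cmd.eval_ifc_pos {x : Word 18} {φ : Fm} {c : Cmd} {ρ : ℕ → ℕ} {s : St}
    (h : φ.Sat x s.A ρ) : (Cmd.ifc φ c).eval x ρ s = c.eval x ρ s := if_pos h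

theorem Cmd.eval_ifc_neg {x : Word 18} {φ : Fm} {c : Cmd} {ρ : ℕ → ℕ} {s : St}
    (h : ¬ φ.Sat x s.A ρ) : (Cmd.ifc φ c).eval x ρ s = s := if_neg h

section

variable {x : Word 18} {F : FinModel} (ρ : ℕ → ℕ) {s : St}

/-- Live worlds form a least fixed point: an alive world enters if it is the root or a successor of
a world already present. -/
theorem Cmd.eval_largest (h : Parsed x F s.A) {E : Set (Fin F.n × Fin F.n)}
    (hE : s.A 11 = edgeRel E) {φ : CTL ℕ} (hφ : φ.PosExistential) {a : ℕ}
    (ho : Occ x (encFormula φ) a) (hlast : x.length = a + (encFormula φ).length) :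
    (Cmd.largest.eval x ρ s).A 14 = edgeRel (F.M.best E) ∧
      ∀ i j, (Cmd.largest.eval x ρ s).A 20 i j ↔ F.M.RestrictModels E (live E F.M.r) φ := by
  have hn := h.le
  simp only [Cmd.largest, Cmd.eval.eq_2]
  set s1 := Cmd.prune.eval x ρ s with hs1
  have h1 : Parsed x F s1.A := h.frame _ (by decide)
  have h12 : Represents (s1.A 12) (alive E) := Cmd.eval_prune ρ hn hE
  set s2 := (Cmd.asg 13 4 5 .fls).eval x ρ s1 with hs2
  have h2 : Parsed x F s2.A := h1.frame _ (by decide)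
  have h13 : s2.A 13 = fun _ _ => False := by
    rw [hs2, Cmd.eval_asg]
    simp [Fm.fls]
  set s3 := (Cmd.fix 13 _).eval x ρ s2 with hs3
  have h3 : Parsed x F s3.A := h2.frame _ (by decide)
  refine Cmd.eval_test ρ h3 (by simpa (disch := decide) only [hs1, hs2, hs3, Cmd.eval_frame] using hE)
    ?_ (serial_live E F.M.r) hφ ho hlast
  intro u j
  let G : Set (Fin F.n) → Set (Fin F.n) := fun Z =>
    {u | u ∈ alive E ∧ (u = F.M.r ∨ ∃ v, v ∈ Z ∧ (v, u) ∈ E)}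
  have hG : Monotone G := fun Z Z' h u ⟨h1, h2⟩ =>
    ⟨h1, h2.imp_right fun ⟨v, hv, hv'⟩ => ⟨v, h hv, hv'⟩⟩
  obtain ⟨g1, g2⟩ := iterate_lfp (m := x.length + 1) (by omega) hG
  have hlive : G^[x.length + 1] ∅ = live E F.M.r := by
    refine subset_antisymm (g2 _ ?_) ?_
    · rintro u ⟨hu, rfl | ⟨v, hv, huv⟩⟩
      · exact ⟨hu, .refl⟩
      · exact live_tail hv huv hu
    · rintro u ⟨hr, hu⟩
      induction hu with
      | refl => rw [← g1]; exact ⟨hr, .inl rfl⟩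
      | tail _ h ih => rw [← g1]; exact ⟨h.2, .inr ⟨_, ih, h.1⟩⟩
  rw [← hlive, hs3, Cmd.eval_fix (fun X i j => s1.A 12 i i ∧ (i = F.M.r ∨
    ∃ v ≤ x.length, X v j ∧ edgeRel E v i)), h13]
  · generalize x.length + 1 = k
    induction k generalizing u with
    | zero => simp
    | succ k ih =>
      rw [Function.iterate_succ_apply', Function.iterate_succ_apply']
      refine and_congr (h12 u u) (or_congr ⟨Fin.ext, congrArg _⟩ ?_)
      constructor
      · rintro ⟨v, _, h4, h5, h6, h7⟩
        exact ⟨⟨v, h5⟩, (ih _).1 h4, h7⟩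
      · rintro ⟨v, h4, h5⟩
        exact ⟨v, by omega, (ih v).2 h4, edgeRel_iff.2 h5⟩
  · intro A k i j hA
    have e1 : A 12 = s1.A 12 := by
      rw [hA _ (by decide) (by decide)]
      simp (disch := decide) only [hs2, Cmd.eval_frame]
    have e2 : A 11 = s.A 11 := by
      rw [hA _ (by decide) (by decide)]
      simp (disch := decide) only [hs1, hs2, Cmd.eval_frame]
    have e3 : A 5 = s2.A 5 := hA _ (by decide) (by decide)
    simp only [Fm.sat_simps, Nat.reduceEqDiff, if_true, if_false, e1, e2, e3, hE, h2.root]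

theorem toLex_lt_iff {n : ℕ} {e e' : Fin n × Fin n} : toLex e < toLex e' ↔
    (e.1 : ℕ) < e'.1 ∨ ((e.1 : ℕ) = e'.1 ∧ (e.2 : ℕ) < e'.2) := by
  rw [Prod.Lex.toLex_lt_toLex, Fin.lt_def, Fin.lt_def, Fin.ext_iff]

open Classical in
-- The conclusion quantifies over pairs with the given coordinates, because the loop variables may
-- exceed the number of worlds; then there is no such pair and nothing is recorded.
theorem Cmd.eval_branch (h : Parsed x F s.A) {R : Set (Fin F.n × Fin F.n)}
    (hR : s.A 21 = edgeRel R) {φ : CTL ℕ} (hφ : φ.PosExistential) {a : ℕ}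
    (ho : Occ x (encFormula φ) a) (hlast : x.length = a + (encFormula φ).length) :
    (∀ e : Fin F.n × Fin F.n, (e.1 : ℕ) = ρ 0 → (e.2 : ℕ) = ρ 1 → F.M.Branches φ R e →
      (Cmd.branch.eval x ρ s).A 23 0 0 ∧
      (Cmd.branch.eval x ρ s).A 22 = edgeRel (F.M.best (F.M.candidates R e))) ∧
    ((∀ e : Fin F.n × Fin F.n, (e.1 : ℕ) = ρ 0 → (e.2 : ℕ) = ρ 1 → ¬ F.M.Branches φ R e) →
      (Cmd.branch.eval x ρ s).A 23 = s.A 23 ∧ (Cmd.branch.eval x ρ s).A 22 = s.A 22) := by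
  by_cases h0 : (Fm.arr 21 0 1).Sat x s.A ρ
  swap
  · have e0 : Cmd.branch.eval x ρ s = s := by rw [Cmd.branch, Cmd.eval_ifc_neg h0]
    rw [e0]
    refine ⟨fun e h1 h2 h3 => absurd ?_ h0, fun _ => ⟨rfl, rfl⟩⟩
    rw [Fm.sat_arr, hR, ← h1, ← h2, edgeRel_iff]
    exact h3.1
  have h0' := h0
  rw [Fm.sat_arr, hR] at h0'
  obtain ⟨hi, hj, he⟩ := h0'
  obtain ⟨e, e1, e2⟩ : ∃ e : Fin F.n × Fin F.n, (e.1 : ℕ) = ρ 0 ∧ (e.2 : ℕ) = ρ 1 :=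
    ⟨(⟨_, hi⟩, ⟨_, hj⟩), rfl, rfl⟩
  have heR : e ∈ R := by
    convert he
  have huniq : ∀ e' : Fin F.n × Fin F.n, (e'.1 : ℕ) = ρ 0 → (e'.2 : ℕ) = ρ 1 → e' = e :=
    fun e' h1 h2 => Prod.ext (Fin.ext (h1.trans e1.symm)) (Fin.ext (h2.trans e2.symm))
  set s1 := (Cmd.asg 11 4 5 ((.arr 4 4 5 ⋏ .before 0 1 4 5) ⋎
    (.arr 21 4 5 ⋏ .before 4 5 0 1))).eval x ρ s with hs1
  have h1 : Parsed x F s1.A := h.frame _ (by decide)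
  have h11 : s1.A 11 = edgeRel (F.M.candidates R e) := by
    rw [hs1, Cmd.eval_asg]
    funext i j
    simp only [Fm.before, Fm.sat_simps, Nat.reduceEqDiff, if_true, if_false, h.edge, hR,
      OfNat.zero_ne_ofNat, OfNat.one_ne_ofNat, ← e1, ← e2, Nat.add_zero]
    rw [eq_iff_iff]
    constructor
    · rintro (⟨⟨h1, h2, h3⟩, h4⟩ | ⟨⟨h1, h2, h3⟩, h4⟩)
      · exact ⟨h1, h2, .inl ⟨h3, toLex_lt_iff.2 h4⟩⟩
      · exact ⟨h1, h2, .inr ⟨h3, toLex_lt_iff.2 h4⟩⟩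
    · rintro ⟨h1, h2, ⟨h3, h4⟩ | ⟨h3, h4⟩⟩
      · exact .inl ⟨⟨h1, h2, h3⟩, toLex_lt_iff.1 h4⟩
      · exact .inr ⟨⟨h1, h2, h3⟩, toLex_lt_iff.1 h4⟩
  set s2 := Cmd.largest.eval x ρ s1 with hs2
  obtain ⟨h14, h20⟩ := Cmd.eval_largest ρ h1 h11 hφ ho hlast
  rw [← hs2] at h14 h20
  have h21 : s2.A 21 = edgeRel R := by
    simpa (disch := decide) only [hs1, hs2, Cmd.eval_frame] using hR
  have hn := h.le
  have htest : (Fm.arr 20 0 1 ⋏ .all 6 (.all 7 (.imp (.arr 21 6 7) (.imp (.before 6 7 0 1)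
      (.arr 14 6 7))))).Sat x s2.A ρ ↔ F.M.Branches φ R e := by
    simp only [Fm.before, Fm.sat_simps, Nat.reduceEqDiff, if_true, if_false, h14, h20, h21,
      OfNat.zero_ne_ofNat, OfNat.one_ne_ofNat, ← e1, ← e2, Nat.add_zero]
    rw [Branches]
    simp only [heR, true_and]
    refine and_congr_right fun _ => ⟨fun h e' he' hlt => ?_, fun h i _ j _ h3 h4 => ?_⟩
    · exact edgeRel_iff.1 (h e'.1 (by omega) e'.2 (by omega) (edgeRel_iff.2 he')
        (toLex_lt_iff.1 hlt))
    · obtain ⟨hi, hj, h3⟩ := h3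
      exact ⟨hi, hj, h _ h3 (toLex_lt_iff.2 h4)⟩
  have heval : Cmd.branch.eval x ρ s = if F.M.Branches φ R e then
      (Cmd.seq (.asg 22 4 5 (.arr 14 4 5)) (.asg 23 4 5 (.not .fls))).eval x ρ s2 else s2 := by
    rw [Cmd.branch, Cmd.eval_ifc_pos h0, Cmd.eval.eq_2, ← hs1, Cmd.eval.eq_2, ← hs2]
    split_ifs with hb
    · rw [Cmd.eval_ifc_pos (htest.2 hb)]
    · rw [Cmd.eval_ifc_neg (fun h => hb (htest.1 h))]
  rw [heval]
  constructor
  · intro e' g1 g2 hb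
    obtain rfl := huniq e' g1 g2
    rw [if_pos hb, Cmd.eval.eq_2]
    constructor
    · rw [Cmd.eval_asg]
      simp [Fm.fls]
    · simp (disch := decide) only [Cmd.eval_frame]
      rw [Cmd.eval_asg]
      simp only [Fm.sat_simps, Nat.reduceEqDiff, if_true, if_false]
      exact h14
  · intro hno
    rw [if_neg (hno e e1 e2)]
    exact ⟨by simp (disch := decide) only [hs1, hs2, Cmd.eval_frame],
      by simp (disch := decide) only [hs1, hs2, Cmd.eval_frame]⟩

/-- The result of the search among the pairs in `D`. -/
def Scanned (F : FinModel) (φ : CTL ℕ) (R : Set (Fin F.n × Fin F.n)) (D : Fin F.n × Fin F.n → Prop)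
    (A : Arrays) : Prop :=
  (¬ A 23 0 0 ∧ ∀ e, D e → ¬ F.M.Branches φ R e) ∨
  (A 23 0 0 ∧ ∃ e, F.M.Branches φ R e ∧ A 22 = edgeRel (F.M.best (F.M.candidates R e)) ∧
    ∀ e', D e' → F.M.Branches φ R e' → toLex e' ≤ toLex e)

theorem Scanned.congr {φ : CTL ℕ} {R : Set (Fin F.n × Fin F.n)} {D D' : Fin F.n × Fin F.n → Prop}
    {A : Arrays} (h : Scanned F φ R D A) (hD : ∀ e, D' e → D e) : Scanned F φ R D' A := by
  rcases h with ⟨h1, h2⟩ | ⟨h1, e, h2, h3, h4⟩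
  · exact .inl ⟨h1, fun e he => h2 e (hD e he)⟩
  · exact .inr ⟨h1, e, h2, h3, fun e' he' => h4 e' (hD e' he')⟩

/-- The two nested loops visit the pairs in increasing lexicographic order, and every success
overwrites the previous one. What remains in the end belongs to the largest branching pair. -/
theorem Cmd.eval_scan (h : Parsed x F s.A) {R : Set (Fin F.n × Fin F.n)}
    (hR : s.A 21 = edgeRel R) {φ : CTL ℕ} (hφ : φ.PosExistential) {a : ℕ}
    (ho : Occ x (encFormula φ) a) (hlast : x.length = a + (encFormula φ).length)
    (h23 : ¬ s.A 23 0 0) :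
    Scanned F φ R (fun _ => True) ((Cmd.forv 0 (.forv 1 .branch)).eval x ρ s).A := by
  have hn := h.le
  -- The loops run up to `|x|`, and there are at most `|x|` worlds, so no pair is missed.
  refine Scanned.congr (D := fun e => (e.1 : ℕ) < x.length + 1) ?_ (fun e _ => by omega)
  refine Cmd.eval_forv_induction
    (fun i s' => Scanned F φ R (fun e => (e.1 : ℕ) < i) s'.A) (.inl ⟨h23, by simp⟩) ?_
  intro i hi s1 hs1 hfr1
  refine Scanned.congr (D := fun e => (e.1 : ℕ) < i ∨ ((e.1 : ℕ) = i ∧ (e.2 : ℕ) < x.length + 1)) ?_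
    (fun e _ => by omega)
  refine Cmd.eval_forv_induction (fun j s' => Scanned F φ R
    (fun e => (e.1 : ℕ) < i ∨ ((e.1 : ℕ) = i ∧ (e.2 : ℕ) < j)) s'.A)
    (hs1.congr fun e _ => by omega) ?_
  intro j hj s2 hs2 hfr2
  have hR2 : s2.A 21 = edgeRel R := by
    rw [hfr2 _ (by decide), hfr1 _ (by decide), hR]
  have hP2 : Parsed x F s2.A := by
    have e : ∀ a ∈ [1, 4, 5, 6, 8, 26], s2.A a = s.A a := fun a ha => by
      have : Cmd.branch.writes a = false := by
        revert a
        decide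
      rw [hfr2 a this, hfr1 a this]
    exact h.of_eq e
  obtain ⟨g1, g2⟩ := Cmd.eval_branch (Function.update (Function.update ρ 0 i) 1 j) hP2 hR2 hφ ho hlast
  simp only [Function.update_self, ne_eq, zero_ne_one, not_false_eq_true,
    Function.update_of_ne] at g1 g2
  by_cases hb : ∃ e : Fin F.n × Fin F.n, (e.1 : ℕ) = i ∧ (e.2 : ℕ) = j ∧ F.M.Branches φ R e
  · obtain ⟨e, e1, e2, hb⟩ := hb
    obtain ⟨g3, g4⟩ := g1 e e1 e2 hb
    refine .inr ⟨g3, e, hb, g4, fun e' he' _ => ?_⟩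
    rw [← not_lt, toLex_lt_iff]
    omega
  · push Not at hb
    obtain ⟨g3, g4⟩ := g2 hb
    rcases hs2 with ⟨k1, k2⟩ | ⟨k1, e, k2, k3, k4⟩
    · refine .inl ⟨by rwa [g3], fun e he => ?_⟩
      by_cases hD : (e.1 : ℕ) < i ∨ ((e.1 : ℕ) = i ∧ (e.2 : ℕ) < j)
      · exact k2 e hD
      · exact hb e (by omega) (by omega)
    · refine .inr ⟨by rwa [g3], e, k2, by rwa [g4], fun e' he' hbe' => ?_⟩
      by_cases hD : (e'.1 : ℕ) < i ∨ ((e'.1 : ℕ) = i ∧ (e'.2 : ℕ) < j)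
      · exact k4 e' hD hbe'
      · exact absurd hbe' (hb e' (by omega) (by omega))

end

/-! ### Output -/

/-- Loops always have `|x| + 1` rounds; the rounds from `n` on must print nothing. -/
theorem Cmd.eval_forv_print {x : Word 18} {n v : ℕ} {c : Cmd} {ρ : ℕ → ℕ} {s : St}
    (hn : n ≤ x.length) (g : Fin n → Word 18) (hc : ∀ a, c.writes a = false)
    (h : ∀ i ≤ x.length, ∀ s' : St, s'.A = s.A → (c.eval x (Function.update ρ v i) s').buf =
      s'.buf ++ if h : i < n then g ⟨i, h⟩ else []) :
    ((Cmd.forv v c).eval x ρ s).buf = s.buf ++ (List.finRange n).flatMap g := by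
  have key : ((Cmd.forv v c).eval x ρ s).buf =
      s.buf ++ ((List.finRange n).take (x.length + 1)).flatMap g := by
    refine Cmd.eval_forv_induction
      (fun i s' => s'.buf = s.buf ++ ((List.finRange n).take i).flatMap g) (by simp) ?_
    intro i hi s' hs' hfr
    rw [h i hi s' (funext fun a => hfr a (hc a)), hs', List.append_assoc]
    congr 1
    split_ifs with hin
    · rw [List.take_add_one, List.getElem?_eq_getElem (by simpa using hin), List.getElem_finRange]
      simp
    · rw [List.take_of_length_le (by simp; omega), List.take_of_length_le (by simp; omega),
        List.append_nil]
  rw [key, List.take_of_length_le (by simp; omega)]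

open Classical in
theorem Cmd.eval_bit (x : Word 18) (φ : Fm) (ρ : ℕ → ℕ) (s : St) :
    ((Cmd.bit φ).eval x ρ s).buf = s.buf ++ [if φ.Sat x s.A ρ then 1 else 0] := by
  rw [Cmd.bit, Cmd.eval.eq_2]
  by_cases h : φ.Sat x s.A ρ
  · rw [Cmd.eval_ifc_pos h, Cmd.eval_ifc_neg (by rw [Fm.sat_not]; exact not_not.2 h), if_pos h]
    rfl
  · rw [Cmd.eval_ifc_neg h, Cmd.eval_ifc_pos (by rw [Fm.sat_not]; exact h), if_neg h]
    rfl

theorem Cmd.writes_output (a : ℕ) : Cmd.output.writes a = false := rfl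

theorem Cmd.eval_output {x : Word 18} {F : FinModel} {s : St} (h : Parsed x F s.A)
    {R : Set (Fin F.n × Fin F.n)} (hR : s.A 21 = edgeRel R) (ρ : ℕ → ℕ) :
    (Cmd.output.eval x ρ s).buf = s.buf ++ encGraph (dom R) R := by
  classical
  have hn := h.le
  simp only [Cmd.output, Cmd.eval.eq_2]
  set s1 := (Cmd.forv 0 (.ifc (.ex 6 (.arr 1 6 6 ⋏ .lt 0 6)) (.bit (.ex 6 (.arr 21 0 6))))).eval
    x ρ s with hs1
  set s2 := (Cmd.print 3).eval x ρ s1 with hs2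
  have hA : s2.A = s.A := funext fun a => by
    rw [hs2, Cmd.eval_frame _ rfl, hs1, Cmd.eval_frame _ rfl]
  have h1 : s1.buf = s.buf ++ (List.finRange F.n).flatMap fun i => [if i ∈ dom R then 1 else 0] := by
    refine Cmd.eval_forv_print hn _ (fun a => rfl) fun i hi s' hs' => ?_
    have hguard : (Fm.ex 6 (.arr 1 6 6 ⋏ .lt 0 6)).Sat x s'.A (Function.update ρ 0 i) ↔ i < F.n := by
      simp only [Fm.sat_simps, Nat.reduceEqDiff, if_true, if_false, OfNat.zero_ne_ofNat, hs',
        h.size]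
      exact ⟨fun ⟨_, _, h1, h2⟩ => h1 ▸ h2, fun h1 => ⟨_, hn, rfl, h1⟩⟩
    by_cases hin : i < F.n
    · rw [Cmd.eval_ifc_pos (hguard.2 hin), Cmd.eval_bit, dif_pos hin]
      refine congrArg (fun a => s'.buf ++ [a]) (if_congr ?_ rfl rfl)
      simp only [Fm.sat_simps, Nat.reduceEqDiff, if_true, if_false, OfNat.zero_ne_ofNat, hs', hR]
      constructor
      · rintro ⟨j, _, _, hj, h1⟩
        exact ⟨⟨j, hj⟩, h1⟩
      · rintro ⟨j, h1⟩
        exact ⟨j, by omega, hin, j.2, h1⟩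
    · rw [Cmd.eval_ifc_neg (fun h => hin (hguard.1 h)), dif_neg hin, List.append_nil]
  have h2 : s2.buf = s1.buf ++ [2] := rfl
  change ((Cmd.forv 0 _).eval x ρ s2).buf ++ [2] = _
  rw [Cmd.eval_forv_print (n := F.n) hn (fun i => (List.finRange F.n).flatMap fun j =>
    [if (i, j) ∈ R then 1 else 0]) (fun a => rfl) fun i hi s' hs' => ?_, h2, h1]
  · simp only [encGraph, List.ofFn_eq_map, List.append_assoc, List.map_eq_flatMap]
  · rw [Cmd.eval_forv_print (n := F.n) hn (fun j => if hi : i < F.n then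
      [if (⟨i, hi⟩, j) ∈ R then 1 else 0] else []) (fun a => rfl) fun j hj s'' hs'' => ?_]
    · split_ifs <;> simp
    have hguard : (Fm.ex 6 (.arr 1 6 6 ⋏ .lt 0 6 ⋏ .lt 1 6)).Sat x s''.A
        (Function.update (Function.update ρ 0 i) 1 j) ↔ i < F.n ∧ j < F.n := by
      simp only [Fm.sat_simps, Nat.reduceEqDiff, if_true, if_false, OfNat.zero_ne_ofNat,
        OfNat.one_ne_ofNat, zero_ne_one, hs'', hs', hA, h.size]
      exact ⟨fun ⟨_, _, h1, h2⟩ => h1 ▸ h2, fun h1 => ⟨_, hn, rfl, h1⟩⟩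
    by_cases hin : i < F.n ∧ j < F.n
    · rw [Cmd.eval_ifc_pos (hguard.2 hin), Cmd.eval_bit, dif_pos hin.2, dif_pos hin.1]
      refine congrArg (fun a => s''.buf ++ [a]) (if_congr ?_ rfl rfl)
      simp only [Fm.sat_simps, Nat.reduceEqDiff, if_true, if_false, zero_ne_one, hs'', hs', hA, hR]
      exact ⟨fun ⟨_, _, h1⟩ => h1, fun h1 => ⟨hin.1, hin.2, h1⟩⟩
    · rw [Cmd.eval_ifc_neg (fun h => hin (hguard.1 h))]
      by_cases hj : j < F.n
      · rw [dif_pos hj, dif_neg (fun hi => hin ⟨hi, hj⟩), List.append_nil]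
      · rw [dif_neg hj, List.append_nil]

/-! ### Correctness of the enumeration -/

/-- The solutions that are not larger than `R`. -/
def upTo (F : FinModel) (φ : CTL ℕ) (R : Set (Fin F.n × Fin F.n)) : Set (Word 18) :=
  (fun R => encGraph (dom R) R) '' {R' | R' ∈ F.M.solutions φ ∧ key R' ≤ key R}

/-- The solutions in `Y` have still to be output, and the first of them is `A 21`. -/
def Pending (x : Word 18) (F : FinModel) (φ : CTL ℕ) (Y : Finset (Word 18)) (s : St) : Prop :=
  Parsed x F s.A ∧ s.buf = [] ∧ ((¬ s.A 0 0 0 ∧ Y = ∅) ∨ (s.A 0 0 0 ∧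
    ∃ R ∈ F.M.solutions φ, s.A 21 = edgeRel R ∧ (Y : Set (Word 18)) = upTo F φ R))

section

variable {x : Word 18} {F : FinModel} {φ : CTL ℕ}

theorem upTo_nonempty {R : Set (Fin F.n × Fin F.n)} (hR : R ∈ F.M.solutions φ) :
    encGraph (dom R) R ∈ upTo F φ R := ⟨R, ⟨hR, le_rfl⟩, rfl⟩

/-- Both the key and the encoded graph determine the relation, so removing the printed word removes
exactly `R`. -/
theorem upTo_diff {R : Set (Fin F.n × Fin F.n)} : upTo F φ R \ {encGraph (dom R) R} =
    (fun R => encGraph (dom R) R) '' {R' | R' ∈ F.M.solutions φ ∧ key R' < key R} := by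
  ext y
  constructor
  · rintro ⟨⟨R', ⟨h1, h2⟩, rfl⟩, h3⟩
    refine ⟨R', ⟨h1, lt_of_le_of_ne h2 fun h => h3 ?_⟩, rfl⟩
    rw [key_injective h]
    rfl
  · rintro ⟨R', ⟨h1, h2⟩, rfl⟩
    refine ⟨⟨R', ⟨h1, h2.le⟩, rfl⟩, fun h => ?_⟩
    rw [encGraph_inj h] at h2
    exact lt_irrefl _ h2

/-- The pending solutions are always those with key at most that of the current one. Removing the
current one leaves the strictly smaller keys, which `next_none` shows to be absent or `next_some`
turns into the same form for the new solution. -/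
theorem enumInvariant_pending (hφ : φ.PosExistential) {a : ℕ}
    (ho : Occ x (encFormula φ) a) (hlast : x.length = a + (encFormula φ).length) :
    EnumInvariant x .output .next (Pending x F φ) := by
  classical
  have hout : ∀ Y s, Pending x F φ Y s → Y.Nonempty → ∃ R ∈ F.M.solutions φ, s.A 21 = edgeRel R ∧
      (Y : Set (Word 18)) = upTo F φ R ∧
      (Cmd.output.eval x (fun _ => 0) s).buf = encGraph (dom R) R := by
    rintro Y s ⟨h1, h2, ⟨-, rfl⟩ | ⟨-, R, h4, h5, h6⟩⟩ hne
    · simp at hne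
    · refine ⟨R, h4, h5, h6, ?_⟩
      rw [Cmd.eval_output h1 h5, h2, List.nil_append]
  refine ⟨fun Y s h => h.2.1, ?_, ?_, ?_⟩
  · rintro Y s ⟨h1, h2, ⟨h3, rfl⟩ | ⟨h3, R, h4, h5, h6⟩⟩
    · simp [h3]
    · refine iff_of_true h3 ?_
      rw [← Finset.coe_nonempty, h6]
      exact ⟨_, upTo_nonempty h4⟩
  · intro Y s h hne
    obtain ⟨R, h1, h2, h3, h4⟩ := hout Y s h hne
    rw [h4, ← Finset.mem_coe, h3]
    exact upTo_nonempty h1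
  · intro Y s h hne
    obtain ⟨R, hR, h21, hY, hbuf⟩ := hout Y s h hne
    rw [hbuf]
    have hA : (Cmd.output.eval x (fun _ => 0) s).A = s.A :=
      funext fun a => Cmd.eval_frame _ (Cmd.writes_output a) _ _
    change Pending x F φ _ (Cmd.next.eval x (fun _ => 0)
      { A := (Cmd.output.eval x (fun _ => 0) s).A, buf := [] })
    rw [hA]
    set s0 : St := { A := s.A, buf := [] } with hs0
    have hP0 : Parsed x F s0.A := h.1
    have hP : Parsed x F (Cmd.next.eval x (fun _ => 0) s0).A := hP0.frame _ (by decide)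
    have hb : (Cmd.next.eval x (fun _ => 0) s0).buf = [] := Cmd.eval_buf _ (by decide) _ _
    refine ⟨hP, hb, ?_⟩
    have hY' : ((Y.erase (encGraph (dom R) R) : Finset (Word 18)) : Set (Word 18)) =
        (fun R => encGraph (dom R) R) '' {R' | R' ∈ F.M.solutions φ ∧ key R' < key R} := by
      rw [Finset.coe_erase, hY, upTo_diff]
    have h0 : (Cmd.next.eval x (fun _ => 0) s0).A 0 0 0 ↔ ((Cmd.forv 0 (.forv 1 .branch)).eval x
        (fun _ => 0) ((Cmd.asg 23 4 5 .fls).eval x (fun _ => 0) s0)).A 23 0 0 := by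
      simp only [Cmd.next, Cmd.eval.eq_2]
      rw [Cmd.eval_asg]
      simp only [Fm.sat_simps, Nat.reduceEqDiff, if_true, if_false]
      simp (disch := decide) only [Cmd.eval_frame]
    have h21' : (Cmd.next.eval x (fun _ => 0) s0).A 21 = ((Cmd.forv 0 (.forv 1 .branch)).eval x
        (fun _ => 0) ((Cmd.asg 23 4 5 .fls).eval x (fun _ => 0) s0)).A 22 := by
      simp only [Cmd.next, Cmd.eval.eq_2]
      simp (disch := decide) only [Cmd.eval_frame]
      rw [Cmd.eval_asg]
      simp only [Fm.sat_simps, Nat.reduceEqDiff, if_true, if_false]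
    rw [h0, h21']
    rcases Cmd.eval_scan (fun _ => 0) (s := (Cmd.asg 23 4 5 .fls).eval x (fun _ => 0) s0)
      (hP0.frame _ (by decide)) (by simpa (disch := decide) only [Cmd.eval_frame] using h21) hφ ho
      hlast (by rw [Cmd.eval_asg]; simp [Fm.fls]) with ⟨g1, g2⟩ | ⟨g1, e, g2, g3, g4⟩
    · refine .inl ⟨g1, ?_⟩
      rw [← Finset.coe_eq_empty, hY', Set.image_eq_empty, Set.eq_empty_iff_forall_notMem]
      rintro R' ⟨h1, h2⟩
      exact next_none hφ (fun e => g2 e trivial) h1 h2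
    · refine .inr ⟨g1, _, g2.mem_solutions hR, g3, ?_⟩
      rw [hY', upTo]
      congr 1
      ext R'
      exact and_congr_right fun h1 => next_some hφ g2 (fun e' => g4 e' trivial) h1

/-- Every solution is contained in the largest connected submodel. So either that is a solution with
maximal key, and everything is pending, or there is no solution at all. -/
theorem pending_first (hφ : φ.PosExistential) {a : ℕ} (hM : ModelAt x F)
    (ho : Occ x (encFormula φ) a) (hlast : x.length = a + (encFormula φ).length)
    {Y : Finset (Word 18)}
    (hY : (Y : Set (Word 18)) = (fun R => encGraph (dom R) R) '' F.M.solutions φ) :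
    Pending x F φ Y (Cmd.first.eval x (fun _ => 0) St.init) := by
  simp only [Cmd.first, Cmd.eval.eq_2]
  set s1 := Cmd.parse.eval x (fun _ => 0) St.init with hs1
  have h1 : Parsed x F s1.A := Cmd.eval_parse hM _ _
  set s2 := (Cmd.asg 11 4 5 (.arr 4 4 5)).eval x (fun _ => 0) s1 with hs2
  have h2 : Parsed x F s2.A := h1.frame _ (by decide)
  have h11 : s2.A 11 = edgeRel F.M.R := by
    rw [hs2, Cmd.eval_asg, ← h1.edge]
    simp only [Fm.sat_simps, Nat.reduceEqDiff, if_true, if_false]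
  set s3 := Cmd.largest.eval x (fun _ => 0) s2 with hs3
  have h3 : Parsed x F s3.A := h2.frame _ (by decide)
  obtain ⟨h14, h20⟩ := Cmd.eval_largest (fun _ => 0) h2 h11 hφ ho hlast
  rw [← hs3] at h14 h20
  refine ⟨(h3.frame _ (by decide)).frame _ (by decide), ?_, ?_⟩
  · rw [Cmd.eval_buf _ (by decide), Cmd.eval_buf _ (by decide), hs3, Cmd.eval_buf _ (by decide), hs2,
      Cmd.eval_buf _ (by decide), hs1, Cmd.eval_buf _ (by decide)]
    rfl
  · have e0 : ((Cmd.asg 0 4 5 (.arr 20 4 5)).eval x (fun _ => 0)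
        ((Cmd.asg 21 4 5 (.arr 14 4 5)).eval x (fun _ => 0) s3)).A 0 0 0 ↔
        F.M.RestrictModels F.M.R (live F.M.R F.M.r) φ := by
      rw [Cmd.eval_asg]
      simp only [Fm.sat_simps, Nat.reduceEqDiff, if_true, if_false]
      simp (disch := decide) only [Cmd.eval_frame]
      exact h20 0 0
    have e21 : ((Cmd.asg 0 4 5 (.arr 20 4 5)).eval x (fun _ => 0)
        ((Cmd.asg 21 4 5 (.arr 14 4 5)).eval x (fun _ => 0) s3)).A 21 =
        edgeRel (F.M.best F.M.R) := by
      simp (disch := decide) only [Cmd.eval_frame]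
      rw [Cmd.eval_asg]
      simpa only [Fm.sat_simps, Nat.reduceEqDiff, if_true, if_false] using h14
    rw [e0, e21]
    by_cases hs : F.M.RestrictModels F.M.R (live F.M.R F.M.r) φ
    · refine .inr ⟨hs, _, best_mem_solutions subset_rfl hs, rfl, ?_⟩
      rw [hY, upTo]
      congr 1
      ext R'
      exact ⟨fun h => ⟨h, key_mono (subset_best hφ h (solutions_subset h)).1⟩, fun h => h.1⟩
    · refine .inl ⟨hs, ?_⟩
      rw [← Finset.coe_eq_empty, hY, Set.image_eq_empty, Set.eq_empty_iff_forall_notMem]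
      exact fun R' h => hs (subset_best hφ h (solutions_subset h)).2

end

theorem eSubmodels_inDelP : InDelP (ESubmodels {φ : CTL ℕ | φ.PosExistential}) := by
  refine inDel_of_cmd extendSubmodel_mem_classP (c := .first) (p := .output) (d := .next)
    (by decide) (by decide) (by decide) ?_
  rintro x ⟨F, φ, hφ, hx⟩
  have hall : ∀ (F : FinModel) (φ : CTL ℕ), φ.PosExistential → x = encInstance F φ →
      ∃ Y : Finset (Word 18),
        (Y : Set (Word 18)) = (fun R => encGraph (dom R) R) '' F.M.solutions φ ∧
        EnumInvariant x .output .next (Pending x F φ) ∧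
        Pending x F φ Y (Cmd.first.eval x (fun _ => 0) St.init) := by
    intro F φ hφ hx
    have hM : ModelAt x F :=
      (Occ.of_eq (pre := []) (w := encModel F) (suf := encFormula φ) hx).modelAt
    have ho : Occ x (encFormula φ) (encModel F).length :=
      Occ.of_eq (suf := []) (by rw [hx, encInstance, List.append_nil])
    have hlast : x.length = (encModel F).length + (encFormula φ).length := by
      rw [hx, encInstance, List.length_append]
    have hfin := (Set.toFinite (F.M.solutions φ)).image fun R => encGraph (dom R) R
    exact ⟨hfin.toFinset, hfin.coe_toFinset, enumInvariant_pending hφ ho hlast,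
      pending_first hφ hM ho hlast hfin.coe_toFinset⟩
  obtain ⟨Y, h1, h2, h3⟩ := hall F φ hφ hx
  refine ⟨_, Y, h2, h3, ?_⟩
  have hsol : ∀ (F : FinModel) (φ : CTL ℕ) (y : Word 18),
      y ∈ (fun R => encGraph (dom R) R) '' F.M.solutions φ ↔
      ∃ M' : KripkeModel (Fin F.n) ℕ, M'.IsConnectedSubmodel F.M ∧ M'.Models φ ∧
        y = encGraph M'.W M'.R := by
    intro F φ y
    constructor
    · rintro ⟨_, ⟨N, g1, g2, rfl⟩, rfl⟩
      exact ⟨N, g1, g2, by rw [W_eq_dom]⟩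
    · rintro ⟨N, g1, g2, rfl⟩
      exact ⟨N.R, ⟨N, g1, g2, rfl⟩, by rw [W_eq_dom]⟩
  ext y
  constructor
  · intro hy
    rw [h1, hsol] at hy
    exact ⟨F, φ, hφ, hx, hy⟩
  · rintro ⟨F', φ', hφ', hx', hy⟩
    -- Another decoding of `x` describes the same run of the program, hence the same set of words.
    obtain ⟨Y', g1, g2, g3⟩ := hall F' φ' hφ' hx'
    rw [← hsol, ← g1] at hy
    rwa [h2.unique g2 h3 g3]

end SubmodelEnum

/-! ### Assembly of the four claims -/

theorem mainTheorem9 :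
    -- submodel enumeration for the fragment is in `DelP`
    InDelP (ESubmodels {φ : CTL ℕ | φ.PosExistential}) ∧
    -- formulas of the fragment are preserved upward from submodels
    (∀ (V P : Type*) (M M' : KripkeModel V P) (φ : CTL P), φ.PosExistential →
      M'.IsSubmodel M → M'.Models φ → M.Models φ) ∧
    -- a partial solution `D` can be extended if and only if `M - D` is a model of the formula
    (∀ (V P : Type*) (M N : KripkeModel V P) (φ : CTL P) (D : Set V × Set (V × V)),
      φ.PosExistential → M.IsDeletion D N → (M.Extendable φ D ↔ N.Models φ)) ∧
    -- model checking `M - D` and the extension problem take polynomial time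
    DeletionModelChecking {φ : CTL ℕ | φ.PosExistential} ∈ classP 18 ∧
    ExtendSubmodel {φ : CTL ℕ | φ.PosExistential} ∈ classP 18 := by
  exact ⟨eSubmodels_inDelP,
    fun _ _ _ _ _ hφ h hs => h.models hφ hs,
    fun _ _ _ _ _ _ hφ h => KripkeModel.extendable_iff hφ h,
    deletionModelChecking_mem_classP, extendSubmodel_mem_classP⟩
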